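/- **Universes and profiles.** Let $V$ be a set. For pairs of subsets of $V$ put $(A,B)\le(C,D)$ if $A\subseteq C$ and $D\subseteq B$, $(A,B)\wedge(C,D)=(A\cap C,B\cup D)$, $(A,B)\vee(C,D)=(A\cup C,B\cap D)$, $(A,B)^*=(B,A)$, and let the order of $(A,B)$ be $|A\cap B|$ if this is finite and $\infty$ otherwise. A universe of vertex separations on $V$ is a set $U$ of pairs $(A,B)$ with $A\cup B=V$, closed under $\wedge$, $\vee$ and $^*$; its elements are called separations. It is limit-closed if for every integer $k\ge 0$ and every nonempty $\le$-chain $(A_i,B_i)_i$ in $U$ of separations of order at most $k$, the supremum of the chain in $U$ exists, has order at most $k$, and is of the form $(\bigcup_i A_i\cup X,\bigcap_i B_i)$ for some $X\subseteq V$. Let $S_k$ be the set of separations in $U$ of order less than $k$. A $k$-profile is a set $P\subseteq S_k$ such that: for every $s\in S_k$ exactly one element of the set $\{s,s^*\}$ is in $P$; if $r,s\in P$ and $r^*\le s$ then $\{r,r^*\}=\{s,s^*\}$; and $(r\vee s)^*\notin P$ for all $r,s\in P$. A separation $s$ distinguishes two profiles if exactly one of them contains $s$. **Cyclic orders.** Cyclic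 orders are linear (any three distinct elements are oriented). For elements $a,b$ of a cyclically ordered set, $[a,b]$ consists of $a$, $b$ and all $c$ such that $(a,c,b)$ is in the cyclic order. An interval of $I$ is a subset $J$ with $[s,t]\subseteq J$ or $[t,s]\subseteq J$ for all $s,t\in J$; it is non-trivial if $J\ne\emptyset$ and $J\neq I$. For a cyclically ordered set $I$ with at least two elements, a cycle completion $C(I)$ is a cyclically ordered set containing $I$ with the induced order such that every non-trivial interval of $I$ is $[v,w]\cap I$ for exactly one pair $v,w\in C(I)\setminus I$ (it exists and is unique up to a unique isomorphism fixing $I$). The elements of $C(I)\setminus I$ are called cutpoints. **Pseudoflowers.** A $k$-pseudoflower $\Phi$ consists of a cyclically ordered set $I$ with at least two elements and a family $(P_z)_{z\in C(I)}$ of subsets of $V$ such that, with $X=V\setminus\bigcup_{z}P_z$, $V(v,w)=X\cup\bigcup_{z\in[v,w]}P_z$ and $S(v,w)=(V(v,w),V(w,v))$, 1. $|P_v|=(k-|X|)/2$ for every cutpoint $v$; 2. for all distinct cutpoints $v,w$ the pair $S(v,w)$ is a separation in $U$ of order at most $k$, and $V(v,w)\cap V(w,v)=P_v\cup P_w\cup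 X$; 3. $P_p\cup P_s\subseteq P_i$ for every $i\in I$ with predecessor $p$ and successor $s$ in $C(I)$; 4. if $i,i'\in I$, $|P_i|=(k-|X|)/2$ and $P_i=P_{i'}$, then $i=i'$. For $k$-pseudoflowers $\Phi$ (with $I,P,X,V(\cdot,\cdot)$) and $\Phi'$ (with $I',P',X'$) write $\Phi\le\Phi'$ ($\Phi'$ extends $\Phi$) if $X=X'$ and there is a surjective map $F:C(I')\to C(I)$ with $F(I')=I$ such that $(x,y,z)$ is in the cyclic order of $C(I')$ whenever $(F(x),F(y),F(z))$ is in that of $C(I)$, and $V(v,w)=X\cup\bigcup_{z\in F^{-1}([v,w])}P'_z$ for all cutpoints $v,w\in C(I)\setminus I$. A $k$-pseudoflower $\Psi$ is $\le$-maximal if $\Psi\le\Psi'$ implies $\Psi'\le\Psi$ for every $k$-pseudoflower $\Psi'$. A $(k+1)$-profile $P$ is located by $\Phi$ if there is a cutpoint $v$ such that either $S(v,w)\in P$ for all cutpoints $w\ne v$, or $S(w,v)\in P$ for all cutpoints $w\neq v$. $\Phi$ distinguishes two profiles if $S(v,w)$ distinguishes them for some distinct cutpoints $v,w$. **Theorem.**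 Let $U$ be a limit-closed universe of vertex separations on $V$, let $k\ge0$ be an integer, and let $\mathcal P$ be a set of $(k+1)$-profiles of $U$ such that no separation of order less than $k$ distinguishes two elements of $\mathcal P$. Let $\Phi$ be a $k$-pseudoflower for which there are three elements of $\mathcal P$ that are located by $\Phi$ and pairwise distinguished by $\Phi$. Then there is a $\le$-maximal $k$-pseudoflower $\Psi$ with $\Phi\le\Psi$. -/

import Mathlib

universe u

/-! ## Separations and universes of vertex separations -/

/-- An ordered pair `(A, B)` of vertex sets. -/
@[ext]
structure VPair (V : Type u) where
  left : Set V
  right : Set V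

namespace VPair

variable {V : Type u}

/-- `(A, B) ≤ (C, D)` if and only if `A ⊆ C` and `D ⊆ B`. -/
instance : PartialOrder (VPair V) where
  le s t := s.left ⊆ t.left ∧ t.right ⊆ s.right
  le_refl _ := ⟨subset_rfl, subset_rfl⟩
  le_trans _ _ _ h₁ h₂ := ⟨h₁.1.trans h₂.1, h₂.2.trans h₁.2⟩
  le_antisymm _ _ h₁ h₂ :=
    VPair.ext (Set.Subset.antisymm h₁.1 h₂.1) (Set.Subset.antisymm h₂.2 h₁.2)

/-- The inverse `(B, A)` of `(A, B)`. -/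
def inv (s : VPair V) : VPair V := ⟨s.right, s.left⟩

/-- `(A, B) ∧ (C, D) = (A ∩ C, B ∪ D)`. -/
def inf (s t : VPair V) : VPair V := ⟨s.left ∩ t.left, s.right ∪ t.right⟩

/-- `(A, B) ∨ (C, D) = (A ∪ C, B ∩ D)`. -/
def sup (s t : VPair V) : VPair V := ⟨s.left ∪ t.left, s.right ∩ t.right⟩

/-- The order of `(A, B)`: the size of `A ∩ B` if that is finite, and `∞` otherwise. -/
noncomputable def order (s : VPair V) : ℕ∞ := (s.left ∩ s.right).encard

end VPair

/-- A universe of vertex separations on the ground set `V`. -/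
structure VertexUniverse (V : Type u) where
  /-- the separations of the universe -/
  seps : Set (VPair V)
  cover : ∀ s ∈ seps, s.left ∪ s.right = Set.univ
  inv_mem : ∀ s ∈ seps, s.inv ∈ seps
  inf_mem : ∀ s ∈ seps, ∀ t ∈ seps, s.inf t ∈ seps
  sup_mem : ∀ s ∈ seps, ∀ t ∈ seps, s.sup t ∈ seps

namespace VertexUniverse

variable {V : Type u}

/-- Every nonempty chain of separations `(A_i, B_i)` of order at most `k` has a supremum in the
universe, which has order at most `k` and is of the form `(⋃ A_i ∪ X, ⋂ B_i)`. -/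
def IsLimitClosed (U : VertexUniverse V) : Prop :=
  ∀ (k : ℕ) (c : Set (VPair V)), c ⊆ U.seps → c.Nonempty → IsChain (· ≤ ·) c →
    (∀ s ∈ c, s.order ≤ (k : ℕ∞)) →
    ∃ t : VPair V, IsLeast (upperBounds c ∩ U.seps) t ∧ t.order ≤ (k : ℕ∞) ∧
      ∃ X : Set V, t.left = (⋃ s ∈ c, s.left) ∪ X ∧ t.right = ⋂ s ∈ c, s.right

/-- The separation system `S_k`: the separations of order less than `k`. -/
def sepsLT (U : VertexUniverse V) (k : ℕ) : Set (VPair V) :=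
  {s | s ∈ U.seps ∧ s.order < (k : ℕ∞)}

/-- `O` is a consistent orientation of `S_k`. -/
structure IsConsistentOrientation (U : VertexUniverse V) (k : ℕ) (O : Set (VPair V)) : Prop where
  subset : O ⊆ U.sepsLT k
  /-- exactly one element of the set `{s, s*}` lies in `O` -/
  exactly_one : ∀ s ∈ U.sepsLT k, ∃! t, t ∈ ({s, s.inv} : Set (VPair V)) ∧ t ∈ O
  consistent : ∀ r ∈ O, ∀ s ∈ O, r.inv ≤ s → ({r, r.inv} : Set (VPair V)) = {s, s.inv}

/-- `P` is a `k`-profile. -/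
structure IsProfile (U : VertexUniverse V) (k : ℕ) (P : Set (VPair V)) : Prop where
  orientation : U.IsConsistentOrientation k P
  profile : ∀ r ∈ P, ∀ s ∈ P, (r.sup s).inv ∉ P

end VertexUniverse

/-- The separation `s` distinguishes the profiles `P` and `Q`: they orient `s` differently. -/
def Distinguishes {V : Type u} (s : VPair V) (P Q : Set (VPair V)) : Prop :=
  (s ∈ P ∧ s ∉ Q) ∨ (s ∈ Q ∧ s ∉ P)

/-! ## Cyclic orders

A (linear) cyclic order is a `CircularOrder`; the set of triples is given by the strict relation
`sbtw`. -/

section Cyclic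

variable {C : Type u} [CircularOrder C]

/-- The arc `[a, b]`, consisting of `a`, `b` and all `c` with `(a, c, b)` in the cyclic order.
(Unlike `Set.cIcc`, this gives `[a, a] = {a}`.) -/
def closedArc (a b : C) : Set C := {a, b} ∪ {c | sbtw a c b}

/-- `J` is an interval of the set `I` with its induced cyclic order. -/
def IsCyclicInterval (I J : Set C) : Prop :=
  J ⊆ I ∧ ∀ s ∈ J, ∀ t ∈ J, closedArc s t ∩ I ⊆ J ∨ closedArc t s ∩ I ⊆ J

/-- `C` is a cycle completion of its subset `I` (with the induced cyclic order): `I` has at least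
two elements and every non-trivial interval of `I` can uniquely be written as `[v, w] ∩ I` with
`v, w ∈ C \ I`. -/
structure IsCycleCompletion (I : Set C) : Prop where
  nontrivial : I.Nontrivial
  existsUnique : ∀ J : Set C, IsCyclicInterval I J → J ≠ ∅ → J ≠ I →
    ∃! p : C × C, p.1 ∉ I ∧ p.2 ∉ I ∧ J = closedArc p.1 p.2 ∩ I

/-- `s` is the successor of `a` (equivalently, `a` is the predecessor of `s`). -/
def IsCyclicSucc (a s : C) : Prop :=
  s ≠ a ∧ ∀ b, b ≠ a → b ≠ s → b ∉ closedArc a s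

/-- Maps respecting the cyclic orders. -/
def CyclicMonotone {C' : Type u} [CircularOrder C'] (F : C' → C) : Prop :=
  ∀ x y z : C', sbtw (F x) (F y) (F z) → sbtw x y z

end Cyclic

/-! ## Pseudoflowers -/

section Families

variable {V C : Type u}

/-- The set `X` of vertices that lie in none of the sets `P_v`. -/
def centre (P : C → Set V) : Set V := (⋃ v, P v)ᶜ

variable [CircularOrder C]

/-- `V(v, w)`, the union of `X` and all `P_z` with `z ∈ [v, w]`. -/
def intervalSet (P : C → Set V) (v w : C) : Set V :=
  (⋃ z ∈ closedArc v w, P z) ∪ centre P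

/-- `S(v, w) = (V(v, w), V(w, v))`. -/
def intervalSep (P : C → Set V) (v w : C) : VPair V :=
  ⟨intervalSet P v w, intervalSet P w v⟩

end Families

/-- A `k`-pseudoflower in `U`: a cyclically ordered set `I`, its cycle completion `C = C(I)`
(with set of cutpoints `C \ I`) and a family `P` of vertex sets indexed by `C`. The equation
`|P_v| = (k - |X|) / 2` is written as `2 |P_v| + |X| = k`. -/
structure Pseudoflower {V : Type u} (U : VertexUniverse V) (k : ℕ) where
  C : Type u
  [circularOrder : CircularOrder C]
  I : Set C
  isCycleCompletion : IsCycleCompletion I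
  P : C → Set V
  encard_cutpoint : ∀ v, v ∉ I → 2 * (P v).encard + (centre P).encard = (k : ℕ∞)
  sep_mem : ∀ v, v ∉ I → ∀ w, w ∉ I → v ≠ w → intervalSep P v w ∈ U.seps
  sep_order : ∀ v, v ∉ I → ∀ w, w ∉ I → v ≠ w → (intervalSep P v w).order ≤ (k : ℕ∞)
  separator : ∀ v, v ∉ I → ∀ w, w ∉ I → v ≠ w →
    intervalSet P v w ∩ intervalSet P w v = P v ∪ P w ∪ centre P
  neighbor_subset : ∀ i ∈ I, ∀ p s, IsCyclicSucc p i → IsCyclicSucc i s → P p ∪ P s ⊆ P i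
  petal_injective : ∀ i ∈ I, ∀ i' ∈ I,
    2 * (P i).encard + (centre P).encard = (k : ℕ∞) → P i = P i' → i = i'

namespace Pseudoflower

attribute [instance] Pseudoflower.circularOrder

variable {V : Type u} {U : VertexUniverse V} {k : ℕ}

/-- `Φ ≤ Ψ`: the `k`-pseudoflower `Ψ` extends `Φ`. -/
instance : LE (Pseudoflower U k) where
  le Φ Ψ := centre Φ.P = centre Ψ.P ∧
    ∃ F : Ψ.C → Φ.C, Function.Surjective F ∧ CyclicMonotone F ∧ F '' Ψ.I = Φ.I ∧
      ∀ v, v ∉ Φ.I → ∀ w, w ∉ Φ.I →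
        intervalSet Φ.P v w = centre Φ.P ∪ ⋃ z ∈ F ⁻¹' closedArc v w, Ψ.P z

/-- The profile `Q` is located by `Φ`. -/
def Locates (Φ : Pseudoflower U k) (Q : Set (VPair V)) : Prop :=
  ∃ v, v ∉ Φ.I ∧
    ((∀ w, w ∉ Φ.I → w ≠ v → intervalSep Φ.P v w ∈ Q) ∨
      (∀ w, w ∉ Φ.I → w ≠ v → intervalSep Φ.P w v ∈ Q))

/-- `Φ` distinguishes `Q` and `Q'`: some interval separation of `Φ` distinguishes them. -/
def DistinguishesProfiles (Φ : Pseudoflower U k) (Q Q' : Set (VPair V)) : Prop :=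
  ∃ v, v ∉ Φ.I ∧ ∃ w, w ∉ Φ.I ∧ v ≠ w ∧ Distinguishes (intervalSep Φ.P v w) Q Q'

end Pseudoflower

/-! No chain of pseudoflowers is considered: a maximal extension is written down directly, by
subdividing all petals of the given pseudoflower at once.

The profiles serve only to produce a tripod. Three located, pairwise distinguished profiles live in
three different arcs of the cyclic order (`Separates.before_or_before`, `exists_isTripod`). This
yields cutpoints a, b, c with pairwise disjoint sets such that every separation of order at most k
between S(a,b) and S(a,c), and cyclically, has order exactly k. Hence each petal i, with predecessor
p and successor s, has an opposite cutpoint w among a, b, c whose set is disjoint from that of i.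
Every split of i, that is, every separation of order at most k between S(w,p) and S(w,s), then meets
the petal in a cutset of the size required of a cutpoint (`IsOpposite.encard_cutset`).

In each petal a maximal chain of splits is chosen. Limit-closedness and maximality make it complete.
The splits become new cutpoints and the jumps of the chain become new petals. A chain may have
stretches without jumps, whereas distinct cutpoints must have a petal between them. For every cutset
occurring anywhere, therefore, one split realising it is selected and doubled, which inserts a petal
whose vertex set is that cutset. Only one split is doubled because the last axiom forbids two such
petals with the same set. One suffices because equal cutsets force constancy on a stretch of the
chain, and constancy forces a jump (`exists_isJump_between`).

Seen from w, a new cutpoint has as its interval separation the chosen split itself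
(`intervalSep_opp`). All other interval separations are corners of ones already known to lie in U,
and disjoint sets at the auxiliary cutpoints make the corners correct (`intervalSep_eq_inf`).

Finally, let F witness an extension of the subdivision. A cutpoint mapped into a petal would give a
split inside a jump. By maximality of the chain this split is an end of the jump, so some petal of
the extension has a cutset as its vertex set; the doubled petal with that cutset rules this out
(`map_notMem_petals`). Thus F is injective and the extension can be reversed. -/

/-! ### Linearizing circular orders -/

section CircularOrders

variable {C : Type u} [CircularOrder C]

/-- The circular order of `C` is induced by the linear order `lo`. -/
def IsLinearization (lo : LinearOrder C) : Prop :=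
  ∀ x y z : C, sbtw x y z ↔ (lo.lt x y ∧ lo.lt y z) ∨ (lo.lt y z ∧ lo.lt z x) ∨
    (lo.lt z x ∧ lo.lt x y)

theorem sbtw_or_sbtw_of_ne {a b c : C} (hab : a ≠ b) (hbc : b ≠ c) (hca : c ≠ a) :
    sbtw a b c ∨ sbtw c b a := by
  rw [sbtw_iff_not_btw, sbtw_iff_not_btw]
  by_contra! h
  rcases btw_antisymm h.1 h.2 with h | h | h
  · exact hbc h.symm
  · exact hab h.symm
  · exact hca h.symm

/-- Every circular order can be cut open at any of its elements. -/
theorem exists_isLinearization (u : C) :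
    ∃ lo : LinearOrder C, (∀ x, lo.le u x) ∧ IsLinearization lo := by
  classical
  have rot : ∀ {a b c : C}, sbtw a b c → sbtw b c a := fun h => h.cyclic_left
  have asym : ∀ {a b c : C}, sbtw a b c → ¬ sbtw c b a := fun h => h.not_sbtw
  have irr : ∀ {a b : C}, ¬ sbtw a b a := fun h => asym h h
  have irr1 : ∀ {a b : C}, ¬ sbtw a a b := fun h => irr (rot h)
  have irr2 : ∀ {a b : C}, ¬ sbtw a b b := fun h => irr (rot (rot h))
  have tr : ∀ {a b c d : C}, sbtw a b c → sbtw b d c → sbtw a d c := fun h h' => sbtw_trans_left h h'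
  have tr' : ∀ {u x y z : C}, sbtw u x y → sbtw u y z → sbtw u x z :=
    fun h h' => rot (rot (tr (rot h) (rot h')))
  -- The element u comes first, and x precedes y among the others when (u, x, y) is in the cyclic
  -- order.
  let lo : LinearOrder C :=
    { le := fun x y => x = y ∨ (x = u ∧ y ≠ u) ∨ sbtw u x y
      lt := fun x y => (x = u ∧ y ≠ u) ∨ sbtw u x y
      le_refl := fun x => Or.inl rfl
      le_trans := by
        rintro x y z (rfl | ⟨rfl, hy⟩ | h) (rfl | ⟨rfl, hz⟩ | h')
        · exact Or.inl rfl
        · exact Or.inr (Or.inl ⟨rfl, hz⟩)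
        · exact Or.inr (Or.inr h')
        · exact Or.inr (Or.inl ⟨rfl, hy⟩)
        · exact absurd rfl hy
        · refine Or.inr (Or.inl ⟨rfl, ?_⟩)
          rintro rfl
          exact irr h'
        · exact Or.inr (Or.inr h)
        · exact absurd h irr
        · exact Or.inr (Or.inr (tr' h h'))
      lt_iff_le_not_ge := by
        intro x y
        constructor
        · rintro (⟨rfl, hy⟩ | h)
          · refine ⟨Or.inr (Or.inl ⟨rfl, hy⟩), ?_⟩
            rintro (h | ⟨h, -⟩ | h)
            · exact hy h
            · exact hy h
            · exact irr h
          · refine ⟨Or.inr (Or.inr h), ?_⟩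
            rintro (rfl | ⟨rfl, -⟩ | h')
            · exact irr2 h
            · exact irr h
            · exact asym h (rot h')
        · rintro ⟨rfl | h, h'⟩
          · exact absurd (Or.inl rfl) h'
          · exact h
      le_antisymm := by
        rintro x y (rfl | ⟨rfl, hy⟩ | h) (h' | ⟨h', hx⟩ | h')
        · rfl
        · rfl
        · rfl
        · exact h'.symm
        · exact absurd h' hy
        · exact absurd h' irr
        · exact h'.symm
        · subst h'; exact absurd h irr
        · exact absurd (rot h') (asym h)
      le_total := by
        intro x y
        by_cases hxy : x = y
        · exact Or.inl (Or.inl hxy)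
        by_cases hx : x = u
        · exact Or.inl (Or.inr (Or.inl ⟨hx, fun h => hxy (hx.trans h.symm)⟩))
        by_cases hy : y = u
        · exact Or.inr (Or.inr (Or.inl ⟨hy, hx⟩))
        rcases sbtw_or_sbtw_of_ne (Ne.symm hx) hxy hy with h | h
        · exact Or.inl (Or.inr (Or.inr h))
        · exact Or.inr (Or.inr (Or.inr (rot (rot h))))
      toDecidableLE := Classical.decRel _ }
  refine ⟨lo, fun x => ?_, fun x y z => ?_⟩
  · by_cases h : x = u
    · exact Or.inl h.symm
    · exact Or.inr (Or.inl ⟨rfl, h⟩)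
  · have key : ∀ {x y z : C}, lo.lt x y → lo.lt y z → sbtw x y z := by
      rintro x y z (⟨rfl, hy⟩ | h) (⟨rfl, hz⟩ | h')
      · exact absurd rfl hy
      · exact h'
      · exact absurd h irr
      · exact rot (tr (rot (rot h')) h)
    have hne : ∀ {x y : C}, x ≠ y → lo.lt x y ∨ lo.lt y x := fun {x y} h =>
      lt_or_gt_of_ne (α := C) h
    constructor
    · intro h
      have h1 : x ≠ y := fun e => by subst e; exact irr1 h
      have h2 : y ≠ z := fun e => by subst e; exact irr2 h
      have h3 : z ≠ x := fun e => by subst e; exact irr h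
      rcases hne h1 with a | a <;> rcases hne h2 with b | b <;> rcases hne h3 with c | c
      · exact Or.inl ⟨a, b⟩
      · exact Or.inl ⟨a, b⟩
      · exact Or.inr (Or.inr ⟨c, a⟩)
      · exact absurd (rot (key c b)) (asym h)
      · exact Or.inr (Or.inl ⟨b, c⟩)
      · exact absurd (rot (rot (key a c))) (asym h)
      · exact absurd (key b a) (asym h)
      · exact absurd (key b a) (asym h)
    · rintro (⟨a, b⟩ | ⟨a, b⟩ | ⟨a, b⟩)
      · exact key a b
      · exact rot (rot (key a b))
      · exact rot (key a b)

theorem mem_closedArc {a b c : C} : c ∈ closedArc a b ↔ c = a ∨ c = b ∨ sbtw a c b := by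
  simp [closedArc, or_assoc]

end CircularOrders

/-! ### Cycle completions and cuts -/

section CycleCompletions

variable {C : Type u} [CircularOrder C]

/-- This form uses the notation `<`, so that `grind` can apply its reasoning about linear orders
after rewriting. -/
theorem IsLinearization.grindable {lo : LinearOrder C} (h : IsLinearization lo) (x y z : C) :
    sbtw x y z ↔ (x < y ∧ y < z) ∨ (y < z ∧ z < x) ∨ (z < x ∧ x < y) := h x y z

/-- A lower set of `I`, with respect to a linearization, is a cyclic interval. -/
theorem isCyclicInterval_of_ordConnected {lo : LinearOrder C} (hlo : IsLinearization lo)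
    {I J : Set C} (hJI : J ⊆ I) (hJ : ∀ s ∈ J, ∀ t ∈ J, ∀ m ∈ I, s ≤ m → m ≤ t → m ∈ J) :
    IsCyclicInterval I J := by
  refine ⟨hJI, fun s hs t ht => ?_⟩
  rcases le_total s t with h | h
  · left
    rintro m ⟨hm, hmI⟩
    rw [mem_closedArc, hlo] at hm
    exact hJ s hs t ht m hmI (by grind) (by grind)
  · right
    rintro m ⟨hm, hmI⟩
    rw [mem_closedArc, hlo] at hm
    exact hJ t ht s hs m hmI (by grind) (by grind)

theorem IsCycleCompletion.exists_notMem {I : Set C} (h : IsCycleCompletion I) : ∃ u, u ∉ I := by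
  obtain ⟨i, hi, j, hj, hij⟩ := h.nontrivial
  obtain ⟨lo, -, hlo⟩ := exists_isLinearization i
  obtain ⟨p, ⟨hp, -⟩, -⟩ := h.existsUnique {i}
    (isCyclicInterval_of_ordConnected hlo (by simpa using hi) (by
      rintro s rfl t rfl m - h1 h2
      exact le_antisymm h2 h1)) (by simp) (by rintro rfl; simp at hj; exact hij hj.symm)
  exact ⟨_, hp⟩

/-- A proper nonempty lower set is an interval of I, hence of the form [v, w] ∩ I, and its second
end w is where it stops. -/
theorem IsCycleCompletion.exists_cut {I : Set C} (h : IsCycleCompletion I) {lo : LinearOrder C}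
    (hlo : IsLinearization lo) {L : Set C} (hLI : L ⊆ I)
    (hL : ∀ i ∈ L, ∀ m ∈ I, m ≤ i → m ∈ L) (hne : L ≠ ∅) (hneI : L ≠ I) :
    ∃ w, w ∉ I ∧ ∀ i ∈ I, i ∈ L ↔ i < w := by
  obtain ⟨⟨v, w⟩, ⟨hv, hw, hJ⟩, -⟩ := h.existsUnique L
    (isCyclicInterval_of_ordConnected hlo hLI fun s _ t ht m hm _ hmt => hL t ht m hm hmt) hne hneI
  simp only at hv hw hJ
  have hmem : ∀ i ∈ I, i ∈ L ↔ i = v ∨ i = w ∨ sbtw v i w := by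
    intro i hi
    rw [hJ]
    simp [mem_closedArc, hi]
  obtain ⟨l, hl⟩ := Set.nonempty_iff_ne_empty.2 hne
  obtain ⟨r, hrI, hr⟩ : ∃ r ∈ I, r ∉ L := by
    by_contra! hc
    exact hneI (Set.Subset.antisymm hLI hc)
  refine ⟨w, hw, fun i hi => ?_⟩
  have hlI := hLI hl
  have h1 := (hmem l hlI).1 hl
  have h2 := mt (hmem r hrI).2 hr
  have h3 := hmem i hi
  have h4 := hL l hl i hi
  have h5 : i ∈ L → r ≤ i → r ∈ L := fun h => hL i h r hrI
  rw [hlo] at h1 h2 h3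
  have : l ≠ v := fun e => hv (e ▸ hlI)
  have : l ≠ w := fun e => hw (e ▸ hlI)
  have : r ≠ v := fun e => hv (e ▸ hrI)
  have : r ≠ w := fun e => hw (e ▸ hrI)
  have : i ≠ v := fun e => hv (e ▸ hi)
  have : i ≠ w := fun e => hw (e ▸ hi)
  grind

theorem IsCycleCompletion.eq_of_closedArc_inter_eq {I : Set C} (h : IsCycleCompletion I)
    {lo : LinearOrder C} (hlo : IsLinearization lo) {J : Set C} (hJI : J ⊆ I)
    (hJ : ∀ s ∈ J, ∀ t ∈ J, ∀ m ∈ I, s ≤ m → m ≤ t → m ∈ J) (hne : J ≠ ∅) (hneI : J ≠ I)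
    {v w v' w' : C} (hv : v ∉ I) (hw : w ∉ I) (hv' : v' ∉ I) (hw' : w' ∉ I)
    (h1 : ∀ i ∈ I, i ∈ J ↔ i ∈ closedArc v w) (h2 : ∀ i ∈ I, i ∈ J ↔ i ∈ closedArc v' w') :
    v = v' ∧ w = w' := by
  have := (h.existsUnique J (isCyclicInterval_of_ordConnected hlo hJI hJ) hne hneI).unique
    (y₁ := (v, w)) (y₂ := (v', w')) ⟨hv, hw, ?_⟩ ⟨hv', hw', ?_⟩
  · simpa using this
  · ext i
    constructor
    · intro hi; exact ⟨(h1 i (hJI hi)).1 hi, hJI hi⟩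
    · rintro ⟨hi, hiI⟩; exact (h1 i hiI).2 hi
  · ext i
    constructor
    · intro hi; exact ⟨(h2 i (hJI hi)).1 hi, hJI hi⟩
    · rintro ⟨hi, hiI⟩; exact (h2 i hiI).2 hi

/-- If no element of I lay between v and w, then for a cutpoint x separating two elements of I the
arcs [v, x] and [w, x] would cut out the same interval, against uniqueness. -/
theorem IsCycleCompletion.exists_between {I : Set C} (h : IsCycleCompletion I) {v w : C}
    (hv : v ∉ I) (hw : w ∉ I) (hvw : v ≠ w) : ∃ i ∈ I, sbtw v i w := by
  by_contra! hno
  obtain ⟨lo, hbot, hlo⟩ := exists_isLinearization v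
  have hno' : ∀ i ∈ I, w < i := by
    intro i hi
    have h1 := hno i hi
    rw [hlo] at h1
    have : i ≠ v := fun e => hv (e ▸ hi)
    have : i ≠ w := fun e => hw (e ▸ hi)
    have := hbot i
    have := hbot w
    grind
  have key : ∀ i₀ ∈ I, ∀ i₁ ∈ I, i₀ < i₁ → False := by
    intro i₀ hi₀ i₁ hi₁ hlt
    obtain ⟨x, hx, hxL⟩ := h.exists_cut hlo (L := {i | i ∈ I ∧ i ≤ i₀}) (fun i hi => hi.1)
      (fun i hi m hm hmi => ⟨hm, hmi.trans hi.2⟩) (Set.nonempty_iff_ne_empty.1 ⟨i₀, hi₀, le_rfl⟩)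
      (fun e => by
        have : i₁ ∈ {i | i ∈ I ∧ i ≤ i₀} := by rw [e]; exact hi₁
        exact absurd this.2 (not_le.2 hlt))
    have hx0 := (hxL i₀ hi₀).1 ⟨hi₀, le_rfl⟩
    refine hvw (h.eq_of_closedArc_inter_eq hlo (J := {i | i ∈ I ∧ i < x}) (w := x) (w' := x)
      (fun i hi => hi.1) (fun s _ t ht m hm _ hmt => ⟨hm, hmt.trans_lt ht.2⟩)
      (Set.nonempty_iff_ne_empty.1 ⟨i₀, hi₀, hx0⟩) (fun e => ?_) hv hx hw hx ?_ ?_).1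
    · have h3 : i₁ ∈ {i | i ∈ I ∧ i < x} := by rw [e]; exact hi₁
      have := ((hxL i₁ hi₁).2 h3.2).2
      exact absurd this (not_le.2 hlt)
    · intro i hi
      have := hno' i hi
      have := hbot i
      have := hbot w
      have : i ≠ x := fun e => hx (e ▸ hi)
      simp only [Set.mem_ofPred_eq, mem_closedArc, hlo.grindable]
      grind
    · intro i hi
      have := hno' i hi
      have := hno' i₀ hi₀
      have := hbot w
      have : i ≠ x := fun e => hx (e ▸ hi)
      simp only [Set.mem_ofPred_eq, mem_closedArc, hlo.grindable]
      grind
  obtain ⟨i, hi, j, hj, hij⟩ := h.nontrivial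
  rcases lt_or_gt_of_ne hij with hlt | hlt
  · exact key i hi j hj hlt
  · exact key j hj i hi hlt

/-- The interval {i} is cut out by some [p, s]. Another cutpoint inside this arc would, by
`exists_between`, have elements of I on both of its sides, and both would be i. -/
theorem IsCycleCompletion.exists_pred_succ {I : Set C} (h : IsCycleCompletion I) {i : C}
    (hi : i ∈ I) : ∃ p s, p ∉ I ∧ s ∉ I ∧ p ≠ s ∧ IsCyclicSucc p i ∧ IsCyclicSucc i s ∧
      ∀ z, z = p ∨ z = i ∨ z = s ∨ sbtw s z p := by
  obtain ⟨lo, hbot, hlo⟩ := exists_isLinearization i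
  obtain ⟨j, hj, hji⟩ := h.nontrivial.exists_ne i
  obtain ⟨⟨p, s⟩, ⟨hp, hs, hJ⟩, -⟩ := h.existsUnique {i}
    (isCyclicInterval_of_ordConnected hlo (by simpa using hi) (by
      rintro s rfl t rfl m - h1 h2
      exact le_antisymm h2 h1)) (by simp) (by rintro rfl; simp at hj; exact hji hj)
  simp only at hp hs hJ
  have hpi : i ≠ p := fun e => hp (e ▸ hi)
  have hsi : i ≠ s := fun e => hs (e ▸ hi)
  have hmem : sbtw p i s := by
    have : i ∈ closedArc p s ∩ I := hJ ▸ rfl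
    rcases mem_closedArc.1 this.1 with e | e | e
    · exact absurd e hpi
    · exact absurd e hsi
    · exact e
  have honly : ∀ m, sbtw p m s → m = i := by
    intro m hm
    by_contra hne
    have hmI : m ∉ I := fun hmI => hne (by
      have : m ∈ ({i} : Set C) := by rw [hJ]; exact ⟨mem_closedArc.2 (Or.inr (Or.inr hm)), hmI⟩
      exact this)
    have hmp : p ≠ m := by rintro rfl; rw [hlo] at hm; grind
    have hms : m ≠ s := by rintro rfl; rw [hlo] at hm; grind
    obtain ⟨a, ha, ha'⟩ := h.exists_between hp hmI hmp
    obtain ⟨b, hb, hb'⟩ := h.exists_between hmI hs hms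
    have h1 : a = i := by
      have : a ∈ ({i} : Set C) := by
        rw [hJ]; exact ⟨mem_closedArc.2 (Or.inr (Or.inr (by rw [hlo] at *; grind))), ha⟩
      exact this
    have h2 : b = i := by
      have : b ∈ ({i} : Set C) := by
        rw [hJ]; exact ⟨mem_closedArc.2 (Or.inr (Or.inr (by rw [hlo] at *; grind))), hb⟩
      exact this
    subst h1; subst h2
    rw [hlo] at *
    grind
  refine ⟨p, s, hp, hs, ?_, ⟨hpi, ?_⟩, ⟨hsi.symm, ?_⟩, ?_⟩
  · rintro rfl; rw [hlo] at hmem; grind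
  · intro b hb hb' hm
    rw [mem_closedArc] at hm
    have := honly b
    rw [hlo] at *
    grind
  · intro b hb hb' hm
    rw [mem_closedArc] at hm
    have := honly b
    rw [hlo] at *
    grind
  · intro z
    have := honly z
    rw [hlo] at *
    grind

/-- The linear criterion for cycle completions. -/
theorem isCycleCompletion_of_cuts {I : Set C} (hI : I.Nontrivial) {lo : LinearOrder C}
    (hlo : IsLinearization lo) {u : C} (hu : u ∉ I) (hbot : ∀ x, u ≤ x)
    (hcut : ∀ L ⊆ I, (∀ i ∈ L, ∀ m ∈ I, m ≤ i → m ∈ L) → L ≠ ∅ → L ≠ I →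
      ∃ w, w ∉ I ∧ ∀ i ∈ I, i ∈ L ↔ i < w)
    (hdense : ∀ v w, v ∉ I → w ∉ I → v ≠ w → ∃ i ∈ I, sbtw v i w) : IsCycleCompletion I := by
  refine ⟨hI, fun J hJ hne hneI => ?_⟩
  obtain ⟨hJI, hJ⟩ := hJ
  obtain ⟨j₀, hj₀⟩ := Set.nonempty_iff_ne_empty.2 hne
  obtain ⟨j₁, hj₁I, hj₁⟩ : ∃ r ∈ I, r ∉ J := by
    by_contra! hc
    exact hneI (Set.Subset.antisymm hJI hc)
  have hj₀I := hJI hj₀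
  have hcut' : ∀ L ⊆ I, (∀ i ∈ L, ∀ m ∈ I, m ≤ i → m ∈ L) → L ≠ I →
      ∃ w, w ∉ I ∧ ∀ i ∈ I, i ∈ L ↔ i < w := by
    intro L h1 h2 h3
    by_cases h4 : L = ∅
    · refine ⟨u, hu, fun i hi => ?_⟩
      simp [h4, hbot i]
    · exact hcut L h1 h2 h4 h3
  -- For a convex K the first end is the cut just below K and the second the cut just above K. If K
  -- is cofinal in I, the arc closes up at the bottom element u instead.
  have hconv : ∀ K ⊆ I, (∀ s ∈ K, ∀ t ∈ K, ∀ m ∈ I, s ≤ m → m ≤ t → m ∈ K) → K.Nonempty → K ≠ I →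
      ∃ p : C × C, p.1 ∉ I ∧ p.2 ∉ I ∧ p.1 ≠ p.2 ∧ ∀ i ∈ I, i ∈ K ↔ i ∈ closedArc p.1 p.2 := by
    intro K hKI hK ⟨k, hk⟩ hKne
    obtain ⟨v, hv, hvL⟩ := hcut' {i | i ∈ I ∧ ∀ j ∈ K, i < j} (fun i hi => hi.1)
      (fun i hi m hm hmi => ⟨hm, fun j hj => hmi.trans_lt (hi.2 j hj)⟩) (fun e => by
        have : k ∈ {i | i ∈ I ∧ ∀ j ∈ K, i < j} := by rw [e]; exact hKI hk
        exact lt_irrefl _ (this.2 k hk))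
    by_cases htop : {i | i ∈ I ∧ ∃ j ∈ K, i ≤ j} = I
    · have hvu : v ≠ u := by
        rintro rfl
        apply hKne
        refine Set.Subset.antisymm hKI fun i hi => ?_
        have h1 : ¬ (∀ j ∈ K, i < j) := fun h => absurd ((hvL i hi).1 ⟨hi, h⟩) (not_lt.2 (hbot i))
        push Not at h1
        obtain ⟨j, hj, hji⟩ := h1
        have h2 : i ∈ {i | i ∈ I ∧ ∃ j ∈ K, i ≤ j} := by rw [htop]; exact hi
        obtain ⟨j', hj', hij'⟩ := h2.2
        exact hK j hj j' hj' i hi hji hij'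
      refine ⟨(v, u), hv, hu, hvu, fun i hi => ?_⟩
      have h2 : i ∈ {i | i ∈ I ∧ ∃ j ∈ K, i ≤ j} := by rw [htop]; exact hi
      obtain ⟨j', hj', hij'⟩ := h2.2
      have h3 := hvL i hi
      have h4 : i ≠ v := fun e => hv (e ▸ hi)
      have h5 : i ≠ u := fun e => hu (e ▸ hi)
      have h6 := hbot i
      have h7 := hbot v
      have h8 : i ∈ K ↔ v < i := by
        constructor
        · intro hiK
          have : ¬ i < v := fun h => lt_irrefl _ ((h3.2 h).2 i hiK)
          grind
        · intro hvi
          have h1 : ¬ (∀ j ∈ K, i < j) := fun h => absurd (h3.1 ⟨hi, h⟩) (not_lt.2 hvi.le)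
          push Not at h1
          obtain ⟨j, hj, hji⟩ := h1
          exact hK j hj j' hj' i hi hji hij'
      rw [h8, mem_closedArc, hlo.grindable]
      simp only
      grind
    · obtain ⟨w, hw, hwL⟩ := hcut' {i | i ∈ I ∧ ∃ j ∈ K, i ≤ j} (fun i hi => hi.1)
        (fun i hi m hm hmi => ⟨hm, hi.2.imp fun j hj => ⟨hj.1, hmi.trans hj.2⟩⟩) htop
      have hmem : ∀ i ∈ I, i ∈ K ↔ v < i ∧ i < w := by
        intro i hi
        have h4 : i ≠ v := fun e => hv (e ▸ hi)
        constructor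
        · intro hiK
          refine ⟨?_, (hwL i hi).1 ⟨hi, i, hiK, le_rfl⟩⟩
          have : ¬ i < v := fun h => lt_irrefl _ (((hvL i hi).2 h).2 i hiK)
          grind
        · rintro ⟨h5, h6⟩
          obtain ⟨-, j', hj', hij'⟩ := (hwL i hi).2 h6
          have h1 : ¬ (∀ j ∈ K, i < j) := fun h => absurd ((hvL i hi).1 ⟨hi, h⟩) (not_lt.2 h5.le)
          push Not at h1
          obtain ⟨j, hj, hji⟩ := h1
          exact hK j hj j' hj' i hi hji hij'
      have hk' := (hmem k (hKI hk)).1 hk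
      refine ⟨(v, w), hv, hw, (hk'.1.trans hk'.2).ne, fun i hi => ?_⟩
      have h4 : i ≠ v := fun e => hv (e ▸ hi)
      have h5 : i ≠ w := fun e => hw (e ▸ hi)
      rw [hmem i hi, mem_closedArc, hlo.grindable]
      simp only
      grind
  have hex : ∃ p : C × C, p.1 ∉ I ∧ p.2 ∉ I ∧ ∀ i ∈ I, i ∈ J ↔ i ∈ closedArc p.1 p.2 := by
    by_cases hoc : ∀ s ∈ J, ∀ t ∈ J, ∀ m ∈ I, s ≤ m → m ≤ t → m ∈ J
    · obtain ⟨p, h1, h2, -, h3⟩ := hconv J hJI hoc ⟨j₀, hj₀⟩ hneI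
      exact ⟨p, h1, h2, h3⟩
    · push Not at hoc
      obtain ⟨s, hs, t, ht, m, hm, hsm, hmt, hmJ⟩ := hoc
      -- A gap m of J between s and t forces J to contain the other arc from t to s. The complement
      -- of J is then convex, and its two ends in swapped order cut out J.
      have hout : ∀ i ∈ I, i ≤ s ∨ t ≤ i → i ∈ J := by
        intro i hi hi'
        have hsm' : s ≠ m := fun e => hmJ (e ▸ hs)
        have hmt' : m ≠ t := fun e => hmJ (e ▸ ht)
        rcases hJ s hs t ht with h | h
        · exact absurd (h ⟨by rw [mem_closedArc, hlo.grindable]; grind, hm⟩) hmJ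
        · exact h ⟨by rw [mem_closedArc, hlo.grindable]; grind, hi⟩
      obtain ⟨p, h1, h2, hp, h3⟩ := hconv (I \ J) Set.sdiff_subset (by
        rintro a ⟨haI, haJ⟩ c ⟨hcI, hcJ⟩ b hb hab hbc
        refine ⟨hb, fun hbJ => ?_⟩
        have hab' : a ≠ b := fun e => haJ (e ▸ hbJ)
        have hbc' : b ≠ c := fun e => hcJ (e ▸ hbJ)
        have h4 := mt (hout a haI) haJ
        have h5 := mt (hout c hcI) hcJ
        rcases hJ s hs b hbJ with h | h
        · exact haJ (h ⟨by rw [mem_closedArc, hlo.grindable]; grind, haI⟩)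
        · exact hcJ (h ⟨by rw [mem_closedArc, hlo.grindable]; grind, hcI⟩)) ⟨j₁, hj₁I, hj₁⟩
        (fun e => by
          have : j₀ ∈ I \ J := by rw [e]; exact hj₀I
          exact this.2 hj₀)
      refine ⟨(p.2, p.1), h2, h1, fun i hi => ?_⟩
      have h4 := h3 i hi
      have h5 : i ≠ p.1 := fun e => h1 (e ▸ hi)
      have h6 : i ≠ p.2 := fun e => h2 (e ▸ hi)
      rw [mem_closedArc, hlo.grindable] at h4 ⊢
      simp only [Set.mem_sdiff, hi, true_and] at h4 ⊢
      grind
  obtain ⟨p, hp1, hp2, hp⟩ := hex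
  refine ⟨p, ⟨hp1, hp2, ?_⟩, ?_⟩
  · ext i
    constructor
    · intro hi; exact ⟨(hp i (hJI hi)).1 hi, hJI hi⟩
    · rintro ⟨hi, hiI⟩; exact (hp i hiI).2 hi
  · rintro ⟨v, w⟩ ⟨hv, hw, hvw⟩
    simp only at hv hw hvw
    obtain ⟨v', w'⟩ := p
    simp only at hp1 hp2 hp
    have hp' : ∀ i ∈ I, i ∈ J ↔ i ∈ closedArc v w := by
      intro i hi
      rw [hvw]
      simp [hi]
    -- Cutting the circle open outside J turns J into a segment for both pairs of ends. Different
    -- ends would have an element of I between them by density.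
    obtain ⟨lo', hbot', hlo'⟩ := exists_isLinearization j₁
    clear hlo hbot hJ hcut hcut' hconv hvw
    have a1 := mt (hp j₁ hj₁I).2 hj₁
    have a2 := mt (hp' j₁ hj₁I).2 hj₁
    have a3 := (hp j₀ hj₀I).1 hj₀
    have a4 := (hp' j₀ hj₀I).1 hj₀
    have b1 : j₀ ≠ v := fun e => hv (e ▸ hj₀I)
    have b2 : j₀ ≠ w := fun e => hw (e ▸ hj₀I)
    have b3 : j₀ ≠ v' := fun e => hp1 (e ▸ hj₀I)
    have b4 : j₀ ≠ w' := fun e => hp2 (e ▸ hj₀I)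
    rw [mem_closedArc, hlo'.grindable] at a1 a2 a3 a4
    have c1 := hbot' v
    have c2 := hbot' w
    have c3 := hbot' v'
    have c4 := hbot' w'
    have key : ∀ i ∈ I, (v < i ∧ i < w) ↔ (v' < i ∧ i < w') := by
      intro i hi
      have h1 := hp i hi
      rw [hp' i hi, mem_closedArc, mem_closedArc, hlo'.grindable, hlo'.grindable] at h1
      have d1 : i ≠ v := fun e => hv (e ▸ hi)
      have d2 : i ≠ w := fun e => hw (e ▸ hi)
      have d3 : i ≠ v' := fun e => hp1 (e ▸ hi)
      have d4 : i ≠ w' := fun e => hp2 (e ▸ hi)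
      grind
    have e1 : v < j₀ ∧ j₀ < w := by grind
    have e2 : v' < j₀ ∧ j₀ < w' := by grind
    have f : ∀ a b, a ∉ I → b ∉ I → a < b → ∃ i ∈ I, a < i ∧ i < b := by
      intro a b ha hb hab
      obtain ⟨i, hi, hi'⟩ := hdense a b ha hb hab.ne
      rw [hlo'.grindable] at hi'
      exact ⟨i, hi, by grind⟩
    have g1 : v = v' := by
      rcases lt_trichotomy v v' with h | h | h
      · obtain ⟨i, hi, h1, h2⟩ := f v v' hv hp1 h
        have := key i hi
        grind
      · exact h
      · obtain ⟨i, hi, h1, h2⟩ := f v' v hp1 hv h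
        have := key i hi
        grind
    have g2 : w = w' := by
      rcases lt_trichotomy w w' with h | h | h
      · obtain ⟨i, hi, h1, h2⟩ := f w w' hw hp2 h
        have := key i hi
        grind
      · exact h
      · obtain ⟨i, hi, h1, h2⟩ := f w' w hp2 hw h
        have := key i hi
        grind
    rw [g1, g2]

end CycleCompletions

/-! ### Interval sets and corners of interval separations -/

section IntervalSets

variable {V C : Type u} [CircularOrder C]

theorem closedArc_union {a b c : C} (h : sbtw a b c) :
    closedArc a b ∪ closedArc b c = closedArc a c := by
  obtain ⟨lo, -, hlo⟩ := exists_isLinearization a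
  ext z
  rw [Set.mem_union, mem_closedArc, mem_closedArc, mem_closedArc]
  rw [hlo.grindable] at *
  grind [hlo.grindable]

theorem closedArc_union_swap {a b : C} (h : a ≠ b) :
    closedArc a b ∪ closedArc b a = Set.univ := by
  obtain ⟨lo, -, hlo⟩ := exists_isLinearization a
  ext z
  rw [Set.mem_union, mem_closedArc, mem_closedArc]
  grind [hlo.grindable]

theorem left_mem_closedArc (a b : C) : a ∈ closedArc a b := mem_closedArc.2 (Or.inl rfl)

theorem right_mem_closedArc (a b : C) : b ∈ closedArc a b := mem_closedArc.2 (Or.inr (Or.inl rfl))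

variable {P : C → Set V}

theorem mem_intervalSet {a b : C} {x : V} :
    x ∈ intervalSet P a b ↔ (∃ z ∈ closedArc a b, x ∈ P z) ∨ x ∈ centre P := by
  simp [intervalSet]

theorem notMem_centre {C : Type u} {P : C → Set V} {z : C} {x : V} (h : x ∈ P z) : x ∉ centre P := by
  intro hx
  exact hx (Set.mem_iUnion_of_mem z h)

theorem exists_mem_of_notMem_centre {C : Type u} {P : C → Set V} {x : V} (h : x ∉ centre P) : ∃ z, x ∈ P z := by
  simpa [centre] using h

theorem subset_intervalSet {a b z : C} (h : z ∈ closedArc a b) : P z ⊆ intervalSet P a b :=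
  fun _ hx => mem_intervalSet.2 (Or.inl ⟨z, h, hx⟩)

theorem centre_subset_intervalSet (a b : C) : centre P ⊆ intervalSet P a b :=
  Set.subset_union_right

theorem intervalSet_union {a b c : C} (h : sbtw a b c) :
    intervalSet P a b ∪ intervalSet P b c = intervalSet P a c := by
  ext x
  rw [Set.mem_union, mem_intervalSet, mem_intervalSet, mem_intervalSet, ← closedArc_union h]
  simp only [Set.mem_union]
  grind

theorem intervalSet_union_swap {a b : C} (h : a ≠ b) :
    intervalSet P a b ∪ intervalSet P b a = Set.univ := by
  ext x
  simp only [Set.mem_univ, iff_true]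
  by_cases hx : x ∈ centre P
  · exact Or.inl (centre_subset_intervalSet _ _ hx)
  · obtain ⟨z, hz⟩ := exists_mem_of_notMem_centre hx
    have : z ∈ closedArc a b ∪ closedArc b a := by rw [closedArc_union_swap h]; trivial
    rcases this with h | h
    · exact Or.inl (subset_intervalSet h hz)
    · exact Or.inr (subset_intervalSet h hz)

theorem intervalSet_subset_left {a b c : C} (h : sbtw a b c) :
    intervalSet P a b ⊆ intervalSet P a c := by
  rw [← intervalSet_union h]; exact Set.subset_union_left

theorem intervalSet_subset_right {a b c : C} (h : sbtw a b c) :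
    intervalSet P b c ⊆ intervalSet P a c := by
  rw [← intervalSet_union h]; exact Set.subset_union_right

theorem intervalSep_le {a x y : C} (h : sbtw a x y) : intervalSep P a x ≤ intervalSep P a y :=
  ⟨intervalSet_subset_left h, intervalSet_subset_right h.cyclic_left⟩

theorem intervalSep_le' {a x y : C} (h : sbtw a x y) : intervalSep P y a ≤ intervalSep P x a :=
  ⟨intervalSet_subset_right h.cyclic_left, intervalSet_subset_left h⟩

theorem inv_intervalSep (a b : C) : (intervalSep P a b).inv = intervalSep P b a := rfl

/-- The vertex `x` respects the separator of `S(a, b)`. -/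
def SepAt (P : C → Set V) (x : V) (a b : C) : Prop :=
  x ∈ intervalSet P a b → x ∈ intervalSet P b a → x ∈ P a ∪ P b ∪ centre P

theorem SepAt.symm {x : V} {a b : C} (h : SepAt P x a b) : SepAt P x b a := by
  intro h1 h2
  rw [Set.union_comm (P b)]
  exact h h2 h1

/-- If `x ∉ P_u`, the separators at `(u, a)` and `(u, b)` yield the separator at `(a, b)`. -/
theorem SepAt.of_base {x : V} {u a b : C} (hx : x ∉ P u) (h : sbtw u a b) (ha : SepAt P x u a)
    (hb : SepAt P x u b) : SepAt P x a b := by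
  intro h1 h2
  rw [← intervalSet_union h.cyclic_right] at h2
  rcases h2 with h2 | h2
  · have := hb (intervalSet_subset_right h h1) h2
    grind
  · have := ha h2 (intervalSet_subset_left h.cyclic_left h1)
    grind

theorem SepAt.of_base' {x : V} {u a b : C} (hx : x ∉ P u) (hua : u ≠ a) (hub : u ≠ b) (hab : a ≠ b)
    (ha : SepAt P x u a) (hb : SepAt P x u b) : SepAt P x a b := by
  rcases sbtw_or_sbtw_of_ne hua hab hub.symm with h | h
  · exact ha.of_base hx h hb
  · exact (hb.of_base hx h.cyclic_right ha).symm

/-- The separation `S(a, b)` as a corner of `S(a, w)` and `S(w', b)`. -/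
theorem intervalSep_eq_inf {a b w w' : C} (h : sbtw a b w) (h' : sbtw a w w')
    (hs : ∀ x, SepAt P x a w) (hs' : ∀ x, SepAt P x b w') (hd : Disjoint (P w) (P w')) :
    intervalSep P a b = (intervalSep P a w).inf (intervalSep P w' b) := by
  obtain ⟨lo, -, hlo⟩ := exists_isLinearization a
  have h1 : sbtw w' a b := by rw [hlo.grindable] at *; grind
  have h2 : sbtw b w w' := by rw [hlo.grindable] at *; grind
  have h3 : sbtw w w' a := by rw [hlo.grindable] at *; grind
  have h4 : sbtw b w a := by rw [hlo.grindable] at *; grind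
  have h5 : sbtw b w' a := by rw [hlo.grindable] at *; grind
  have e1 := intervalSet_union (P := P) h
  have e2 := intervalSet_union (P := P) h1
  have e3 := intervalSet_union (P := P) h2
  have e4 := intervalSet_union (P := P) h3
  have e5 := intervalSet_union (P := P) h4
  have e6 := intervalSet_union (P := P) h5
  have i1 := subset_intervalSet (P := P) (left_mem_closedArc a b)
  have i2 := subset_intervalSet (P := P) (right_mem_closedArc a b)
  have i3 := centre_subset_intervalSet (P := P) a b
  rw [Set.disjoint_left] at hd
  -- The left side needs an argument only for a vertex in both V(b,w) and V(w',a). It lies in the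
  -- separators of S(a,w) and of S(b,w'), and as the sets at w and w' are disjoint, it is in the set
  -- at a or b or in the centre.
  ext x
  · have hs := hs x
    have hs' := hs' x
    simp only [SepAt] at hs hs'
    simp only [intervalSep, VPair.inf]
    grind
  · simp only [intervalSep, VPair.inf]
    grind

end IntervalSets

theorem ENat.two_mul_add_cancel {a b x : ℕ∞} {k : ℕ} (ha : 2 * a + x = k) (hb : 2 * b + x = k) :
    a = b := by
  have hx : x ≠ ⊤ := by rintro rfl; simp at ha
  have h1 : a ≠ ⊤ := by rintro rfl; simp at ha
  have h2 : b ≠ ⊤ := by rintro rfl; simp at hb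
  lift x to ℕ using hx
  lift a to ℕ using h1
  lift b to ℕ using h2
  norm_cast at *
  omega

/-! ### Profiles and orders of interval separations -/

section Profiles

variable {V : Type u} {U : VertexUniverse V} {k : ℕ}

theorem VPair.order_inv (s : VPair V) : s.inv.order = s.order := by
  simp [VPair.order, VPair.inv, Set.inter_comm]

namespace VertexUniverse.IsProfile

variable {P Q : Set (VPair V)}

theorem mem_sepsLT {s : VPair V} (hs : s ∈ U.seps) (ho : s.order ≤ k) : s ∈ U.sepsLT (k + 1) := by
  refine ⟨hs, ?_⟩
  push_cast
  exact Order.lt_add_one_iff_of_not_isMax (by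
    intro h
    have := isMax_iff_eq_top.1 h
    exact ENat.natCast_ne_top k this) |>.2 ho

theorem seps_of_mem (hP : U.IsProfile (k + 1) P) {s : VPair V} (hs : s ∈ P) : s ∈ U.seps :=
  (hP.orientation.subset hs).1

theorem order_le (hP : U.IsProfile (k + 1) P) {s : VPair V} (hs : s ∈ P) : s.order ≤ k := by
  have := (hP.orientation.subset hs).2
  push_cast at this
  exact Order.le_of_lt_add_one this

theorem mem_or_inv_mem (hP : U.IsProfile (k + 1) P) {s : VPair V} (hs : s ∈ U.seps)
    (ho : s.order ≤ k) : s ∈ P ∨ s.inv ∈ P := by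
  obtain ⟨t, ⟨ht, htP⟩, -⟩ := hP.orientation.exactly_one s (mem_sepsLT hs ho)
  rcases ht with rfl | rfl
  · exact Or.inl htP
  · exact Or.inr htP

theorem inv_notMem (hP : U.IsProfile (k + 1) P) {s : VPair V} (hs : s ∈ P) : s.inv ∉ P := by
  have h := hP.profile s hs s hs
  have : s.sup s = s := by ext <;> simp [VPair.sup]
  rwa [this] at h

/-- Consistency makes profiles closed downwards, except that it says nothing about the pair s, s*.
This exception has to be excluded separately wherever the lemma is used. -/
theorem mem_of_le (hP : U.IsProfile (k + 1) P) {r s : VPair V} (hs : s ∈ P) (hr : r ∈ U.seps)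
    (ho : r.order ≤ k) (hrs : r ≤ s) (hne : r ≠ s.inv) : r ∈ P := by
  rcases hP.mem_or_inv_mem hr ho with h | h
  · exact h
  · have h1 := hP.orientation.consistent r.inv h s hs hrs
    have h2 : r ∈ ({s, s.inv} : Set (VPair V)) := by
      rw [← h1]; right; rfl
    rcases h2 with rfl | h2
    · exact hs
    · exact absurd h2 hne

/-- The join of r with (V, B) has the form (V, B') with B' ⊆ B, so its order is small enough and the
profile property puts it into P. Its inverse lies below (V, B), so consistency allows it only to be
(V, B) or (B, V). -/
theorem subset_right_of_univ_mem (hP : U.IsProfile (k + 1) P) {B : Set V}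
    (hB : (⟨Set.univ, B⟩ : VPair V) ∈ P) {r : VPair V} (hr : r ∈ P) : B ⊆ r.right := by
  have h1 := hP.profile r hr _ hB
  have hU := U.sup_mem r (hP.seps_of_mem hr) _ (hP.seps_of_mem hB)
  have ho : (r.sup ⟨Set.univ, B⟩).order ≤ k := by
    refine le_trans ?_ (hP.order_le hB)
    refine Set.encard_le_encard ?_
    rintro x ⟨-, hx⟩
    exact ⟨trivial, hx.2⟩
  have h2 := (hP.mem_or_inv_mem hU ho).resolve_right h1
  have h3 := hP.orientation.consistent _ h2 _ hB ⟨Set.subset_univ _, by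
    simp [VPair.inv, VPair.sup]⟩
  have h4 : r.sup ⟨Set.univ, B⟩ ∈
      ({⟨Set.univ, B⟩, VPair.inv ⟨Set.univ, B⟩} : Set (VPair V)) := by
    rw [← h3]; left; rfl
  rcases h4 with h4 | h4
  · have := congrArg VPair.right h4
    simp only [VPair.sup] at this
    intro x hx
    rw [← this] at hx
    exact hx.1
  · have := congrArg VPair.right h4
    simp only [VPair.sup, VPair.inv] at this
    intro x hx
    have hx' : x ∈ r.right ∩ B := by rw [this]; trivial
    exact hx'.1

/-- A separation r in P with r* in Q would lie above (B, V), by the previous lemma applied to Q,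
which is inconsistent with (V, B) in P. A profile is therefore determined by any element (V, B). -/
theorem subset_of_univ_mem (hP : U.IsProfile (k + 1) P) (hQ : U.IsProfile (k + 1) Q) {B : Set V}
    (hBP : (⟨Set.univ, B⟩ : VPair V) ∈ P) (hBQ : (⟨Set.univ, B⟩ : VPair V) ∈ Q) : P ⊆ Q := by
  intro r hr
  by_contra hrQ
  have hr' := (hQ.mem_or_inv_mem (hP.seps_of_mem hr) (hP.order_le hr)).resolve_left hrQ
  have h2 := hQ.subset_right_of_univ_mem hBQ hr'
  have h3 := hP.orientation.consistent _ hBP r hr ⟨h2, Set.subset_univ _⟩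
  have h4 : r ∈ ({⟨Set.univ, B⟩, VPair.inv ⟨Set.univ, B⟩} : Set (VPair V)) := by
    rw [h3]; left; rfl
  rcases h4 with h4 | h4
  · exact hrQ (h4 ▸ hBQ)
  · exact hP.inv_notMem hBP (h4 ▸ hr)

end VertexUniverse.IsProfile

namespace Pseudoflower

variable (Φ : Pseudoflower U k) {u v w a b : Φ.C}

theorem disjoint_centre (z : Φ.C) : Disjoint (Φ.P z) (centre Φ.P) :=
  Set.disjoint_left.2 fun _ h => notMem_centre h

theorem sepAt (hv : v ∉ Φ.I) (hw : w ∉ Φ.I) (h : v ≠ w) (x : V) : SepAt Φ.P x v w := by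
  intro h1 h2
  rw [← Φ.separator v hv w hw h]
  exact ⟨h1, h2⟩

theorem encard_eq (hv : v ∉ Φ.I) (hw : w ∉ Φ.I) : (Φ.P v).encard = (Φ.P w).encard :=
  ENat.two_mul_add_cancel (Φ.encard_cutpoint v hv) (Φ.encard_cutpoint w hw)

theorem encard_centre_ne_top (Φ : Pseudoflower U k) : (centre Φ.P).encard ≠ ⊤ := by
  obtain ⟨v, hv⟩ := Φ.isCycleCompletion.exists_notMem
  have := Φ.encard_cutpoint v hv
  intro h
  rw [h] at this
  simp at this

theorem encard_ne_top (hv : v ∉ Φ.I) : (Φ.P v).encard ≠ ⊤ := by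
  have := Φ.encard_cutpoint v hv
  intro h
  rw [h] at this
  simp at this

theorem order_eq (hv : v ∉ Φ.I) (hw : w ∉ Φ.I) (h : v ≠ w) :
    (intervalSep Φ.P v w).order = (Φ.P v ∪ Φ.P w).encard + (centre Φ.P).encard := by
  rw [VPair.order]
  simp only [intervalSep]
  rw [Φ.separator v hv w hw h, Set.encard_union_eq]
  rw [Set.disjoint_union_left]
  exact ⟨Φ.disjoint_centre v, Φ.disjoint_centre w⟩

/-- The sizes of P_v, P_w and the centre add up to k, so a separator of order at least k leaves no
room for an overlap. -/
theorem disjoint_of_le_order (hv : v ∉ Φ.I) (hw : w ∉ Φ.I) (h : v ≠ w)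
    (ho : (k : ℕ∞) ≤ (intervalSep Φ.P v w).order) : Disjoint (Φ.P v) (Φ.P w) := by
  rw [Φ.order_eq hv hw h] at ho
  have h1 := Set.encard_union_add_encard_inter (Φ.P v) (Φ.P w)
  have h2 := Φ.encard_cutpoint v hv
  rw [← Φ.encard_eq hv hw] at h1
  rw [Set.disjoint_iff_inter_eq_empty, ← Set.encard_eq_zero]
  have h3 := Φ.encard_ne_top hv
  have h4 := Φ.encard_centre_ne_top
  have h5 : (Φ.P v ∪ Φ.P w).encard ≠ ⊤ := by
    intro e; rw [e] at h1; exact h3 (by simpa using h1.symm)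
  have h6 : (Φ.P v ∩ Φ.P w).encard ≠ ⊤ := by
    intro e; rw [e] at h1; exact h3 (by simpa using h1.symm)
  generalize (Φ.P v ∩ Φ.P w).encard = q at *
  generalize (Φ.P v ∪ Φ.P w).encard = r at *
  generalize (Φ.P v).encard = c at *
  generalize (centre Φ.P).encard = x at *
  lift q to ℕ using h6
  lift r to ℕ using h5
  lift c to ℕ using h3
  lift x to ℕ using h4
  norm_cast at *
  omega

theorem eq_of_subset (hv : v ∉ Φ.I) (hw : w ∉ Φ.I) (h : Φ.P v ⊆ Φ.P w) : Φ.P v = Φ.P w :=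
  (Set.encard_ne_top_iff.1 (Φ.encard_ne_top hv)).eq_of_subset_of_encard_le h
    (Φ.encard_eq hv hw).ge

end Pseudoflower

end Profiles

/-! ### From three located profiles to a tripod -/

section Location

variable {V : Type u} {U : VertexUniverse V} {k : ℕ}

namespace Pseudoflower

variable (Φ : Pseudoflower U k)

/-- `P` and `Q` are profiles distinguished by `Φ`, but by no separation of order less than `k`. -/
structure Separates (P Q : Set (VPair V)) : Prop where
  left : U.IsProfile (k + 1) P
  right : U.IsProfile (k + 1) Q
  le_order : ∀ s ∈ U.seps, Distinguishes s P Q → (k : ℕ∞) ≤ s.order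
  distinguishes : Φ.DistinguishesProfiles P Q

variable {Φ} {P Q : Set (VPair V)}

theorem DistinguishesProfiles.ne (h : Φ.DistinguishesProfiles P Q) : P ≠ Q := by
  rintro rfl
  obtain ⟨v, -, w, -, -, h | h⟩ := h
  · exact h.2 h.1
  · exact h.2 h.1

theorem DistinguishesProfiles.symm (h : Φ.DistinguishesProfiles P Q) :
    Φ.DistinguishesProfiles Q P := by
  obtain ⟨v, hv, w, hw, hvw, h⟩ := h
  exact ⟨v, hv, w, hw, hvw, Or.symm h⟩

theorem Separates.symm (h : Φ.Separates P Q) : Φ.Separates Q P :=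
  ⟨h.right, h.left, fun s hs hd => h.le_order s hs (Or.symm hd), h.distinguishes.symm⟩

/-- Two disjoint arcs never give the same separation `(B, V)` with `(V, B) ∈ P`. -/
theorem Separates.intervalSep_ne (h : Φ.Separates P Q) {a x y : Φ.C} (ha : a ∉ Φ.I) (hx : x ∉ Φ.I)
    (hy : y ∉ Φ.I) (haxy : sbtw a x y) (hxa : intervalSep Φ.P x a ∈ P) :
    intervalSep Φ.P y a ≠ intervalSep Φ.P a x := by
  intro he
  obtain ⟨hP, hQ, hk, hd⟩ := h
  have hax : a ≠ x := by rintro rfl; exact haxy.not_sbtw haxy.cyclic_left.cyclic_left |>.elim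
  have hay : a ≠ y := by rintro rfl; exact haxy.not_sbtw haxy |>.elim
  have hxy : x ≠ y := by rintro rfl; exact haxy.not_sbtw haxy.cyclic_left |>.elim
  have e1 : intervalSet Φ.P y a = intervalSet Φ.P a x := congrArg VPair.left he
  have e2 : intervalSet Φ.P a y = intervalSet Φ.P x a := congrArg VPair.right he
  have huniv : intervalSet Φ.P x a = Set.univ := by
    have h1 := intervalSet_union_swap (P := Φ.P) hax
    have h2 := intervalSet_subset_left (P := Φ.P) haxy
    rw [e2] at h2
    rwa [Set.union_eq_right.2 h2] at h1
  set B := intervalSet Φ.P a x with hB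
  have es : intervalSep Φ.P x a = ⟨Set.univ, B⟩ := by simp [intervalSep, huniv, hB]
  have es' : intervalSep Φ.P a y = ⟨Set.univ, B⟩ := by
    simp [intervalSep, e1, e2, huniv]
  have hPB := hxa
  rw [es] at hPB
  -- Two profiles containing (V, B) coincide, so this separation distinguishes P from Q and has
  -- order at least k.
  have hQB : (⟨Set.univ, B⟩ : VPair V) ∉ Q := fun hQB => hd.ne
    (Set.Subset.antisymm (hP.subset_of_univ_mem hQ hPB hQB) (hQ.subset_of_univ_mem hP hQB hPB))
  have hU := hP.seps_of_mem hPB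
  have hQB' := (hQ.mem_or_inv_mem hU (hP.order_le hPB)).resolve_left hQB
  have hkB := hk _ hU (Or.inl ⟨hPB, hQB⟩)
  have d1 := Φ.disjoint_of_le_order hx ha hax.symm (by rwa [es])
  have d2 := Φ.disjoint_of_le_order ha hy hay (by rwa [es'])
  have hPxy : Φ.P x = Φ.P y := by
    refine Φ.eq_of_subset hx hy fun z hz => ?_
    have h1 := Φ.separator x hx a ha hax.symm
    have h2 := Φ.separator y hy a ha hay.symm
    rw [e1, e2, huniv, Set.inter_univ] at h2
    rw [huniv, Set.univ_inter] at h1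
    have h3 : z ∈ B := by
      rw [hB, h1]; exact Or.inl (Or.inl hz)
    rw [h2] at h3
    rcases h3 with (h3 | h3) | h3
    · exact h3
    · exact absurd h3 (Set.disjoint_left.1 d1 hz)
    · exact absurd h3 (notMem_centre hz)
  -- If the sets at cutpoints are empty, then B is the centre, and petals on the arcs from a to x
  -- and from y to a are both empty, contrary to the last axiom.
  by_cases hc : (Φ.P x).encard = 0
  · have hempty : ∀ z, z ∉ Φ.I → Φ.P z = ∅ := fun z hz => by
      rw [← Set.encard_eq_zero, ← hc]; exact Φ.encard_eq hz hx
    have hBX : B = centre Φ.P := by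
      have h1 := Φ.separator x hx a ha hax.symm
      rw [huniv, Set.univ_inter, hempty x hx, hempty a ha] at h1
      simpa using h1
    have hkX : ∀ i, Φ.P i = ∅ → 2 * (Φ.P i).encard + (centre Φ.P).encard = k := by
      intro i hi
      have := Φ.encard_cutpoint x hx
      rw [hc] at this
      rw [hi]
      simpa using this
    obtain ⟨i, hi, hi'⟩ := Φ.isCycleCompletion.exists_between ha hx hax
    obtain ⟨j, hj, hj'⟩ := Φ.isCycleCompletion.exists_between hy ha hay.symm
    have hPi : Φ.P i = ∅ := by
      rw [Set.eq_empty_iff_forall_notMem]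
      intro z hz
      have : z ∈ B := subset_intervalSet (mem_closedArc.2 (Or.inr (Or.inr hi'))) hz
      rw [hBX] at this
      exact notMem_centre hz this
    have hPj : Φ.P j = ∅ := by
      rw [Set.eq_empty_iff_forall_notMem]
      intro z hz
      have : z ∈ intervalSet Φ.P y a :=
        subset_intervalSet (mem_closedArc.2 (Or.inr (Or.inr hj'))) hz
      rw [e1, hBX] at this
      exact notMem_centre hz this
    have := Φ.petal_injective i hi j hj (hkX i hPi) (hPi.trans hPj.symm)
    subst this
    obtain ⟨lo, -, hlo⟩ := exists_isLinearization a
    rw [hlo.grindable] at *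
    grind
  -- Since P_x = P_y is nonempty, S(x,y) has order below k, so P and Q must orient it alike.
  · have hlt : (intervalSep Φ.P x y).order < k := by
      rw [Φ.order_eq hx hy hxy, ← hPxy, Set.union_self]
      have h1 := Φ.encard_cutpoint x hx
      have h3 := Φ.encard_ne_top hx
      have h4 := Φ.encard_centre_ne_top
      generalize (Φ.P x).encard = c at *
      generalize (centre Φ.P).encard = x at *
      lift c to ℕ using h3
      lift x to ℕ using h4
      norm_cast at *
      omega
    have hUxy := Φ.sep_mem x hx y hy hxy
    have e3 : intervalSet Φ.P y x = B := by
      rw [← intervalSet_union haxy.cyclic_right, e1, Set.union_self]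
    have hxyP : intervalSep Φ.P x y ∈ P := by
      refine (hP.mem_or_inv_mem hUxy hlt.le).resolve_right fun hinv => ?_
      have h2 := hP.orientation.consistent _ hPB _ hinv ⟨e3.ge, Set.subset_univ _⟩
      have h4 : (intervalSep Φ.P x y).inv ∈
          ({⟨Set.univ, B⟩, VPair.inv ⟨Set.univ, B⟩} : Set (VPair V)) := by
        rw [h2]; left; rfl
      have h5 : (intervalSep Φ.P x y).inv.order = (⟨Set.univ, B⟩ : VPair V).order := by
        rcases h4 with h4 | h4
        · rw [h4]
        · rw [h4, VPair.order_inv]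
      rw [VPair.order_inv] at h5
      rw [h5] at hlt
      exact absurd hkB (not_le.2 hlt)
    have hxyQ : intervalSep Φ.P x y ∈ Q := by
      by_contra hn
      exact absurd (hk _ hUxy (Or.inl ⟨hxyP, hn⟩)) (not_le.2 hlt)
    -- The join of S(x,y) and (B, V), both in Q, is (V, B), whose inverse also lies in Q.
    have h6 := hQ.profile _ hxyQ _ hQB'
    apply h6
    have h7 := intervalSet_union_swap (P := Φ.P) hxy
    rw [e3] at h7
    have : (intervalSep Φ.P x y).sup (VPair.inv ⟨Set.univ, B⟩) = ⟨Set.univ, B⟩ := by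
      ext z
      · simp only [VPair.sup, VPair.inv, intervalSep]
        rw [h7]
      · simp only [VPair.sup, VPair.inv, intervalSep]
        rw [e3, Set.inter_univ]
    rw [this]
    exact hQB'

theorem ne_of_sbtw {C : Type u} [CircularOrder C] {a b c : C} (h : sbtw a b c) :
    a ≠ b ∧ b ≠ c ∧ c ≠ a := by
  refine ⟨?_, ?_, ?_⟩
  · rintro rfl; exact (h.not_sbtw h.cyclic_left.cyclic_left).elim
  · rintro rfl; exact (h.not_sbtw h.cyclic_left).elim
  · rintro rfl; exact (h.not_sbtw h).elim

/-- The exceptional case of `mem_of_le` is the one excluded by `intervalSep_ne`. -/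
theorem Separates.mem_extend_right (h : Φ.Separates P Q) {a x y : Φ.C} (ha : a ∉ Φ.I)
    (hx : x ∉ Φ.I) (hy : y ∉ Φ.I) (haxy : sbtw a x y) (hxa : intervalSep Φ.P x a ∈ P) :
    intervalSep Φ.P y a ∈ P := by
  have hn := ne_of_sbtw haxy
  exact h.left.mem_of_le hxa (Φ.sep_mem y hy a ha hn.2.2) (Φ.sep_order y hy a ha hn.2.2)
    (intervalSep_le' haxy) (h.intervalSep_ne ha hx hy haxy hxa)

theorem Separates.mem_extend_left (h : Φ.Separates P Q) {a x y : Φ.C} (ha : a ∉ Φ.I)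
    (hx : x ∉ Φ.I) (hy : y ∉ Φ.I) (haxy : sbtw a x y) (hay : intervalSep Φ.P a y ∈ P) :
    intervalSep Φ.P a x ∈ P := by
  have hn := ne_of_sbtw haxy
  refine h.left.mem_of_le hay (Φ.sep_mem a ha x hx hn.1) (Φ.sep_order a ha x hx hn.1)
    (intervalSep_le haxy) fun he => ?_
  rw [inv_intervalSep] at he
  have : intervalSep Φ.P a y = intervalSep Φ.P x a := by
    rw [← inv_intervalSep y a, ← he, inv_intervalSep]
  rw [this] at hay
  exact h.intervalSep_ne ha hx hy haxy hay he.symm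

theorem Separates.not_small_aux (h : Φ.Separates P Q) {a b v : Φ.C} (ha : a ∉ Φ.I) (hb : b ∉ Φ.I)
    (hv : v ∉ Φ.I) (hab : intervalSep Φ.P a b ∈ P)
    (hl : (∀ w, w ∉ Φ.I → w ≠ v → intervalSep Φ.P v w ∈ P) ∨
      (∀ w, w ∉ Φ.I → w ≠ v → intervalSep Φ.P w v ∈ P))
    (hvab : sbtw a v b) : False := by
  have hn := ne_of_sbtw hvab
  have hnot : intervalSep Φ.P b a ∉ P := h.left.inv_notMem hab
  rcases hl with hl | hl
  · exact hnot (h.mem_extend_right ha hv hb hvab (hl a ha hn.1))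
  · exact hnot (h.mem_extend_left hb ha hv hvab.cyclic_right (hl b hb hn.2.1.symm))

/-- A located profile never regards all three arcs between three cutpoints as small. -/
theorem Separates.not_small (h : Φ.Separates P Q) (hl : Φ.Locates P) {a b c : Φ.C} (ha : a ∉ Φ.I)
    (hb : b ∉ Φ.I) (hc : c ∉ Φ.I) (habc : sbtw a b c) (hab : intervalSep Φ.P a b ∈ P)
    (hbc : intervalSep Φ.P b c ∈ P) : intervalSep Φ.P c a ∉ P := by
  intro hca
  obtain ⟨v, hv, hl⟩ := hl
  obtain ⟨h1, h2, h3⟩ := ne_of_sbtw habc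
  have nab := h.left.inv_notMem hab
  have nbc := h.left.inv_notMem hbc
  have nca := h.left.inv_notMem hca
  rw [inv_intervalSep] at nab nbc nca
  by_cases eva : v = a
  · subst eva
    rcases hl with hl | hl
    · exact nca (hl c hc h3)
    · exact nab (hl b hb h1.symm)
  by_cases evb : v = b
  · subst evb
    rcases hl with hl | hl
    · exact nab (hl a ha h1)
    · exact nbc (hl c hc h2.symm)
  by_cases evc : v = c
  · subst evc
    rcases hl with hl | hl
    · exact nbc (hl b hb h2)
    · exact nca (hl a ha h3.symm)
  have : sbtw a v b ∨ sbtw b v c ∨ sbtw c v a := by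
    obtain ⟨lo, -, hlo⟩ := exists_isLinearization a
    rw [hlo.grindable] at *
    grind [hlo.grindable]
  rcases this with e | e | e
  · exact h.not_small_aux ha hb hv hab hl e
  · exact h.not_small_aux hb hc hv hbc hl e
  · exact h.not_small_aux hc ha hv hca hl e

/-- Seen from the cutpoint `u`, the profile `P` lies before the profile `Q`. -/
def Before (Φ : Pseudoflower U k) (u : Φ.C) (P Q : Set (VPair V)) : Prop :=
  ∃ a, a ∉ Φ.I ∧ a ≠ u ∧ intervalSep Φ.P a u ∈ P ∧ intervalSep Φ.P u a ∈ Q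

theorem mem_or_mem (hP : U.IsProfile (k + 1) P) {a b : Φ.C} (ha : a ∉ Φ.I) (hb : b ∉ Φ.I)
    (h : a ≠ b) : intervalSep Φ.P a b ∈ P ∨ intervalSep Φ.P b a ∈ P :=
  hP.mem_or_inv_mem (Φ.sep_mem a ha b hb h) (Φ.sep_order a ha b hb h)

/-- If neither profile precedes the other as seen from u, they agree on all separations S(a,u) and
S(u,a). These determine S(a,b): either `mem_extend_left` or `mem_extend_right` applies, or two of
the three arcs are small, and `not_small` decides the third. -/
theorem Separates.agree (h : Φ.Separates P Q) (hP : Φ.Locates P) (hQ : Φ.Locates Q) {u : Φ.C}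
    (hu : u ∉ Φ.I) (h1 : ¬ Φ.Before u P Q) (h2 : ¬ Φ.Before u Q P) {a b : Φ.C} (ha : a ∉ Φ.I)
    (hb : b ∉ Φ.I) (hab : a ≠ b) : intervalSep Φ.P a b ∈ P → intervalSep Φ.P a b ∈ Q := by
  have base : ∀ a, a ∉ Φ.I → a ≠ u → (intervalSep Φ.P a u ∈ P ↔ intervalSep Φ.P a u ∈ Q) := by
    intro a ha hau
    constructor
    · intro hm
      exact (mem_or_mem h.right ha hu hau).resolve_right fun hm' => h1 ⟨a, ha, hau, hm, hm'⟩
    · intro hm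
      exact (mem_or_mem h.left ha hu hau).resolve_right fun hm' => h2 ⟨a, ha, hau, hm, hm'⟩
  have base' : ∀ a, a ∉ Φ.I → a ≠ u → (intervalSep Φ.P u a ∈ P ↔ intervalSep Φ.P u a ∈ Q) := by
    intro a ha hau
    have := base a ha hau
    constructor
    · intro hm
      exact (mem_or_mem h.right hu ha hau.symm).resolve_right
        fun hm' => h.left.inv_notMem hm (this.2 hm')
    · intro hm
      exact (mem_or_mem h.left hu ha hau.symm).resolve_right
        fun hm' => h.right.inv_notMem hm (this.1 hm')
  intro hm
  by_cases hau : a = u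
  · subst hau; exact (base' b hb hab.symm).1 hm
  by_cases hbu : b = u
  · subst hbu; exact (base a ha hab).1 hm
  rcases sbtw_or_sbtw_of_ne (Ne.symm hau) hab hbu with e | e
  · rcases mem_or_mem h.left ha hu hau with m | m
    · exact h.symm.mem_extend_left ha hb hu e.cyclic_left ((base a ha hau).1 m)
    · rcases mem_or_mem h.left hb hu hbu with m' | m'
      · exact absurd m' (h.not_small hP hu ha hb e m hm)
      · exact h.symm.mem_extend_right hb hu ha e.cyclic_right ((base' b hb hbu).1 m')
  · have e' : sbtw u b a := e.cyclic_right
    by_contra hmQ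
    have hmQ' := (mem_or_mem h.right ha hb hab).resolve_left hmQ
    have : intervalSep Φ.P b a ∈ P := by
      rcases mem_or_mem h.right hb hu hbu with m | m
      · exact h.mem_extend_left hb ha hu e'.cyclic_left ((base b hb hbu).2 m)
      · rcases mem_or_mem h.right ha hu hau with m' | m'
        · exact absurd m' (h.symm.not_small hQ hu hb ha e' m hmQ')
        · exact h.mem_extend_right ha hu hb e'.cyclic_right ((base' a ha hau).2 m')
    exact h.left.inv_notMem hm this

theorem Separates.before_or_before (h : Φ.Separates P Q) (hP : Φ.Locates P) (hQ : Φ.Locates Q)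
    {u : Φ.C} (hu : u ∉ Φ.I) : Φ.Before u P Q ∨ Φ.Before u Q P := by
  by_contra! hc
  obtain ⟨v, hv, w, hw, hvw, hd⟩ := h.distinguishes
  have h1 := h.agree hP hQ hu hc.1 hc.2 hv hw hvw
  have h2 := h.symm.agree hQ hP hu hc.2 hc.1 hv hw hvw
  unfold Distinguishes at hd
  tauto

/-- Three cutpoints with pairwise disjoint separators, such that every separation pointing from one
of them into the opposite arc has order at least `k`. -/
structure IsTripod (Φ : Pseudoflower U k) (a b c : Φ.C) : Prop where
  between : sbtw a b c
  mem₁ : a ∉ Φ.I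
  mem₂ : b ∉ Φ.I
  mem₃ : c ∉ Φ.I
  disjoint₁ : Disjoint (Φ.P a) (Φ.P b)
  disjoint₂ : Disjoint (Φ.P b) (Φ.P c)
  disjoint₃ : Disjoint (Φ.P c) (Φ.P a)
  le_order₁ : ∀ T ∈ U.seps, T.order ≤ k → intervalSep Φ.P a b ≤ T → T ≤ intervalSep Φ.P a c →
    (k : ℕ∞) ≤ T.order
  le_order₂ : ∀ T ∈ U.seps, T.order ≤ k → intervalSep Φ.P b c ≤ T → T ≤ intervalSep Φ.P b a →
    (k : ℕ∞) ≤ T.order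
  le_order₃ : ∀ T ∈ U.seps, T.order ≤ k → intervalSep Φ.P c a ≤ T → T ≤ intervalSep Φ.P c b →
    (k : ℕ∞) ≤ T.order

theorem IsTripod.rotate {a b c : Φ.C} (h : Φ.IsTripod a b c) : Φ.IsTripod b c a :=
  ⟨h.between.cyclic_left, h.mem₂, h.mem₃, h.mem₁, h.disjoint₂, h.disjoint₃, h.disjoint₁, h.le_order₂,
    h.le_order₃, h.le_order₁⟩

variable {P₁ P₂ P₃ : Set (VPair V)}

/-- Since S(x,y) lies below S(z,y) and below S(x,z), it belongs to P₂ or to P₃ but not to P₁, unless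
it equals the inverses of both. In that case all three arcs have the same vertex set and S(x,y) is
its own inverse. -/
theorem Separates.le_order_of_mem (h₁₂ : Φ.Separates P₁ P₂) (h₁₃ : Φ.Separates P₁ P₃) {x y z : Φ.C}
    (hx : x ∉ Φ.I) (hy : y ∉ Φ.I) (hxyz : sbtw x y z) (h₁ : intervalSep Φ.P y x ∈ P₁)
    (h₂ : intervalSep Φ.P z y ∈ P₂) (h₃ : intervalSep Φ.P x z ∈ P₃) :
    (k : ℕ∞) ≤ (intervalSep Φ.P x y).order := by
  obtain ⟨n1, n2, n3⟩ := ne_of_sbtw hxyz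
  have hU := Φ.sep_mem x hx y hy n1
  have ho := Φ.sep_order x hx y hy n1
  have hn := h₁₂.left.inv_notMem h₁
  rw [inv_intervalSep] at hn
  by_cases m2 : intervalSep Φ.P x y ∈ P₂
  · exact h₁₂.le_order _ hU (Or.inr ⟨m2, hn⟩)
  by_cases m3 : intervalSep Φ.P x y ∈ P₃
  · exact h₁₃.le_order _ hU (Or.inr ⟨m3, hn⟩)
  exfalso
  have e2 : intervalSep Φ.P x y = intervalSep Φ.P y z := by
    by_contra he
    exact m2 (h₁₂.right.mem_of_le h₂ hU ho (intervalSep_le' hxyz.cyclic_left) he)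
  have e3 : intervalSep Φ.P x y = intervalSep Φ.P z x := by
    by_contra he
    exact m3 (h₁₃.right.mem_of_le h₃ hU ho (intervalSep_le hxyz) he)
  have a2 : intervalSet Φ.P x y = intervalSet Φ.P y z := congrArg VPair.left e2
  have a3 : intervalSet Φ.P x y = intervalSet Φ.P z x := congrArg VPair.left e3
  have a4 : intervalSet Φ.P y x = intervalSet Φ.P x y := by
    rw [← intervalSet_union hxyz.cyclic_left, ← a2, ← a3, Set.union_self]
  apply hn
  have : intervalSep Φ.P x y = intervalSep Φ.P y x := by
    simp [intervalSep, a4]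
  rwa [this]

/-- P₂ contains T because it contains the upper bound of T, and P₃ contains T* because it contains
the inverse of the lower bound. In the two exceptional cases T has the order of one of these bounds.
-/
theorem Separates.le_order_of_between (h₂₃ : Φ.Separates P₂ P₃) {a b c : Φ.C}
    (h₂ : intervalSep Φ.P c b ∈ P₂) (h₃ : intervalSep Φ.P a c ∈ P₃)
    (hcb : (k : ℕ∞) ≤ (intervalSep Φ.P c b).order) (hac : (k : ℕ∞) ≤ (intervalSep Φ.P a c).order)
    (T : VPair V) (hT : T ∈ U.seps) (ho : T.order ≤ k) (h1 : intervalSep Φ.P c a ≤ T)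
    (h2 : T ≤ intervalSep Φ.P c b) : (k : ℕ∞) ≤ T.order := by
  by_cases e1 : T = (intervalSep Φ.P c b).inv
  · rwa [e1, VPair.order_inv]
  by_cases e2 : T.inv = (intervalSep Φ.P a c).inv
  · rwa [← VPair.order_inv, e2, VPair.order_inv]
  have m1 := h₂₃.left.mem_of_le h₂ hT ho h2 e1
  have m2 := h₂₃.right.mem_of_le h₃ (U.inv_mem T hT) (by rwa [VPair.order_inv])
    (show T.inv ≤ intervalSep Φ.P a c from ⟨h1.2, h1.1⟩) e2
  exact h₂₃.le_order T hT (Or.inl ⟨m1, fun m => h₂₃.right.inv_notMem m m2⟩)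

theorem order_intervalSep_comm (a b : Φ.C) :
    (intervalSep Φ.P a b).order = (intervalSep Φ.P b a).order :=
  (VPair.order_inv _).symm

/-- The profiles P₁, P₂, P₃ live in the arcs from u to b, from b to a and from a to u, so every
separation between two of these arcs has order at least k. -/
theorem isTripod_of_before (h₁₂ : Φ.Separates P₁ P₂) (h₁₃ : Φ.Separates P₁ P₃)
    (h₂₃ : Φ.Separates P₂ P₃) (hl : Φ.Locates P₂) {u : Φ.C} (hu : u ∉ Φ.I)
    (hb : Φ.Before u P₁ P₂) (hb' : Φ.Before u P₂ P₃) : ∃ a b c, Φ.IsTripod a b c := by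
  obtain ⟨b, hb, hbu, b1, b2⟩ := hb
  obtain ⟨a, ha, hau, a2, a3⟩ := hb'
  have nb := h₁₂.right.inv_notMem b2
  rw [inv_intervalSep] at nb
  have hab : a ≠ b := by rintro rfl; exact nb a2
  have hs : sbtw u b a := by
    rcases sbtw_or_sbtw_of_ne hbu.symm hab.symm hau with e | e
    · exact e
    · exact absurd (h₂₃.mem_extend_right hu ha hb e.cyclic_right a2) nb
  have m2 : intervalSep Φ.P a b ∈ P₂ :=
    (mem_or_mem h₁₂.right ha hb hab).resolve_right fun m => h₂₃.not_small hl hu hb ha hs b2 m a2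
  have o1 := h₁₂.le_order_of_mem h₁₃ hu hb hs b1 m2 a3
  have o2 := h₂₃.le_order_of_mem h₁₂.symm hb ha hs.cyclic_left m2 a3 b1
  have o3 := h₁₃.symm.le_order_of_mem h₂₃.symm ha hu hs.cyclic_right a3 b1 m2
  have o1' := o1
  have o2' := o2
  have o3' := o3
  rw [order_intervalSep_comm] at o1' o2' o3'
  exact ⟨u, b, a, hs, hu, hb, ha, Φ.disjoint_of_le_order hu hb hbu.symm o1,
    Φ.disjoint_of_le_order hb ha hab.symm o2, Φ.disjoint_of_le_order ha hu hau o3,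
    h₁₃.symm.le_order_of_between a3 b1 o3' o1',
    h₁₂.le_order_of_between b1 m2 o1' o2',
    h₂₃.le_order_of_between m2 a3 o2' o3'⟩

/-- From any cutpoint, precedence is a tournament on the three profiles, and such a tournament
contains a directed path of length two. -/
theorem exists_isTripod (h₁₂ : Φ.Separates P₁ P₂) (h₁₃ : Φ.Separates P₁ P₃)
    (h₂₃ : Φ.Separates P₂ P₃) (l₁ : Φ.Locates P₁) (l₂ : Φ.Locates P₂) (l₃ : Φ.Locates P₃) :
    ∃ a b c, Φ.IsTripod a b c := by
  obtain ⟨u, hu⟩ := Φ.isCycleCompletion.exists_notMem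
  rcases h₁₂.before_or_before l₁ l₂ hu with a | a <;>
  rcases h₂₃.before_or_before l₂ l₃ hu with b | b <;>
  rcases h₁₃.before_or_before l₁ l₃ hu with c | c
  · exact isTripod_of_before h₁₂ h₁₃ h₂₃ l₂ hu a b
  · exact isTripod_of_before h₁₂ h₁₃ h₂₃ l₂ hu a b
  · exact isTripod_of_before h₁₃ h₁₂ h₂₃.symm l₃ hu c b
  · exact isTripod_of_before h₁₃.symm h₂₃.symm h₁₂ l₁ hu c a
  · exact isTripod_of_before h₁₂.symm h₂₃ h₁₃ l₁ hu a c
  · exact isTripod_of_before h₂₃ h₁₂.symm h₁₃.symm l₃ hu b c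
  · exact isTripod_of_before h₂₃.symm h₁₃.symm h₁₂.symm l₂ hu b a
  · exact isTripod_of_before h₂₃.symm h₁₃.symm h₁₂.symm l₂ hu b a

/-- A cutpoint opposite to a petal `i` with predecessor `p` and successor `s`. -/
structure IsOpposite (Φ : Pseudoflower U k) (p i s w : Φ.C) : Prop where
  pred_mem : p ∉ Φ.I
  mem : i ∈ Φ.I
  succ_mem : s ∉ Φ.I
  opp_mem : w ∉ Φ.I
  between : sbtw p i s
  between_opp : sbtw s w p
  succ_pred : IsCyclicSucc p i
  succ_succ : IsCyclicSucc i s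
  eq_or : ∀ z, z = p ∨ z = i ∨ z = s ∨ sbtw s z p
  disjoint : Disjoint (Φ.P w) (Φ.P i)
  le_order : ∀ T ∈ U.seps, T.order ≤ k → intervalSep Φ.P w p ≤ T → T ≤ intervalSep Φ.P w s →
    (k : ℕ∞) ≤ T.order

end Pseudoflower
end Location

/-! ### Splits of a petal and maximal chains of splits -/

section Splits

variable {V : Type u} {U : VertexUniverse V} {k : ℕ}

namespace Pseudoflower

variable {Φ : Pseudoflower U k}

/-- Since S(c,a) ≤ S(c,p) ≤ S(c,s) ≤ S(c,b), the order bound of the tripod passes to the petal. It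
makes P_c disjoint from P_p and P_s. A common vertex of P_c and P_i would lie in the separator of
S(p,s), which these two sets and the centre make up. -/
theorem IsTripod.exists_isOpposite_aux {a b c i : Φ.C} (h : Φ.IsTripod a b c) (hi : i ∈ Φ.I)
    (hai : sbtw a i b) : ∃ p s, Φ.IsOpposite p i s c := by
  obtain ⟨p, s, hp, hs, hps, h1, h2, h3⟩ := Φ.isCycleCompletion.exists_pred_succ hi
  obtain ⟨lo, -, hlo⟩ := exists_isLinearization i
  have ha := h3 a
  have hb := h3 b
  have hc := h3 c
  have habc := h.between
  have hpi : p ≠ i := fun e => hp (e ▸ hi)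
  have hsi : s ≠ i := fun e => hs (e ▸ hi)
  have hci : c ≠ i := fun e => h.mem₃ (e ▸ hi)
  have hpis : sbtw p i s := by
    rcases sbtw_or_sbtw_of_ne hpi hsi.symm hps.symm with e | e
    · exact e
    · exfalso
      have h4 := h1.2 s hps.symm hsi
      rw [mem_closedArc] at h4
      exact h4 (Or.inr (Or.inr e.cyclic_right))
  have hscp : sbtw s c p := by rw [hlo.grindable] at *; grind
  have hpa : p = a ∨ sbtw c a p := by rw [hlo.grindable] at *; grind
  have hsb : s = b ∨ sbtw c s b := by rw [hlo.grindable] at *; grind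
  have hcp : c ≠ p := (ne_of_sbtw hscp).2.1
  have hcs : c ≠ s := (ne_of_sbtw hscp).1.symm
  have lp : intervalSep Φ.P c a ≤ intervalSep Φ.P c p := by
    rcases hpa with e | e
    · rw [e]
    · exact intervalSep_le e
  have ls : intervalSep Φ.P c s ≤ intervalSep Φ.P c b := by
    rcases hsb with e | e
    · rw [e]
    · exact intervalSep_le e
  have lps : intervalSep Φ.P c p ≤ intervalSep Φ.P c s :=
    intervalSep_le hscp.cyclic_left
  have dp := Φ.disjoint_of_le_order h.mem₃ hp hcp (h.le_order₃ _ (Φ.sep_mem c h.mem₃ p hp hcp)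
    (Φ.sep_order c h.mem₃ p hp hcp) lp (lps.trans ls))
  have ds := Φ.disjoint_of_le_order h.mem₃ hs hcs (h.le_order₃ _ (Φ.sep_mem c h.mem₃ s hs hcs)
    (Φ.sep_order c h.mem₃ s hs hcs) (lp.trans lps) ls)
  refine ⟨p, s, hp, hi, hs, h.mem₃, hpis, hscp, h1, h2, h3, ?_, fun T hT ho h4 h5 =>
    h.le_order₃ T hT ho (lp.trans h4) (h5.trans ls)⟩
  rw [Set.disjoint_left] at *
  intro x hx hxi
  have h4 := Φ.sepAt hp hs hps x (subset_intervalSet (mem_closedArc.2 (Or.inr (Or.inr hpis))) hxi)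
    (subset_intervalSet (mem_closedArc.2 (Or.inr (Or.inr hscp))) hx)
  rcases h4 with (h4 | h4) | h4
  · exact dp hx h4
  · exact ds hx h4
  · exact notMem_centre hx h4

theorem IsTripod.exists_isOpposite {a b c i : Φ.C} (h : Φ.IsTripod a b c) (hi : i ∈ Φ.I) :
    ∃ p s w, Φ.IsOpposite p i s w := by
  obtain ⟨lo, -, hlo⟩ := exists_isLinearization i
  have habc := h.between
  have ha : a ≠ i := fun e => h.mem₁ (e ▸ hi)
  have hb : b ≠ i := fun e => h.mem₂ (e ▸ hi)
  have hc : c ≠ i := fun e => h.mem₃ (e ▸ hi)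
  have : sbtw a i b ∨ sbtw b i c ∨ sbtw c i a := by
    rw [hlo.grindable] at *
    grind [hlo.grindable]
  rcases this with e | e | e
  · obtain ⟨p, s, h'⟩ := h.exists_isOpposite_aux hi e
    exact ⟨p, s, c, h'⟩
  · obtain ⟨p, s, h'⟩ := h.rotate.exists_isOpposite_aux hi e
    exact ⟨p, s, a, h'⟩
  · obtain ⟨p, s, h'⟩ := h.rotate.rotate.exists_isOpposite_aux hi e
    exact ⟨p, s, b, h'⟩

/-- The separations that split the petal between `p` and `s`, seen from `w`. -/
def splits (Φ : Pseudoflower U k) (p s w : Φ.C) : Set (VPair V) :=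
  {T | T ∈ U.seps ∧ T.order ≤ k ∧ intervalSep Φ.P w p ≤ T ∧ T ≤ intervalSep Φ.P w s}

/-- The part of the separator of `T` inside the petal `i`. -/
def cutset (Φ : Pseudoflower U k) (i : Φ.C) (T : VPair V) : Set V := Φ.P i ∩ T.left ∩ T.right

variable {p i s w : Φ.C}

namespace IsOpposite

variable (h : Φ.IsOpposite p i s w)

include h

theorem pred_subset : Φ.P p ⊆ Φ.P i :=
  Set.subset_union_left.trans (Φ.neighbor_subset i h.mem p s h.succ_pred h.succ_succ)

theorem succ_subset : Φ.P s ⊆ Φ.P i :=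
  Set.subset_union_right.trans (Φ.neighbor_subset i h.mem p s h.succ_pred h.succ_succ)

theorem between_pred : sbtw w p s := h.between_opp.cyclic_left

theorem between_petal : sbtw w i s := by
  have h1 := h.between
  have h2 := h.between_opp
  obtain ⟨lo, -, hlo⟩ := exists_isLinearization i
  rw [hlo.grindable] at *
  grind

theorem between_petal' : sbtw w p i := by
  have h1 := h.between
  have h2 := h.between_opp
  obtain ⟨lo, -, hlo⟩ := exists_isLinearization i
  rw [hlo.grindable] at *
  grind

theorem opp_ne_pred : w ≠ p := (ne_of_sbtw h.between_opp).2.1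

theorem opp_ne_succ : w ≠ s := (ne_of_sbtw h.between_opp).1.symm

theorem opp_ne : w ≠ i := fun e => h.opp_mem (e ▸ h.mem)

theorem intervalSet_pred_succ : intervalSet Φ.P p s = Φ.P i ∪ centre Φ.P := by
  ext x
  rw [mem_intervalSet]
  constructor
  · rintro (⟨z, hz, hx⟩ | hx)
    · left
      rcases h.eq_or z with rfl | rfl | rfl | e
      · exact h.pred_subset hx
      · exact hx
      · exact h.succ_subset hx
      · exfalso
        rw [mem_closedArc] at hz
        obtain ⟨lo, -, hlo⟩ := exists_isLinearization i
        rw [hlo.grindable] at *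
        grind
    · exact Or.inr hx
  · rintro (hx | hx)
    · exact Or.inl ⟨i, mem_closedArc.2 (Or.inr (Or.inr h.between)), hx⟩
    · exact Or.inr hx

theorem intervalSet_opp_succ :
    intervalSet Φ.P w s = intervalSet Φ.P w p ∪ Φ.P i ∪ centre Φ.P := by
  rw [← intervalSet_union h.between_pred, h.intervalSet_pred_succ, Set.union_assoc]

theorem intervalSet_pred_opp :
    intervalSet Φ.P p w = Φ.P i ∪ centre Φ.P ∪ intervalSet Φ.P s w := by
  rw [← intervalSet_union h.between_pred.cyclic_left, h.intervalSet_pred_succ]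

theorem bot_mem : intervalSep Φ.P w p ∈ Φ.splits p s w :=
  ⟨Φ.sep_mem w h.opp_mem p h.pred_mem h.opp_ne_pred,
    Φ.sep_order w h.opp_mem p h.pred_mem h.opp_ne_pred, le_rfl, intervalSep_le h.between_pred⟩

theorem top_mem : intervalSep Φ.P w s ∈ Φ.splits p s w :=
  ⟨Φ.sep_mem w h.opp_mem s h.succ_mem h.opp_ne_succ,
    Φ.sep_order w h.opp_mem s h.succ_mem h.opp_ne_succ, intervalSep_le h.between_pred, le_rfl⟩

/-- Outside the petal, T is squeezed between S(w,p) and S(w,s), so its separator can contain only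
vertices of P_w and of the centre there. -/
theorem left_inter_right {T : VPair V} (hT : T ∈ Φ.splits p s w) :
    T.left ∩ T.right = Φ.cutset i T ∪ Φ.P w ∪ centre Φ.P := by
  obtain ⟨-, -, ⟨l1, l2⟩, ⟨l3, l4⟩⟩ := hT
  simp only [intervalSep] at l1 l2 l3 l4
  ext x
  have hs := Φ.sepAt h.opp_mem h.pred_mem h.opp_ne_pred x
  have e1 := h.intervalSet_opp_succ
  have e2 := h.pred_subset
  have e3 := subset_intervalSet (P := Φ.P) (left_mem_closedArc w p)
  have e4 := subset_intervalSet (P := Φ.P) (right_mem_closedArc s w)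
  have e5 := centre_subset_intervalSet (P := Φ.P) w p
  have e6 := centre_subset_intervalSet (P := Φ.P) s w
  simp only [SepAt, cutset] at *
  grind

/-- A split has order exactly k, and its separator is the disjoint union of the cutset, P_w and the
centre. -/
theorem encard_cutset {T : VPair V} (hT : T ∈ Φ.splits p s w) :
    2 * (Φ.cutset i T).encard + (centre Φ.P).encard = k := by
  have h1 : T.order = k := le_antisymm hT.2.1 (h.le_order T hT.1 hT.2.1 hT.2.2.1 hT.2.2.2)
  have hd : Disjoint (Φ.cutset i T) (Φ.P w) :=
    (h.disjoint.mono_right (Set.inter_subset_left.trans Set.inter_subset_left)).symm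
  have hd' : Disjoint (Φ.cutset i T) (centre Φ.P) :=
    (Φ.disjoint_centre i).mono_left (Set.inter_subset_left.trans Set.inter_subset_left)
  rw [VPair.order, h.left_inter_right hT, Set.encard_union_eq
    (Set.disjoint_union_left.2 ⟨hd', Φ.disjoint_centre w⟩), Set.encard_union_eq hd] at h1
  have h2 := Φ.encard_cutpoint w h.opp_mem
  have h3 := Φ.encard_ne_top h.opp_mem
  have h4 := Φ.encard_centre_ne_top
  have h5 : (Φ.cutset i T).encard ≠ ⊤ := by
    intro e; rw [e] at h1; simp at h1
  generalize (Φ.P w).encard = c at *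
  generalize (centre Φ.P).encard = x at *
  generalize (Φ.cutset i T).encard = y at *
  lift c to ℕ using h3
  lift x to ℕ using h4
  lift y to ℕ using h5
  norm_cast at *
  omega

theorem cutset_bot : Φ.cutset i (intervalSep Φ.P w p) = Φ.P p := by
  ext x
  have hs := Φ.sepAt h.opp_mem h.pred_mem h.opp_ne_pred x
  have e2 := h.pred_subset
  have e3 := subset_intervalSet (P := Φ.P) (right_mem_closedArc w p)
  have e4 := subset_intervalSet (P := Φ.P) (left_mem_closedArc p w)
  have e5 := Set.disjoint_left.1 h.disjoint
  have e6 := Set.disjoint_left.1 (Φ.disjoint_centre i)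
  simp only [SepAt, cutset, intervalSep] at *
  grind

theorem cutset_top : Φ.cutset i (intervalSep Φ.P w s) = Φ.P s := by
  ext x
  have hs := Φ.sepAt h.opp_mem h.succ_mem h.opp_ne_succ x
  have e2 := h.succ_subset
  have e3 := subset_intervalSet (P := Φ.P) (right_mem_closedArc w s)
  have e4 := subset_intervalSet (P := Φ.P) (left_mem_closedArc s w)
  have e5 := Set.disjoint_left.1 h.disjoint
  have e6 := Set.disjoint_left.1 (Φ.disjoint_centre i)
  simp only [SepAt, cutset, intervalSep] at *
  grind

end IsOpposite

/-- A maximal chain of splits of the petal between `p` and `s`. -/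
structure IsMaxSplitChain (Φ : Pseudoflower U k) (p s w : Φ.C) (c : Set (VPair V)) : Prop where
  subset : c ⊆ Φ.splits p s w
  chain : IsChain (· ≤ ·) c
  maximal : ∀ T ∈ Φ.splits p s w, (∀ S ∈ c, T ≤ S ∨ S ≤ T) → T ∈ c

theorem exists_isMaxSplitChain (Φ : Pseudoflower U k) (p s w : Φ.C) :
    ∃ c, Φ.IsMaxSplitChain p s w c := by
  let r : Φ.splits p s w → Φ.splits p s w → Prop := fun S T => S.1 ≤ T.1
  have hm : IsMaxChain r (maxChain r) := maxChain_spec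
  refine ⟨Subtype.val '' maxChain r, ?_, ?_, ?_⟩
  · rintro _ ⟨T, -, rfl⟩
    exact T.2
  · rintro _ ⟨S, hS, rfl⟩ _ ⟨T, hT, rfl⟩ hne
    exact hm.1 hS hT fun e => hne (congrArg _ e)
  · intro T hT hc
    refine ⟨⟨T, hT⟩, ?_, rfl⟩
    have h1 : IsChain r (insert ⟨T, hT⟩ (maxChain r)) :=
      hm.1.insert fun S hS _ => hc S.1 ⟨S, hS, rfl⟩
    rw [hm.2 h1 (Set.subset_insert _ _)]
    exact Set.mem_insert _ _

/-- The pair `(c, d)` is a jump of the chain `𝒞`. -/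
def IsJump {α : Type u} [PartialOrder α] (𝒞 : Set α) (c d : α) : Prop :=
  c ∈ 𝒞 ∧ d ∈ 𝒞 ∧ c < d ∧ ∀ y ∈ 𝒞, y ≤ c ∨ d ≤ y

namespace IsMaxSplitChain

variable {𝒞 : Set (VPair V)}

theorem le_total (h : Φ.IsMaxSplitChain p s w 𝒞) {S T : VPair V} (hS : S ∈ 𝒞) (hT : T ∈ 𝒞) :
    S ≤ T ∨ T ≤ S := h.chain.total hS hT

/-- The supremum supplied by limit-closedness is again a split comparable to the whole chain, so
maximality puts it into the chain. Its exact right side is what locates individual vertices later.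
-/
theorem exists_sup (h : Φ.IsMaxSplitChain p s w 𝒞) (ho : Φ.IsOpposite p i s w)
    (hU : U.IsLimitClosed) {A : Set (VPair V)} (hA : A ⊆ 𝒞) (hne : A.Nonempty) :
    ∃ t ∈ 𝒞, (∀ a ∈ A, a ≤ t) ∧ (∀ y ∈ 𝒞, (∀ a ∈ A, a ≤ y) → t ≤ y) ∧
      t.right = ⋂ a ∈ A, a.right := by
  obtain ⟨t, ⟨⟨hub, htU⟩, hleast⟩, hto, X, -, hr⟩ := hU k A (fun a ha => (h.subset (hA ha)).1) hne
    (h.chain.mono hA) (fun a ha => (h.subset (hA ha)).2.1)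
  have hl : ∀ y ∈ U.seps, (∀ a ∈ A, a ≤ y) → t ≤ y := fun y hy hy' => hleast ⟨hy', hy⟩
  obtain ⟨a₀, ha₀⟩ := hne
  have ht : t ∈ Φ.splits p s w := ⟨htU, hto, (h.subset (hA ha₀)).2.2.1.trans (hub ha₀),
    hl _ ho.top_mem.1 fun a ha => (h.subset (hA ha)).2.2.2⟩
  refine ⟨t, h.maximal t ht fun S hS => ?_, fun a ha => hub ha, fun y hy => hl y (h.subset hy).1, hr⟩
  by_cases hc : ∀ a ∈ A, a ≤ S
  · exact Or.inl (hl S (h.subset hS).1 hc)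
  · push Not at hc
    obtain ⟨a, ha, hna⟩ := hc
    exact Or.inr (((h.le_total hS (hA ha)).resolve_right hna).trans (hub ha))

theorem exists_inf (h : Φ.IsMaxSplitChain p s w 𝒞) (ho : Φ.IsOpposite p i s w)
    (hU : U.IsLimitClosed) {A : Set (VPair V)} (hA : A ⊆ 𝒞) (hne : A.Nonempty) :
    ∃ t ∈ 𝒞, (∀ a ∈ A, t ≤ a) ∧ t.left = ⋂ a ∈ A, a.left := by
  obtain ⟨t, ⟨⟨hub, htU⟩, hleast⟩, hto, X, -, hr⟩ := hU k (VPair.inv '' A)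
    (by rintro _ ⟨a, ha, rfl⟩; exact U.inv_mem a (h.subset (hA ha)).1) (hne.image _)
    (by
      rintro _ ⟨a, ha, rfl⟩ _ ⟨b, hb, rfl⟩ -
      rcases h.le_total (hA ha) (hA hb) with e | e
      · exact Or.inr ⟨e.2, e.1⟩
      · exact Or.inl ⟨e.2, e.1⟩)
    (by rintro _ ⟨a, ha, rfl⟩; rw [VPair.order_inv]; exact (h.subset (hA ha)).2.1)
  have hub' : ∀ a ∈ A, t.inv ≤ a := fun a ha => by
    have := hub ⟨a, ha, rfl⟩
    exact ⟨this.2, this.1⟩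
  have hl : ∀ y ∈ U.seps, (∀ a ∈ A, y ≤ a) → y ≤ t.inv := fun y hy hy' => by
    have : t ≤ y.inv := hleast ⟨by
      rintro _ ⟨a, ha, rfl⟩
      exact ⟨(hy' a ha).2, (hy' a ha).1⟩, U.inv_mem y hy⟩
    exact ⟨this.2, this.1⟩
  obtain ⟨a₀, ha₀⟩ := hne
  have ht : t.inv ∈ Φ.splits p s w := ⟨U.inv_mem t htU, by rwa [VPair.order_inv],
    hl _ ho.bot_mem.1 fun a ha => (h.subset (hA ha)).2.2.1,
    (hub' a₀ ha₀).trans (h.subset (hA ha₀)).2.2.2⟩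
  refine ⟨t.inv, h.maximal _ ht fun S hS => ?_, hub', ?_⟩
  · by_cases hc : ∀ a ∈ A, S ≤ a
    · exact Or.inr (hl S (h.subset hS).1 hc)
    · push Not at hc
      obtain ⟨a, ha, hna⟩ := hc
      exact Or.inl ((hub' a ha).trans ((h.le_total hS (hA ha)).resolve_left hna))
  · rw [Set.biInter_image] at hr
    exact hr

theorem bot_mem (h : Φ.IsMaxSplitChain p s w 𝒞) (ho : Φ.IsOpposite p i s w) :
    intervalSep Φ.P w p ∈ 𝒞 :=
  h.maximal _ ho.bot_mem fun _ hS => Or.inl (h.subset hS).2.2.1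

theorem top_mem (h : Φ.IsMaxSplitChain p s w 𝒞) (ho : Φ.IsOpposite p i s w) :
    intervalSep Φ.P w s ∈ 𝒞 :=
  h.maximal _ ho.top_mem fun _ hS => Or.inr (h.subset hS).2.2.2

theorem mem_left_or_mem_right (h : Φ.IsMaxSplitChain p s w 𝒞) {S : VPair V} (hS : S ∈ 𝒞) (x : V) :
    x ∈ S.left ∨ x ∈ S.right := by
  have : x ∈ S.left ∪ S.right := by rw [U.cover S (h.subset hS).1]; trivial
  exact this

/-- A vertex of the petal that lies in no cutset lies between the two sides of a jump. -/
theorem exists_isJump (h : Φ.IsMaxSplitChain p s w 𝒞) (ho : Φ.IsOpposite p i s w)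
    (hU : U.IsLimitClosed) {x : V} (hx : x ∈ Φ.P i) (hn : ∀ S ∈ 𝒞, x ∉ Φ.cutset i S) :
    ∃ c d, IsJump 𝒞 c d ∧ x ∉ c.left ∧ x ∈ c.right ∧ x ∈ d.left ∧ x ∉ d.right := by
  have hn' : ∀ S ∈ 𝒞, ¬ (x ∈ S.left ∧ x ∈ S.right) := fun S hS hc => hn S hS ⟨⟨hx, hc.1⟩, hc.2⟩
  have hc := fun S hS => h.mem_left_or_mem_right (S := S) hS x
  have hb : x ∉ (intervalSep Φ.P w p).left := fun hl => hn' _ (h.bot_mem ho) ⟨hl, by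
    rw [intervalSep, ho.intervalSet_pred_opp]; exact Or.inl (Or.inl hx)⟩
  have ht : x ∉ (intervalSep Φ.P w s).right := fun hl => hn' _ (h.top_mem ho) ⟨by
    rw [intervalSep, ho.intervalSet_opp_succ]; exact Or.inl (Or.inr hx), hl⟩
  -- c is the supremum of the splits with x strictly on the right, d the infimum of those with x
  -- strictly on the left. The formulas for their sides keep x on the right of c and on the left of
  -- d.
  obtain ⟨c, hc𝒞, hc1, -, hc2⟩ := h.exists_sup ho hU (A := {S | S ∈ 𝒞 ∧ x ∉ S.left})
    (fun S hS => hS.1) ⟨_, h.bot_mem ho, hb⟩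
  obtain ⟨d, hd𝒞, hd1, hd2⟩ := h.exists_inf ho hU (A := {S | S ∈ 𝒞 ∧ x ∉ S.right})
    (fun S hS => hS.1) ⟨_, h.top_mem ho, ht⟩
  have hcr : x ∈ c.right := by
    rw [hc2]
    simp only [Set.mem_iInter]
    rintro S ⟨hS, hxS⟩
    exact (hc S hS).resolve_left hxS
  have hdl : x ∈ d.left := by
    rw [hd2]
    simp only [Set.mem_iInter]
    rintro S ⟨hS, hxS⟩
    exact (hc S hS).resolve_right hxS
  have hcl : x ∉ c.left := fun hl => hn' c hc𝒞 ⟨hl, hcr⟩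
  have hdr : x ∉ d.right := fun hr => hn' d hd𝒞 ⟨hdl, hr⟩
  have hndc : ¬ d ≤ c := fun hle => hcl (hle.1 hdl)
  refine ⟨c, d, ⟨hc𝒞, hd𝒞, lt_of_le_not_ge ((h.le_total hc𝒞 hd𝒞).resolve_right hndc) hndc,
    fun y hy => ?_⟩, hcl, hcr, hdl, hdr⟩
  by_cases hxy : x ∈ y.left
  · exact Or.inr (hd1 y ⟨hy, fun hr => hn' y hy ⟨hxy, hr⟩⟩)
  · exact Or.inl (hc1 y ⟨hy, hxy⟩)

/-- All splits contain V(w,p) on the left and V(s,w) on the right, so two of them can differ only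
within the petal. -/
theorem sep_eq_of_subset (h : Φ.IsMaxSplitChain p s w 𝒞) (ho : Φ.IsOpposite p i s w) {S T : VPair V}
    (hS : S ∈ 𝒞) (hT : T ∈ 𝒞) (hST : S ≤ T)
    (hj : ∀ x, x ∈ Φ.P i → x ∈ S.right → x ∈ T.left → x ∈ S.left ∧ x ∈ T.right) : S = T := by
  apply hST.antisymm
  have h1 := (h.subset hS).2.2
  have h2 := (h.subset hT).2.2
  have e1 := ho.intervalSet_opp_succ
  have e2 := ho.intervalSet_pred_opp
  have e5 := centre_subset_intervalSet (P := Φ.P) w p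
  have e6 := centre_subset_intervalSet (P := Φ.P) s w
  constructor
  · intro x hx
    by_contra hxS
    have h3 := (h.mem_left_or_mem_right hS x).resolve_left hxS
    have h4 := h2.2.1 hx
    have h5 := fun hc => hxS (h1.1.1 hc)
    simp only [intervalSep] at h4 h5
    have h6 : x ∈ Φ.P i := by grind
    exact hxS (hj x h6 h3 hx).1
  · intro x hx
    by_contra hxT
    have h3 := (h.mem_left_or_mem_right hT x).resolve_right hxT
    have h4 := h1.1.2 hx
    have h5 := fun hc => hxT (h2.2.2 hc)
    simp only [intervalSep] at h4 h5
    have h6 : x ∈ Φ.P i := by grind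
    exact hxT (hj x h6 hx h3).2

/-- Two splits between which the cutset is constant have a jump between them. -/
theorem exists_isJump_of_cutset_eq (h : Φ.IsMaxSplitChain p s w 𝒞) (ho : Φ.IsOpposite p i s w)
    (hU : U.IsLimitClosed) {S T : VPair V} (hS : S ∈ 𝒞) (hT : T ∈ 𝒞) (hST : S < T)
    (hcut : ∀ y ∈ 𝒞, S ≤ y → y ≤ T → Φ.cutset i y = Φ.cutset i S) :
    ∃ c d, IsJump 𝒞 c d ∧ S ≤ c ∧ d ≤ T := by
  by_contra! hno
  have hj : ∀ x, x ∈ Φ.P i → x ∈ T.left → x ∈ S.right → x ∈ S.left ∧ x ∈ T.right := by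
    intro x hx hxT hxS
    have hcT := hcut T hT hST.le le_rfl
    have key : x ∈ Φ.cutset i S → x ∈ S.left ∧ x ∈ T.right := fun hxc =>
      ⟨hxc.1.2, by rw [← hcT] at hxc; exact hxc.2⟩
    -- A vertex in no cutset would produce a jump between S and T. Any other vertex of the petal
    -- right of S and left of T lies in their common cutset, so S and T coincide.
    by_cases hn : ∀ S ∈ 𝒞, x ∉ Φ.cutset i S
    · exfalso
      obtain ⟨c, d, hcd, h1, h2, h3, h4⟩ := h.exists_isJump ho hU hx hn
      refine hno c d hcd ?_ ?_
      · exact (hcd.2.2.2 S hS).resolve_right fun hle => h4 (hle.2 hxS)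
      · exact (hcd.2.2.2 T hT).resolve_left fun hle => h1 (hle.1 hxT)
    · push Not at hn
      obtain ⟨y, hy, hxy⟩ := hn
      rcases h.le_total hy hS with e | e
      · exact key ⟨⟨hx, e.1 hxy.1.2⟩, hxS⟩
      rcases h.le_total hy hT with e' | e'
      · rw [hcut y hy e e'] at hxy
        exact key hxy
      · have : x ∈ Φ.cutset i T := ⟨⟨hx, hxT⟩, e'.2 hxy.2⟩
        rw [hcT] at this
        exact key this
  exact hST.ne (h.sep_eq_of_subset ho hS hT hST.le fun x hx hxS hxT => hj x hx hxT hxS)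

/-- If the cutset of `z` is contained in another petal, then the cutsets are constant on one of the
two sides of `z`. -/
theorem cutset_eq_of_subset (h : Φ.IsMaxSplitChain p s w 𝒞) (ho : Φ.IsOpposite p i s w)
    {z : VPair V} (hz : z ∈ 𝒞) {j : Φ.C} (hj : j ∈ Φ.I) (hji : j ≠ i)
    (hsub : Φ.cutset i z ⊆ Φ.P j) :
    (∀ y ∈ 𝒞, y ≤ z → Φ.cutset i y = Φ.cutset i z) ∨
      (∀ y ∈ 𝒞, z ≤ y → Φ.cutset i y = Φ.cutset i z) := by
  have heq : ∀ y ∈ 𝒞, Φ.cutset i z ⊆ Φ.cutset i y → Φ.cutset i y = Φ.cutset i z := by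
    intro y hy hsub
    have h1 := ho.encard_cutset (h.subset hy)
    have h2 := ho.encard_cutset (h.subset hz)
    refine (Set.Finite.eq_of_subset_of_encard_le ?_ hsub
      (ENat.two_mul_add_cancel h1 h2).le).symm
    rw [← Set.encard_ne_top_iff]
    intro e
    rw [e] at h2
    simp at h2
  have hjw : j ≠ w := fun e => ho.opp_mem (e ▸ hj)
  have hjp : j ≠ p := fun e => ho.pred_mem (e ▸ hj)
  have hjs : j ≠ s := fun e => ho.succ_mem (e ▸ hj)
  have hpos : sbtw s j w ∨ sbtw w j p := by
    have h1 := ho.eq_or j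
    have h2 := ho.between_opp
    obtain ⟨lo, -, hlo⟩ := exists_isLinearization i
    rw [hlo.grindable] at *
    grind [hlo.grindable]
  -- The petal j lies on the right of every split or on the left of every split. A cutset inside P_j
  -- thus persists in all later or all earlier splits, where equality follows by size.
  rcases hpos with e | e
  · right
    refine fun y hy hzy => heq y hy fun x hx => ⟨⟨hx.1.1, hzy.1 hx.1.2⟩, (h.subset hy).2.2.2.2 ?_⟩
    exact subset_intervalSet (mem_closedArc.2 (Or.inr (Or.inr e))) (hsub hx)
  · left
    refine fun y hy hzy => heq y hy fun x hx => ⟨⟨hx.1.1, (h.subset hy).2.2.1.1 ?_⟩, hzy.2 hx.2⟩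
    exact subset_intervalSet (mem_closedArc.2 (Or.inr (Or.inr e))) (hsub hx)

/-- Cutsets are convex along the chain. -/
theorem cutset_eq_of_between (h : Φ.IsMaxSplitChain p s w 𝒞) (ho : Φ.IsOpposite p i s w)
    {S T y : VPair V} (hS : S ∈ 𝒞) (hy : y ∈ 𝒞) (hST : Φ.cutset i S = Φ.cutset i T)
    (h1 : S ≤ y) (h2 : y ≤ T) : Φ.cutset i y = Φ.cutset i S := by
  have e1 := ho.encard_cutset (h.subset hy)
  have e2 := ho.encard_cutset (h.subset hS)
  refine (Set.Finite.eq_of_subset_of_encard_le ?_ ?_ (ENat.two_mul_add_cancel e1 e2).le).symm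
  · rw [← Set.encard_ne_top_iff]
    intro e
    rw [e] at e2
    simp at e2
  · intro x hx
    have hx' := hx
    rw [hST] at hx'
    exact ⟨⟨hx.1.1, h1.1 hx.1.2⟩, h2.2 hx'.2⟩

end IsMaxSplitChain

end Pseudoflower
end Splits

/-! ### Doubling selected splits -/

section Cuts

variable {V : Type u} {U : VertexUniverse V} {k : ℕ}

/-- A separation together with the information which of two copies of it is meant. -/
abbrev Cut (V : Type u) := VPair V ×ₗ Bool

namespace Cut

/-- The separation of a cut. -/
def sep (κ : Cut V) : VPair V := (ofLex κ).1

/-- The copy of the separation of a cut. -/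
def bit (κ : Cut V) : Bool := (ofLex κ).2

/-- The copy `b` of the separation `S`. -/
def mk (S : VPair V) (b : Bool) : Cut V := toLex (S, b)

@[simp] theorem sep_mk (S : VPair V) (b : Bool) : (mk S b).sep = S := rfl

@[simp] theorem bit_mk (S : VPair V) (b : Bool) : (mk S b).bit = b := rfl

theorem ext_iff' {κ μ : Cut V} : κ = μ ↔ κ.sep = μ.sep ∧ κ.bit = μ.bit := by
  constructor
  · rintro rfl; exact ⟨rfl, rfl⟩
  · rintro ⟨h1, h2⟩
    exact congrArg toLex (Prod.ext h1 h2)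

theorem le_iff {κ μ : Cut V} :
    κ ≤ μ ↔ κ.sep < μ.sep ∨ (κ.sep = μ.sep ∧ (κ.bit = true → μ.bit = true)) := by
  rw [Prod.Lex.le_iff]
  rfl

theorem lt_iff {κ μ : Cut V} :
    κ < μ ↔ κ.sep < μ.sep ∨ (κ.sep = μ.sep ∧ κ.bit = false ∧ μ.bit = true) := by
  rw [Prod.Lex.lt_iff, Bool.lt_iff]
  rfl

theorem sep_le {κ μ : Cut V} (h : κ ≤ μ) : κ.sep ≤ μ.sep := by
  rcases le_iff.1 h with h | h
  · exact h.le
  · exact h.1.le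

end Cut

namespace Pseudoflower

/-- A choice of maximal chains of splits for all petals, and of a split for every cutset. -/
structure Subdivision (Φ : Pseudoflower U k) where
  a : Φ.C
  b : Φ.C
  c : Φ.C
  isTripod : Φ.IsTripod a b c
  pred : Φ.C → Φ.C
  succ : Φ.C → Φ.C
  opp : Φ.C → Φ.C
  isOpposite : ∀ i ∈ Φ.I, Φ.IsOpposite (pred i) i (succ i) (opp i)
  chain : Φ.C → Set (VPair V)
  isMax : ∀ i ∈ Φ.I, Φ.IsMaxSplitChain (pred i) (succ i) (opp i) (chain i)
  -- A dummy split imposing no condition on vertices, so that cutpoints and petals can share one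
  -- formula for their vertex sets.
  chain_cutpoint : ∀ v, v ∉ Φ.I → chain v = {⟨Set.univ, Set.univ⟩}
  pick : Set V → Φ.C × VPair V
  pick_mem : ∀ i ∈ Φ.I, ∀ S ∈ chain i, (pick (Φ.cutset i S)).1 ∈ Φ.I ∧
    (pick (Φ.cutset i S)).2 ∈ chain (pick (Φ.cutset i S)).1 ∧
    Φ.cutset (pick (Φ.cutset i S)).1 (pick (Φ.cutset i S)).2 = Φ.cutset i S
  pick_trivial : ∀ i ∈ Φ.I, 2 * (Φ.P i).encard + (centre Φ.P).encard = k → (pick (Φ.P i)).1 = i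

/-- If a set A is the vertex set of a petal of least possible size, the choice for A is the first
split of that petal; the last axiom makes the petal unique. Otherwise any split with cutset A will
do. -/
theorem IsTripod.exists_subdivision {Φ : Pseudoflower U k} {a b c : Φ.C} (h : Φ.IsTripod a b c) :
    Nonempty Φ.Subdivision := by
  classical
  have h1 : ∀ i, ∃ t : Φ.C × Φ.C × Φ.C, i ∈ Φ.I → Φ.IsOpposite t.1 i t.2.1 t.2.2 := by
    intro i
    by_cases hi : i ∈ Φ.I
    · obtain ⟨p, s, w, h1⟩ := h.exists_isOpposite hi
      exact ⟨(p, s, w), fun _ => h1⟩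
    · exact ⟨(i, i, i), fun h => absurd h hi⟩
  choose t ht using h1
  have h2 : ∀ i, ∃ 𝒞 : Set (VPair V),
      (i ∈ Φ.I → Φ.IsMaxSplitChain (t i).1 (t i).2.1 (t i).2.2 𝒞) ∧
      (i ∉ Φ.I → 𝒞 = {⟨Set.univ, Set.univ⟩}) := by
    intro i
    by_cases hi : i ∈ Φ.I
    · obtain ⟨𝒞, h𝒞⟩ := Φ.exists_isMaxSplitChain (t i).1 (t i).2.1 (t i).2.2
      exact ⟨𝒞, fun _ => h𝒞, fun h => absurd hi h⟩
    · exact ⟨_, fun h => absurd h hi, fun _ => rfl⟩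
  choose 𝒞 h𝒞 h𝒞' using h2
  have h3 : ∀ A : Set V, ∃ q : Φ.C × VPair V,
      (∀ i ∈ Φ.I, ∀ S ∈ 𝒞 i, Φ.cutset i S = A →
        q.1 ∈ Φ.I ∧ q.2 ∈ 𝒞 q.1 ∧ Φ.cutset q.1 q.2 = A) ∧
      ∀ i ∈ Φ.I, 2 * (Φ.P i).encard + (centre Φ.P).encard = k → Φ.P i = A → q.1 = i := by
    intro A
    by_cases hA : ∃ i ∈ Φ.I, 2 * (Φ.P i).encard + (centre Φ.P).encard = k ∧ Φ.P i = A
    · obtain ⟨i, hi, hc, rfl⟩ := hA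
      have ho := ht i hi
      refine ⟨(i, intervalSep Φ.P (t i).2.2 (t i).1), fun j hj S hS hjS =>
        ⟨hi, (h𝒞 i hi).bot_mem ho, ?_⟩, fun j hj hjc hji => ?_⟩
      · refine (ho.cutset_bot).trans ?_
        refine Set.Finite.eq_of_subset_of_encard_le ?_ ho.pred_subset
          (ENat.two_mul_add_cancel hc (Φ.encard_cutpoint _ ho.pred_mem)).le
        exact Set.encard_ne_top_iff.1 (Φ.encard_ne_top ho.pred_mem)
      · exact Φ.petal_injective i hi j hj hc hji.symm
    · by_cases hA' : ∃ i ∈ Φ.I, ∃ S ∈ 𝒞 i, Φ.cutset i S = A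
      · obtain ⟨i, hi, S, hS, hiS⟩ := hA'
        exact ⟨(i, S), fun _ _ _ _ _ => ⟨hi, hS, hiS⟩,
          fun j hj hjc hji => absurd ⟨j, hj, hjc, hji⟩ hA⟩
      · exact ⟨(a, ⟨∅, ∅⟩), fun i hi S hS hiS => absurd ⟨i, hi, S, hS, hiS⟩ hA',
          fun j hj hjc hji => absurd ⟨j, hj, hjc, hji⟩ hA⟩
  choose q hq hq' using h3
  exact ⟨⟨a, b, c, h, fun i => (t i).1, fun i => (t i).2.1, fun i => (t i).2.2,
    fun i hi => ht i hi, 𝒞, h𝒞, h𝒞', q,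
    fun i hi S hS => hq _ i hi S hS rfl, fun i hi hc => hq' _ i hi hc rfl⟩⟩

namespace Subdivision

variable {Φ : Pseudoflower U k} (D : Φ.Subdivision)

/-- The cuts at `z`: the separations of the chain, with the chosen ones doubled. -/
def cuts (z : Φ.C) : Set (Cut V) :=
  {κ | κ.sep ∈ D.chain z ∧ (κ.bit = true → z ∈ Φ.I ∧ D.pick (Φ.cutset z κ.sep) = (z, κ.sep))}

variable {D} {z i : Φ.C} {κ μ : Cut V}

theorem mk_false_mem_cuts {S : VPair V} (h : S ∈ D.chain z) : Cut.mk S false ∈ D.cuts z :=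
  ⟨h, by simp⟩

theorem chain_total {S T : VPair V} (hS : S ∈ D.chain z) (hT : T ∈ D.chain z) : S ≤ T ∨ T ≤ S := by
  by_cases hz : z ∈ Φ.I
  · exact (D.isMax z hz).le_total hS hT
  · rw [D.chain_cutpoint z hz] at hS hT
    rw [hS, hT]
    exact Or.inl le_rfl

theorem cuts_total (hκ : κ ∈ D.cuts z) (hμ : μ ∈ D.cuts z) : κ ≤ μ ∨ μ ≤ κ := by
  rw [Cut.le_iff, Cut.le_iff]
  rcases chain_total hκ.1 hμ.1 with h | h
  · rcases h.lt_or_eq with h | h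
    · exact Or.inl (Or.inl h)
    · grind
  · rcases h.lt_or_eq with h | h
    · exact Or.inr (Or.inl h)
    · grind

theorem eq_of_mem_cuts (hz : z ∉ Φ.I) (hκ : κ ∈ D.cuts z) :
    κ = Cut.mk ⟨Set.univ, Set.univ⟩ false := by
  have h1 := hκ.1
  rw [D.chain_cutpoint z hz] at h1
  rw [Cut.ext_iff']
  refine ⟨h1, ?_⟩
  have := hκ.2
  simp only [Cut.bit_mk]
  grind

variable (D) in
/-- The least cut of a petal. -/
def bot (i : Φ.C) : Cut V := Cut.mk (intervalSep Φ.P (D.opp i) (D.pred i)) false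

theorem bot_mem (hi : i ∈ Φ.I) : D.bot i ∈ D.cuts i :=
  mk_false_mem_cuts ((D.isMax i hi).bot_mem (D.isOpposite i hi))

theorem bot_le (hi : i ∈ Φ.I) (hκ : κ ∈ D.cuts i) : D.bot i ≤ κ := by
  rw [Cut.le_iff]
  rcases (((D.isMax i hi).subset hκ.1).2.2.1).lt_or_eq with h | h
  · exact Or.inl h
  · exact Or.inr ⟨h, by simp [bot]⟩

theorem exists_top (hi : i ∈ Φ.I) : ∃ μ ∈ D.cuts i,
    μ.sep = intervalSep Φ.P (D.opp i) (D.succ i) ∧ ∀ κ ∈ D.cuts i, κ ≤ μ := by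
  have hmem := (D.isMax i hi).top_mem (D.isOpposite i hi)
  have hle : ∀ κ ∈ D.cuts i, κ.sep ≤ intervalSep Φ.P (D.opp i) (D.succ i) :=
    fun κ hκ => ((D.isMax i hi).subset hκ.1).2.2.2
  by_cases h : Cut.mk (intervalSep Φ.P (D.opp i) (D.succ i)) true ∈ D.cuts i
  · refine ⟨_, h, rfl, fun κ hκ => ?_⟩
    rw [Cut.le_iff]
    rcases (hle κ hκ).lt_or_eq with h | h
    · exact Or.inl h
    · exact Or.inr ⟨h, by simp⟩
  · refine ⟨_, mk_false_mem_cuts hmem, rfl, fun κ hκ => ?_⟩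
    rw [Cut.le_iff]
    rcases (hle κ hκ).lt_or_eq with h' | h'
    · exact Or.inl h'
    · refine Or.inr ⟨h', fun hb => absurd ?_ h⟩
      have : Cut.mk (intervalSep Φ.P (D.opp i) (D.succ i)) true = κ := by
        rw [Cut.ext_iff']; exact ⟨h'.symm, hb.symm⟩
      rw [this]
      exact hκ

/-- If A has no greatest element, its separations stay strictly below their supremum t, so the first
copy of t is the least upper bound. -/
theorem exists_sup_cuts (hU : U.IsLimitClosed) (hi : i ∈ Φ.I) {A : Set (Cut V)} (hA : A ⊆ D.cuts i)
    (hne : A.Nonempty) :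
    ∃ m ∈ D.cuts i, (∀ κ ∈ A, κ ≤ m) ∧ ∀ y ∈ D.cuts i, (∀ κ ∈ A, κ ≤ y) → m ≤ y := by
  by_cases hmax : ∃ m ∈ A, ∀ κ ∈ A, κ ≤ m
  · obtain ⟨m, hm, hm'⟩ := hmax
    exact ⟨m, hA hm, hm', fun y _ hy' => hy' m hm⟩
  · obtain ⟨t, ht, ht1, ht2, -⟩ := (D.isMax i hi).exists_sup (D.isOpposite i hi) hU
      (A := Cut.sep '' A) (by rintro _ ⟨κ, hκ, rfl⟩; exact (hA hκ).1) (hne.image _)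
    have hlt : ∀ κ ∈ A, κ.sep < t := by
      intro κ hκ
      refine lt_of_le_of_ne (ht1 _ ⟨κ, hκ, rfl⟩) fun he => hmax ?_
      have key : ∀ m ∈ A, m.sep = t → (∀ κ ∈ A, κ.sep = t → κ.bit = true → m.bit = true) →
          ∀ κ ∈ A, κ ≤ m := by
        intro m hm hmt hb κ' hκ'
        rw [Cut.le_iff]
        rcases (ht1 _ ⟨κ', hκ', rfl⟩).lt_or_eq with h | h
        · exact Or.inl (hmt ▸ h)
        · exact Or.inr ⟨h.trans hmt.symm, hb κ' hκ' h⟩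
      by_cases hb : ∃ m ∈ A, m.sep = t ∧ m.bit = true
      · obtain ⟨m, hm, hmt, hmb⟩ := hb
        exact ⟨m, hm, key m hm hmt fun _ _ _ _ => hmb⟩
      · exact ⟨κ, hκ, key κ hκ he fun m hm h1 h2 => absurd ⟨m, hm, h1, h2⟩ hb⟩
    refine ⟨Cut.mk t false, mk_false_mem_cuts ht, fun κ hκ => ?_, fun y hy hy' => ?_⟩
    · rw [Cut.le_iff]
      exact Or.inl (hlt κ hκ)
    · rw [Cut.le_iff]
      have : t ≤ y.sep := ht2 _ hy.1 (by
        rintro _ ⟨κ, hκ, rfl⟩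
        exact Cut.sep_le (hy' κ hκ))
      rcases this.lt_or_eq with h | h
      · exact Or.inl h
      · exact Or.inr ⟨h, by simp⟩

theorem isJump_doubled {S : VPair V} (hi : i ∈ Φ.I) (hS : S ∈ D.chain i)
    (hp : D.pick (Φ.cutset i S) = (i, S)) :
    IsJump (D.cuts i) (Cut.mk S false) (Cut.mk S true) := by
  refine ⟨mk_false_mem_cuts hS, ⟨hS, fun _ => ⟨hi, hp⟩⟩, Cut.lt_iff.2 (by simp), fun y hy => ?_⟩
  rw [Cut.le_iff, Cut.le_iff]
  simp only [Cut.sep_mk, Cut.bit_mk]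
  rcases chain_total hy.1 hS with h | h <;> rcases h.lt_or_eq with h | h <;> grind

theorem exists_isJump_cuts {S T : VPair V} (hST : IsJump (D.chain i) S T) :
    ∃ κ μ, IsJump (D.cuts i) κ μ ∧ κ.sep = S ∧ μ.sep = T ∧ μ.bit = false ∧
      ∀ κ' ∈ D.cuts i, κ'.sep = S → κ' ≤ κ := by
  obtain ⟨hS, hT, hlt, hj⟩ := hST
  have hex : ∃ κ ∈ D.cuts i, κ.sep = S ∧ ∀ κ' ∈ D.cuts i, κ'.sep = S → κ' ≤ κ := by
    by_cases hb : Cut.mk S true ∈ D.cuts i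
    · refine ⟨_, hb, rfl, fun κ' _ h => ?_⟩
      rw [Cut.le_iff]
      exact Or.inr ⟨h, by simp⟩
    · refine ⟨_, mk_false_mem_cuts hS, rfl, fun κ' hκ' h => ?_⟩
      rw [Cut.le_iff]
      refine Or.inr ⟨h, fun hb' => absurd ?_ hb⟩
      have : Cut.mk S true = κ' := by
        rw [Cut.ext_iff']; exact ⟨h.symm, hb'.symm⟩
      rw [this]
      exact hκ'
  obtain ⟨κ, hκ, rfl, hκ'⟩ := hex
  refine ⟨κ, Cut.mk T false, ⟨hκ, mk_false_mem_cuts hT, Cut.lt_iff.2 (Or.inl hlt), fun y hy => ?_⟩,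
    rfl, rfl, rfl, hκ'⟩
  rcases hj _ hy.1 with h | h
  · left
    rcases h.lt_or_eq with h | h
    · exact Cut.le_iff.2 (Or.inl h)
    · exact hκ' y hy h
  · right
    rw [Cut.le_iff]
    rcases h.lt_or_eq with h | h
    · exact Or.inl h
    · exact Or.inr ⟨h, by simp⟩

theorem isJump_sep (h : IsJump (D.cuts i) κ μ) :
    IsJump (D.chain i) κ.sep μ.sep ∨ (κ.sep = μ.sep ∧ κ.bit = false ∧ μ.bit = true) := by
  obtain ⟨hκ, hμ, hlt, hj⟩ := h
  rcases Cut.lt_iff.1 hlt with h | h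
  · left
    refine ⟨hκ.1, hμ.1, h, fun y hy => ?_⟩
    exact (hj _ (mk_false_mem_cuts hy)).imp Cut.sep_le Cut.sep_le
  · exact Or.inr h

/-- If the first and last split of a petal coincide, then P_i = P_p has the least possible size.
`pick_trivial` then makes this only split the doubled one, so no petal disappears in the
subdivision. -/
theorem exists_bot_lt (hi : i ∈ Φ.I) : ∃ μ ∈ D.cuts i, D.bot i < μ := by
  have ho := D.isOpposite i hi
  obtain ⟨μ, hμ, hsep, hmax⟩ := exists_top (D := D) hi
  refine ⟨μ, hμ, lt_of_le_of_ne (bot_le hi hμ) fun he => ?_⟩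
  have e : intervalSep Φ.P (D.opp i) (D.pred i) = intervalSep Φ.P (D.opp i) (D.succ i) := by
    rw [← hsep, ← he]; rfl
  have hPi : Φ.P i = Φ.P (D.pred i) := by
    refine Set.Subset.antisymm (fun x hx => ?_) ho.pred_subset
    rw [← ho.cutset_bot]
    refine ⟨⟨hx, ?_⟩, ?_⟩
    · rw [e, intervalSep, ho.intervalSet_opp_succ]
      exact Or.inl (Or.inr hx)
    · rw [intervalSep, ho.intervalSet_pred_opp]
      exact Or.inl (Or.inl hx)
  have hcut : Φ.cutset i (D.bot i).sep = Φ.P i := by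
    rw [hPi]; exact ho.cutset_bot
  have hbot := (bot_mem (D := D) hi).1
  have h1 := D.pick_mem i hi _ hbot
  have h2 := D.pick_trivial i hi (by rw [hPi]; exact Φ.encard_cutpoint _ ho.pred_mem)
  rw [hcut, h2] at h1
  have h3 : (D.pick (Φ.P i)).2 = (D.bot i).sep := by
    have h4 := ((D.isMax i hi).subset h1.2.1).2.2
    refine le_antisymm ?_ h4.1
    refine h4.2.trans ?_
    rw [← e]
    exact le_rfl
  have hmem : Cut.mk (D.bot i).sep true ∈ D.cuts i :=
    ⟨hbot, fun _ => ⟨hi, by rw [Cut.sep_mk, hcut]; exact Prod.ext h2 h3⟩⟩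
  have := hmax _ hmem
  rw [← he, Cut.le_iff] at this
  simp [bot] at this

/-- Between any two cuts there is a jump. -/
theorem exists_isJump_between (hU : U.IsLimitClosed) (hi : i ∈ Φ.I) {α β : Cut V}
    (hα : α ∈ D.cuts i) (hβ : β ∈ D.cuts i) (hlt : α < β) :
    ∃ κ μ, IsJump (D.cuts i) κ μ ∧ α ≤ κ ∧ μ ≤ β := by
  have ho := D.isOpposite i hi
  have hm := D.isMax i hi
  rcases Cut.lt_iff.1 hlt with h | ⟨h1, h2, h3⟩
  · have case1 : ∀ c d, IsJump (D.chain i) c d → α.sep ≤ c → d ≤ β.sep →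
        ∃ κ μ, IsJump (D.cuts i) κ μ ∧ α ≤ κ ∧ μ ≤ β := by
      intro c d hcd hc hd
      obtain ⟨κ, μ, hj, rfl, rfl, hb, hmax⟩ := exists_isJump_cuts hcd
      refine ⟨κ, μ, hj, ?_, ?_⟩
      · rcases hc.lt_or_eq with h | h
        · exact Cut.le_iff.2 (Or.inl h)
        · exact hmax α hα h
      · rcases hd.lt_or_eq with h | h
        · exact Cut.le_iff.2 (Or.inl h)
        · exact Cut.le_iff.2 (Or.inr ⟨h, by simp [hb]⟩)
    by_contra hno
    have hno' : ∀ c d, IsJump (D.chain i) c d → α.sep ≤ c → d ≤ β.sep → False :=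
      fun c d h1 h2 h3 => hno (case1 c d h1 h2 h3)
    obtain ⟨z, hz, hz1, hz2⟩ : ∃ z ∈ D.chain i, α.sep < z ∧ z < β.sep := by
      by_contra! hc
      refine hno' α.sep β.sep ⟨hα.1, hβ.1, h, fun y hy => ?_⟩ le_rfl le_rfl
      rcases chain_total hy hα.1 with h | h
      · exact Or.inl h
      rcases chain_total hβ.1 hy with h' | h'
      · exact Or.inr h'
      rcases h.lt_or_eq with h | h
      · rcases h'.lt_or_eq with h' | h'
        · exact absurd h' (hc y hy h)
        · exact Or.inr h'.ge
      · exact Or.inl h.ge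
    have lo : ∀ y ∈ D.chain i, α.sep ≤ y → y < z →
        (∀ x ∈ D.chain i, y ≤ x → x ≤ z → Φ.cutset i x = Φ.cutset i z) → False := by
      intro y hy hαy hyz hc
      obtain ⟨c, d, hcd, h1, h2⟩ := hm.exists_isJump_of_cutset_eq ho hU hy hz hyz
        fun x hx hyx hxz => (hc x hx hyx hxz).trans (hc y hy le_rfl hyz.le).symm
      exact hno' c d hcd (hαy.trans h1) (h2.trans hz2.le)
    have hi' : ∀ y ∈ D.chain i, y ≤ β.sep → z < y →
        (∀ x ∈ D.chain i, z ≤ x → x ≤ y → Φ.cutset i x = Φ.cutset i z) → False := by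
      intro y hy hyβ hzy hc
      obtain ⟨c, d, hcd, h1, h2⟩ := hm.exists_isJump_of_cutset_eq ho hU hz hy hzy hc
      exact hno' c d hcd (hz1.le.trans h1) (h2.trans hyβ)
    -- If z is the split selected for its cutset, its doubling is the jump. If another split of this
    -- petal was selected, convexity makes the cutset constant from z towards it, which forces a
    -- jump.
    obtain ⟨q1, q2, q3⟩ := D.pick_mem i hi z hz
    generalize hq : D.pick (Φ.cutset i z) = q at q1 q2 q3
    obtain ⟨j, y⟩ := q
    simp only at q1 q2 q3
    by_cases hji : j = i
    · subst hji
      by_cases hyz : y = z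
      · subst hyz
        refine hno ⟨_, _, isJump_doubled hi hz hq, ?_, ?_⟩
        · exact Cut.le_iff.2 (Or.inl hz1)
        · exact Cut.le_iff.2 (Or.inl hz2)
      · rcases chain_total q2 hz with h | h
        · have hyz' := lt_of_le_of_ne h hyz
          rcases chain_total q2 hα.1 with h' | h'
          · exact lo _ hα.1 le_rfl hz1 fun x hx h1 h2 =>
              (hm.cutset_eq_of_between ho q2 hx q3 (h'.trans h1) h2).trans q3
          · exact lo _ q2 h' hyz' fun x hx h1 h2 =>
              (hm.cutset_eq_of_between ho q2 hx q3 h1 h2).trans q3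
        · have hyz' := lt_of_le_of_ne h (Ne.symm hyz)
          rcases chain_total q2 hβ.1 with h' | h'
          · exact hi' _ q2 h' hyz' fun x hx h1 h2 =>
              hm.cutset_eq_of_between ho hz hx q3.symm h1 h2
          · exact hi' _ hβ.1 le_rfl hz2 fun x hx h1 h2 =>
              hm.cutset_eq_of_between ho hz hx q3.symm h1 (h2.trans h')
    -- A split selected in another petal j puts the cutset of z inside P_j, so cutsets are constant
    -- on one whole side of z.
    · rcases hm.cutset_eq_of_subset ho hz q1 hji (by
        rw [← q3]; exact Set.inter_subset_left.trans Set.inter_subset_left) with h | h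
      · exact lo _ hα.1 le_rfl hz1 fun x hx _ h2 => h x hx h2
      · exact hi' _ hβ.1 le_rfl hz2 fun x hx h1 _ => h x hx h1
  · refine ⟨α, β, ⟨hα, hβ, hlt, fun y hy => ?_⟩, le_rfl, le_rfl⟩
    rw [Cut.le_iff, Cut.le_iff]
    rcases chain_total hy.1 hα.1 with h | h <;> rcases h.lt_or_eq with h | h <;> grind

end Subdivision
end Pseudoflower
end Cuts

/-! ### The cyclic order of the subdivision -/

section Nodes

variable {V : Type u} {U : VertexUniverse V} {k : ℕ}

namespace Pseudoflower.Subdivision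

variable {Φ : Pseudoflower U k}

/-- The elements of the cycle completion of the subdivided pseudoflower: for every petal of `Φ` its
cuts other than the first and the last one, its jumps, and the cutpoints of `Φ`. -/
@[ext]
structure Node (D : Φ.Subdivision) where
  base : Φ.C
  cut : Cut V
  gap : Bool
  mem : cut ∈ D.cuts base
  jump : gap = true → ∃ μ, IsJump (D.cuts base) cut μ
  inner : gap = false → base ∈ Φ.I → (∃ α ∈ D.cuts base, α < cut) ∧ ∃ β ∈ D.cuts base, cut < β

variable {D : Φ.Subdivision}

/-- The position of a node among the nodes with the same base. -/
def Node.key (n : D.Node) : Cut V ×ₗ Bool := toLex (n.cut, n.gap)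

theorem Node.key_lt_iff {m n : D.Node} :
    m.key < n.key ↔ m.cut < n.cut ∨ (m.cut = n.cut ∧ m.gap = false ∧ n.gap = true) := by
  rw [Prod.Lex.lt_iff, Bool.lt_iff]
  rfl

theorem Node.key_trichotomy {m n : D.Node} (h : m.base = n.base) :
    m.key < n.key ∨ m = n ∨ n.key < m.key := by
  have hn := n.mem
  rw [← h] at hn
  rw [Node.key_lt_iff, Node.key_lt_iff]
  have hext : m.cut = n.cut → m.gap = n.gap → m = n := fun h1 h2 => Node.ext h h1 h2
  rcases cuts_total m.mem hn with e | e <;> rcases e.lt_or_eq with e | e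
  · exact Or.inl (Or.inl e)
  · grind
  · exact Or.inr (Or.inr (Or.inl e))
  · grind

variable (D)

/-- A linear order on `Φ.C` with least element `D.a` inducing its circular order. -/
noncomputable def baseOrder : LinearOrder Φ.C := (exists_isLinearization D.a).choose

theorem baseOrder_bot (x : Φ.C) : D.baseOrder.le D.a x :=
  (exists_isLinearization D.a).choose_spec.1 x

theorem baseOrder_isLinearization : IsLinearization D.baseOrder :=
  (exists_isLinearization D.a).choose_spec.2

/-- The lexicographic order of the nodes. -/
def NodeLT (m n : D.Node) : Prop := D.baseOrder.lt m.base n.base ∨ (m.base = n.base ∧ m.key < n.key)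

instance : IsStrictTotalOrder D.Node D.NodeLT :=
  letI := D.baseOrder
  { trichotomous := fun m n h1 h2 => by
      by_contra hne
      rcases lt_trichotomy m.base n.base with h | h | h
      · exact h1 (Or.inl h)
      · rcases Node.key_trichotomy h with h' | h' | h'
        · exact h1 (Or.inr ⟨h, h'⟩)
        · exact hne h'
        · exact h2 (Or.inr ⟨h.symm, h'⟩)
      · exact h2 (Or.inl h)
    irrefl := by
      rintro m (h | ⟨-, h⟩)
      · exact lt_irrefl _ h
      · exact lt_irrefl _ h
    trans := by
      rintro m n l (h | ⟨e, h⟩) (h' | ⟨e', h'⟩)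
      · exact Or.inl (h.trans h')
      · exact Or.inl (e' ▸ h)
      · exact Or.inl (e ▸ h')
      · exact Or.inr ⟨e.trans e', h.trans h'⟩ }

open Classical in
/-- The linear order of the nodes. -/
noncomputable def nodeOrder : LinearOrder D.Node := linearOrderOfSTO D.NodeLT

noncomputable instance : CircularOrder D.Node := @LinearOrder.toCircularOrder _ D.nodeOrder

theorem nodeOrder_isLinearization : IsLinearization D.nodeOrder := fun _ _ _ => Iff.rfl

theorem nodeOrder_lt_iff {m n : D.Node} : D.nodeOrder.lt m n ↔
    D.baseOrder.lt m.base n.base ∨ (m.base = n.base ∧ m.key < n.key) := Iff.rfl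

variable {D}

theorem Node.sbtw_of_base {x y z : D.Node} (h : sbtw x.base y.base z.base) : sbtw x y z := by
  rw [D.nodeOrder_isLinearization, nodeOrder_lt_iff, nodeOrder_lt_iff, nodeOrder_lt_iff]
  rw [D.baseOrder_isLinearization] at h
  tauto

theorem Node.sbtw_of_key {x y z : D.Node} (h : x.base = y.base) (hz : x.base ≠ z.base)
    (hxy : x.key < y.key) : sbtw z x y := by
  rw [D.nodeOrder_isLinearization, nodeOrder_lt_iff, nodeOrder_lt_iff, nodeOrder_lt_iff]
  let _ := D.baseOrder
  rcases lt_or_gt_of_ne hz with e | e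
  · exact Or.inr (Or.inl ⟨Or.inr ⟨h, hxy⟩, Or.inl (h ▸ e)⟩)
  · exact Or.inl ⟨Or.inl e, Or.inr ⟨h, hxy⟩⟩

theorem Node.sbtw_of_key_key {x y z : D.Node} (h : x.base = y.base) (h' : y.base = z.base)
    (hxy : x.key < y.key) (hyz : y.key < z.key) : sbtw x y z := by
  rw [D.nodeOrder_isLinearization, nodeOrder_lt_iff, nodeOrder_lt_iff, nodeOrder_lt_iff]
  exact Or.inl ⟨Or.inr ⟨h, hxy⟩, Or.inr ⟨h', hyz⟩⟩

/-- The petals of the subdivided pseudoflower. -/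
def petals (D : Φ.Subdivision) : Set D.Node := {n | n.gap = true}

theorem notMem_petals {n : D.Node} : n ∉ D.petals ↔ n.gap = false := by
  simp [petals]

theorem base_mem_of_mem_petals {n : D.Node} (hn : n ∈ D.petals) : n.base ∈ Φ.I := by
  by_contra hb
  obtain ⟨μ, h1, h2, h3, -⟩ := n.jump hn
  rw [eq_of_mem_cuts hb h1, eq_of_mem_cuts hb h2] at h3
  exact lt_irrefl _ h3

/-- The node of a cutpoint of `Φ`. -/
def vnode (D : Φ.Subdivision) (v : Φ.C) (hv : v ∉ Φ.I) : D.Node where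
  base := v
  cut := Cut.mk ⟨Set.univ, Set.univ⟩ false
  gap := false
  mem := mk_false_mem_cuts (by rw [D.chain_cutpoint v hv]; rfl)
  jump := by simp
  inner := fun _ h => absurd h hv

theorem vnode_notMem (v : Φ.C) (hv : v ∉ Φ.I) : D.vnode v hv ∉ D.petals := by
  simp [petals, vnode]

@[simp] theorem vnode_base (v : Φ.C) (hv : v ∉ Φ.I) : (D.vnode v hv).base = v := rfl

theorem eq_vnode {n : D.Node} (hn : n.base ∉ Φ.I) : n = D.vnode n.base hn := by
  refine Node.ext rfl (eq_of_mem_cuts hn n.mem) ?_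
  have : n ∉ D.petals := fun h => hn (base_mem_of_mem_petals h)
  exact notMem_petals.1 this

/-- The node of a jump. -/
def jumpNode (D : Φ.Subdivision) {i : Φ.C} {κ μ : Cut V} (h : IsJump (D.cuts i) κ μ) : D.Node where
  base := i
  cut := κ
  gap := true
  mem := h.1
  jump := fun _ => ⟨μ, h⟩
  inner := by simp

theorem jumpNode_mem {i : Φ.C} {κ μ : Cut V} (h : IsJump (D.cuts i) κ μ) :
    D.jumpNode h ∈ D.petals := rfl

variable (hU : U.IsLimitClosed)

include hU

theorem exists_petal_above {n : D.Node} (hn : n ∉ D.petals) (hb : n.base ∈ Φ.I) :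
    ∃ m ∈ D.petals, m.base = n.base ∧ n.key < m.key := by
  obtain ⟨-, β, hβ, hlt⟩ := n.inner (notMem_petals.1 hn) hb
  obtain ⟨κ, μ, hj, h1, h2⟩ := exists_isJump_between hU hb n.mem hβ hlt
  refine ⟨D.jumpNode hj, rfl, rfl, ?_⟩
  rw [Node.key_lt_iff]
  rcases h1.lt_or_eq with h | h
  · exact Or.inl h
  · exact Or.inr ⟨h, notMem_petals.1 hn, rfl⟩

theorem exists_petal_below {n : D.Node} (hn : n ∉ D.petals) (hb : n.base ∈ Φ.I) :
    ∃ m ∈ D.petals, m.base = n.base ∧ m.key < n.key := by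
  obtain ⟨⟨α, hα, hlt⟩, -⟩ := n.inner (notMem_petals.1 hn) hb
  obtain ⟨κ, μ, hj, h1, h2⟩ := exists_isJump_between hU hb hα n.mem hlt
  refine ⟨D.jumpNode hj, rfl, rfl, ?_⟩
  rw [Node.key_lt_iff]
  exact Or.inl (hj.2.2.1.trans_le h2)

theorem exists_petal_base {i : Φ.C} (hi : i ∈ Φ.I) : ∃ m ∈ D.petals, m.base = i := by
  obtain ⟨μ, hμ, hlt⟩ := exists_bot_lt (D := D) hi
  obtain ⟨κ, μ, hj, -, -⟩ := exists_isJump_between hU hi (bot_mem hi) hμ hlt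
  exact ⟨D.jumpNode hj, rfl, rfl⟩

theorem exists_petal_between {v w : D.Node} (hv : v ∉ D.petals) (hw : w ∉ D.petals) (hvw : v ≠ w) :
    ∃ m ∈ D.petals, sbtw v m w := by
  by_cases hb : v.base = w.base
  · have hI : v.base ∈ Φ.I := by
      by_contra hI
      apply hvw
      rw [eq_vnode hI, eq_vnode (n := w) (hb ▸ hI)]
      exact Node.ext hb rfl rfl
    rcases Node.key_trichotomy hb with h | h | h
    · rw [Node.key_lt_iff, notMem_petals.1 hw] at h
      have hlt : v.cut < w.cut := by simpa using h
      have hw' := w.mem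
      rw [← hb] at hw'
      obtain ⟨κ, μ, hj, h1, h2⟩ := exists_isJump_between hU hI v.mem hw' hlt
      refine ⟨D.jumpNode hj, rfl, Node.sbtw_of_key_key rfl hb ?_ ?_⟩
      · rw [Node.key_lt_iff]
        rcases h1.lt_or_eq with h | h
        · exact Or.inl h
        · exact Or.inr ⟨h, notMem_petals.1 hv, rfl⟩
      · rw [Node.key_lt_iff]
        exact Or.inl (hj.2.2.1.trans_le h2)
    · exact absurd h hvw
    · obtain ⟨m, hm, hmb, hlt⟩ := exists_petal_above hU hv hI
      exact ⟨m, hm, (Node.sbtw_of_key_key hb.symm hmb.symm h hlt).cyclic_left⟩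
  · by_cases hI : v.base ∈ Φ.I
    · obtain ⟨m, hm, hmb, hlt⟩ := exists_petal_above hU hv hI
      exact ⟨m, hm, (Node.sbtw_of_key hmb.symm hb hlt).cyclic_left⟩
    · by_cases hI' : w.base ∈ Φ.I
      · obtain ⟨m, hm, hmb, hlt⟩ := exists_petal_below hU hw hI'
        exact ⟨m, hm, Node.sbtw_of_key hmb (by rw [hmb]; exact Ne.symm hb) hlt⟩
      · obtain ⟨i, hi, hi'⟩ := Φ.isCycleCompletion.exists_between hI hI' hb
        obtain ⟨m, hm, rfl⟩ := exists_petal_base (D := D) hU hi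
        exact ⟨m, hm, Node.sbtw_of_base hi'⟩

theorem exists_node_cut {L : Set D.Node} (hL : L ⊆ D.petals)
    (hlow : ∀ n ∈ L, ∀ m ∈ D.petals, D.nodeOrder.le m n → m ∈ L) (hne : L ≠ ∅)
    (hneI : L ≠ D.petals) : ∃ w, w ∉ D.petals ∧ ∀ n ∈ D.petals, n ∈ L ↔ D.nodeOrder.lt n w := by
  let _ := D.baseOrder
  have hlow' : ∀ n ∈ L, ∀ m ∈ D.petals, D.nodeOrder.lt m n → m ∈ L :=
    fun n hn m hm h => hlow n hn m hm (@le_of_lt _ D.nodeOrder.toPreorder _ _ h)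
  by_cases hsplit : ∃ i ∈ Φ.I, (∃ n ∈ L, n.base = i) ∧ ∃ n ∈ D.petals, n ∉ L ∧ n.base = i
  · obtain ⟨i, hi, ⟨n₀, hn₀, hb₀⟩, n₁, hn₁, hn₁L, hb₁⟩ := hsplit
    -- When L divides a petal of Φ, the required cutpoint is the supremum of the upper ends of the
    -- jumps in L. It lies strictly between the first and the last cut, as there are jumps on both
    -- sides of it.
    let A : Set (Cut V) := {μ | ∃ κ, ∃ h : IsJump (D.cuts i) κ μ, D.jumpNode h ∈ L}
    have hmk : ∀ n ∈ D.petals, n.base = i → ∃ κ μ, ∃ h : IsJump (D.cuts i) κ μ, n = D.jumpNode h := by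
      rintro n hn rfl
      obtain ⟨μ, hμ⟩ := n.jump hn
      exact ⟨n.cut, μ, hμ, Node.ext rfl rfl hn⟩
    obtain ⟨κ₀, μ₀, j₀, rfl⟩ := hmk n₀ (hL hn₀) hb₀
    obtain ⟨κ₁, μ₁, j₁, rfl⟩ := hmk n₁ hn₁ hb₁
    have key : ∀ κ μ κ' μ', ∀ h : IsJump (D.cuts i) κ μ, ∀ h' : IsJump (D.cuts i) κ' μ',
        D.jumpNode h ∈ L → D.jumpNode h' ∉ L → μ ≤ κ' := by
      intro κ μ κ' μ' h h' hm hm'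
      refine (h.2.2.2 κ' h'.1).resolve_left fun hle => hm' ?_
      rcases hle.lt_or_eq with e | e
      · exact hlow' _ hm _ rfl (Or.inr ⟨rfl, Node.key_lt_iff.2 (Or.inl e)⟩)
      · have : D.jumpNode h' = D.jumpNode h := Node.ext rfl e rfl
        rwa [this]
    obtain ⟨m, hm, hm1, hm2⟩ := exists_sup_cuts (D := D) hU hi (A := A)
      (fun μ ⟨κ, h, _⟩ => h.2.1) ⟨μ₀, κ₀, j₀, hn₀⟩
    have hmκ₁ : m ≤ κ₁ := hm2 κ₁ j₁.1 fun μ ⟨κ, h, hmem⟩ => key _ _ _ _ h j₁ hmem hn₁L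
    have hκ₀m : κ₀ < m := j₀.2.2.1.trans_le (hm1 μ₀ ⟨κ₀, j₀, hn₀⟩)
    refine ⟨⟨i, m, false, hm, by simp, fun _ _ => ⟨⟨κ₀, j₀.1, hκ₀m⟩, μ₁, j₁.2.1,
      hmκ₁.trans_lt j₁.2.2.1⟩⟩, by simp [petals], fun n hn => ?_⟩
    rw [nodeOrder_lt_iff]
    simp only
    rcases lt_trichotomy n.base i with h | h | h
    · exact iff_of_true (hlow' _ hn₀ n hn (Or.inl h)) (Or.inl h)
    · obtain ⟨κ, μ, j, rfl⟩ := hmk n hn h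
      rw [Node.key_lt_iff]
      constructor
      · intro hnL
        exact Or.inr ⟨rfl, Or.inl (j.2.2.1.trans_le (hm1 μ ⟨κ, j, hnL⟩))⟩
      · intro hlt
        by_contra hnL
        have hle : m ≤ κ := hm2 κ j.1 fun μ' ⟨κ', h', hmem⟩ => key _ _ _ _ h' j hmem hnL
        rcases hlt with h' | ⟨-, h' | ⟨-, h', -⟩⟩
        · exact lt_irrefl _ h'
        · exact absurd hle (not_le_of_gt h')
        · simp [jumpNode] at h'
    · refine iff_of_false (fun hnL => hn₁L (hlow' n hnL _ rfl (Or.inl h))) ?_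
      rintro (h' | ⟨h', -⟩)
      · exact lt_asymm h h'
      · exact h.ne h'.symm
  · push Not at hsplit
    have hiff : ∀ n ∈ D.petals, ∀ m ∈ D.petals, m.base = n.base → n ∈ L → m ∈ L := by
      intro n hn m hm hb hnL
      by_contra hmL
      exact hsplit n.base (base_mem_of_mem_petals hn) ⟨n, hnL, rfl⟩ m hm hmL hb
    obtain ⟨n₀, hn₀⟩ := Set.nonempty_iff_ne_empty.2 hne
    -- Now L is a union of whole petals of Φ, and a cutpoint of Φ itself does the cutting.
    obtain ⟨v, hv, hvL⟩ := Φ.isCycleCompletion.exists_cut D.baseOrder_isLinearization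
      (L := {i | i ∈ Φ.I ∧ ∀ n ∈ D.petals, n.base = i → n ∈ L}) (fun i hi => hi.1)
      (fun i hi m hm hmi => ⟨hm, fun n hn hnb => by
        rcases hmi.lt_or_eq with e | e
        · obtain ⟨l, hl, hlb⟩ := exists_petal_base (D := D) hU hi.1
          exact hlow' l (hi.2 l hl hlb) n hn (Or.inl (by rw [hnb, hlb]; exact e))
        · exact hi.2 n hn (hnb.trans e)⟩)
      (Set.nonempty_iff_ne_empty.1 ⟨n₀.base, base_mem_of_mem_petals (hL hn₀), fun n hn hnb =>
        hiff n₀ (hL hn₀) n hn hnb hn₀⟩)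
      (fun e => hneI (Set.Subset.antisymm hL fun n hn => by
        have h : n.base ∈ {i | i ∈ Φ.I ∧ ∀ n ∈ D.petals, n.base = i → n ∈ L} := by
          rw [e]; exact base_mem_of_mem_petals hn
        exact h.2 n hn rfl))
    refine ⟨D.vnode v hv, vnode_notMem v hv, fun n hn => ?_⟩
    have hnI := base_mem_of_mem_petals hn
    have h1 := hvL n.base hnI
    have h2 : n ∈ L ↔ n.base < v := by
      rw [← h1]
      exact ⟨fun h => ⟨hnI, fun m hm hmb => hiff n hn m hm hmb h⟩, fun h => h.2 n hn rfl⟩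
    rw [h2, nodeOrder_lt_iff]
    constructor
    · exact fun h => Or.inl h
    · rintro (h | ⟨h, -⟩)
      · exact h
      · exact absurd hnI (by rw [h]; exact hv)

theorem isCycleCompletion_petals : IsCycleCompletion D.petals := by
  obtain ⟨i, hi, j, hj, hij⟩ := Φ.isCycleCompletion.nontrivial
  obtain ⟨m, hm, rfl⟩ := exists_petal_base (D := D) hU hi
  obtain ⟨n, hn, rfl⟩ := exists_petal_base (D := D) hU hj
  refine isCycleCompletion_of_cuts ⟨m, hm, n, hn, fun e => hij (e ▸ rfl)⟩
    D.nodeOrder_isLinearization (u := D.vnode D.a D.isTripod.mem₁) (vnode_notMem _ _) (fun x => ?_)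
    (fun L h1 h2 h3 h4 => exists_node_cut hU h1 h2 h3 h4)
    (fun v w hv hw hvw => exists_petal_between hU hv hw hvw)
  let _ := D.baseOrder
  by_cases hx : x.base = D.a
  · have : x.base ∉ Φ.I := by rw [hx]; exact D.isTripod.mem₁
    have e : x = D.vnode D.a D.isTripod.mem₁ := by
      rw [eq_vnode this]; exact Node.ext hx rfl rfl
    rw [e]
    exact @le_refl _ D.nodeOrder.toPreorder _
  · exact @le_of_lt _ D.nodeOrder.toPreorder _ _
      (Or.inl (lt_of_le_of_ne (D.baseOrder_bot x.base) (Ne.symm hx)))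

end Pseudoflower.Subdivision
end Nodes

/-! ### Vertex sets of the subdivision -/

section Vertices

variable {V : Type u} {U : VertexUniverse V} {k : ℕ}

namespace Pseudoflower.Subdivision

variable {Φ : Pseudoflower U k} {D : Φ.Subdivision} {i : Φ.C}

/-- The vertex sets of the subdivided pseudoflower. -/
def P (D : Φ.Subdivision) (n : D.Node) : Set V :=
  {x | x ∈ Φ.P n.base ∧ x ∈ n.cut.sep.right ∧ ((n.gap = false ∧ x ∈ n.cut.sep.left) ∨
    (n.gap = true ∧ ∃ μ, IsJump (D.cuts n.base) n.cut μ ∧ x ∈ μ.sep.left))}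

theorem P_subset (n : D.Node) : D.P n ⊆ Φ.P n.base := fun _ hx => hx.1

@[simp] theorem P_vnode (v : Φ.C) (hv : v ∉ Φ.I) : D.P (D.vnode v hv) = Φ.P v := by
  ext x
  simp [P, vnode]

theorem P_of_notMem {n : D.Node} (hn : n ∉ D.petals) : D.P n = Φ.cutset n.base n.cut.sep := by
  ext x
  simp only [P, cutset, notMem_petals.1 hn, Set.mem_ofPred_eq, Set.mem_inter_iff]
  grind

theorem isJump_unique {κ μ μ' : Cut V} (h : IsJump (D.cuts i) κ μ) (h' : IsJump (D.cuts i) κ μ') :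
    μ = μ' := by
  refine le_antisymm ?_ ?_
  · exact (h.2.2.2 _ h'.2.1).resolve_left (not_le_of_gt h'.2.2.1)
  · exact (h'.2.2.2 _ h.2.1).resolve_left (not_le_of_gt h.2.2.1)

theorem mem_P_jumpNode {κ μ : Cut V} (h : IsJump (D.cuts i) κ μ) {x : V} :
    x ∈ D.P (D.jumpNode h) ↔ x ∈ Φ.P i ∧ x ∈ κ.sep.right ∧ x ∈ μ.sep.left := by
  simp only [P, jumpNode]
  constructor
  · rintro ⟨h1, h2, ⟨h3, -⟩ | ⟨-, μ', h3, h4⟩⟩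
    · simp at h3
    · rw [isJump_unique h h3]
      exact ⟨h1, h2, h4⟩
  · rintro ⟨h1, h2, h3⟩
    exact ⟨h1, h2, Or.inr ⟨trivial, μ, h, h3⟩⟩

theorem exists_eq_jumpNode {n : D.Node} (hn : n ∈ D.petals) :
    ∃ κ μ, ∃ h : IsJump (D.cuts n.base) κ μ, n = D.jumpNode h := by
  obtain ⟨μ, hμ⟩ := n.jump hn
  exact ⟨n.cut, μ, hμ, Node.ext rfl rfl hn⟩

/-- Every vertex between two cuts lies in a cut or a jump between them. -/
theorem exists_cell (hU : U.IsLimitClosed) (hi : i ∈ Φ.I) {α β : Cut V} (hα : α ∈ D.cuts i)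
    (hβ : β ∈ D.cuts i) (hle : α ≤ β) {x : V} (hx : x ∈ Φ.P i) (hxα : x ∈ α.sep.right)
    (hxβ : x ∈ β.sep.left) :
    (∃ κ ∈ D.cuts i, α ≤ κ ∧ κ ≤ β ∧ x ∈ Φ.cutset i κ.sep) ∨
      ∃ κ μ, ∃ h : IsJump (D.cuts i) κ μ, α ≤ κ ∧ μ ≤ β ∧ x ∈ D.P (D.jumpNode h) := by
  have ho := D.isOpposite i hi
  have hm := D.isMax i hi
  by_cases h1 : x ∈ α.sep.left
  · exact Or.inl ⟨α, hα, le_rfl, hle, ⟨hx, h1⟩, hxα⟩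
  by_cases h2 : x ∈ β.sep.right
  · exact Or.inl ⟨β, hβ, hle, le_rfl, ⟨hx, hxβ⟩, h2⟩
  by_cases hn : ∀ S ∈ D.chain i, x ∉ Φ.cutset i S
  · right
    obtain ⟨c, d, hcd, h3, h4, h5, h6⟩ := hm.exists_isJump ho hU hx hn
    obtain ⟨κ, μ, hj, rfl, rfl, hb, hmax⟩ := exists_isJump_cuts hcd
    refine ⟨κ, μ, hj, ?_, ?_, (mem_P_jumpNode hj).2 ⟨hx, h4, h5⟩⟩
    · have := (hcd.2.2.2 _ hα.1).resolve_right fun h => h1 (h.1 h5)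
      rcases this.lt_or_eq with h | h
      · exact Cut.le_iff.2 (Or.inl h)
      · exact hmax α hα h
    · have := (hcd.2.2.2 _ hβ.1).resolve_left fun h => h2 (h.2 h4)
      rcases this.lt_or_eq with h | h
      · exact Cut.le_iff.2 (Or.inl h)
      · exact Cut.le_iff.2 (Or.inr ⟨h, by simp [hb]⟩)
  · push Not at hn
    obtain ⟨S, hS, hxS⟩ := hn
    have h3 : α.sep < S := lt_of_le_not_ge
      ((chain_total hα.1 hS).resolve_right fun h => h1 (h.1 hxS.1.2)) fun h => h1 (h.1 hxS.1.2)
    have h4 : S < β.sep := lt_of_le_not_ge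
      ((chain_total hβ.1 hS).resolve_left fun h => h2 (h.2 hxS.2)) fun h => h2 (h.2 hxS.2)
    exact Or.inl ⟨Cut.mk S false, mk_false_mem_cuts hS, Cut.le_iff.2 (Or.inl h3),
      Cut.le_iff.2 (Or.inl h4), hxS⟩

/-- The cuts of a petal are its first cut, its last cut, and the cuts that are nodes. -/
theorem cut_cases (hi : i ∈ Φ.I) {κ : Cut V} (hκ : κ ∈ D.cuts i) :
    κ = D.bot i ∨ (κ.sep = intervalSep Φ.P (D.opp i) (D.succ i) ∧ ∀ κ' ∈ D.cuts i, κ' ≤ κ) ∨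
      ∃ n : D.Node, n ∉ D.petals ∧ n.base = i ∧ n.cut = κ := by
  obtain ⟨τ, hτ, hτs, hmax⟩ := exists_top (D := D) hi
  rcases (bot_le hi hκ).lt_or_eq with h | h
  · rcases (hmax κ hκ).lt_or_eq with h' | h'
    · exact Or.inr (Or.inr ⟨⟨i, κ, false, hκ, by simp, fun _ _ =>
        ⟨⟨_, bot_mem hi, h⟩, τ, hτ, h'⟩⟩, by simp [petals], rfl, rfl⟩)
    · exact Or.inr (Or.inl (h' ▸ ⟨hτs, hmax⟩))
  · exact Or.inl h.symm

theorem bot_lt {n : D.Node} (hb : n.base ∈ Φ.I) (hn : n ∉ D.petals) : D.bot n.base < n.cut := by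
  obtain ⟨⟨α, hα, hlt⟩, -⟩ := n.inner (notMem_petals.1 hn) hb
  exact (bot_le hb hα).trans_lt hlt

/-- The first and last cut of a petal are not nodes over it; the neighbouring cutpoints of Φ take
their places, which accounts for the first two alternatives. -/
theorem exists_node (hU : U.IsLimitClosed) (hi : i ∈ Φ.I) {α β : Cut V} (hα : α ∈ D.cuts i)
    (hβ : β ∈ D.cuts i) (hle : α ≤ β) {x : V} (hx : x ∈ Φ.P i) (hxα : x ∈ α.sep.right)
    (hxβ : x ∈ β.sep.left) :
    (α = D.bot i ∧ x ∈ Φ.P (D.pred i)) ∨ ((∀ κ ∈ D.cuts i, κ ≤ β) ∧ x ∈ Φ.P (D.succ i)) ∨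
      ∃ n : D.Node, n.base = i ∧ x ∈ D.P n ∧ α ≤ n.cut ∧
        (n.cut < β ∨ (n.cut = β ∧ n.gap = false)) := by
  have ho := D.isOpposite i hi
  rcases exists_cell hU hi hα hβ hle hx hxα hxβ with ⟨κ, hκ, h1, h2, h3⟩ | ⟨κ, μ, h, h1, h2, h3⟩
  · rcases cut_cases hi hκ with rfl | ⟨h4, h5⟩ | ⟨n, hn, rfl, rfl⟩
    · refine Or.inl ⟨h1.antisymm (bot_le hi hα), ?_⟩
      rw [← ho.cutset_bot]
      exact h3
    · refine Or.inr (Or.inl ⟨fun κ' hκ' => (h5 κ' hκ').trans h2, ?_⟩)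
      rw [← ho.cutset_top, ← h4]
      exact h3
    · refine Or.inr (Or.inr ⟨n, rfl, ?_, h1, ?_⟩)
      · rwa [P_of_notMem hn]
      · rcases h2.lt_or_eq with h | h
        · exact Or.inl h
        · exact Or.inr ⟨h, notMem_petals.1 hn⟩
  · exact Or.inr (Or.inr ⟨_, rfl, h3, h1, Or.inl (h.2.2.1.trans_le h2)⟩)

theorem exists_node_of_mem (hU : U.IsLimitClosed) {z : Φ.C} {x : V} (hx : x ∈ Φ.P z) :
    ∃ n : D.Node, x ∈ D.P n ∧ (n.base = z ∨ (z ∈ Φ.I ∧ (n.base = D.pred z ∨ n.base = D.succ z))) := by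
  by_cases hz : z ∈ Φ.I
  · have ho := D.isOpposite z hz
    obtain ⟨τ, hτ, hτs, hmax⟩ := exists_top (D := D) hz
    rcases exists_node hU hz (bot_mem hz) hτ (hmax _ (bot_mem hz)) hx (by
        change x ∈ intervalSet Φ.P _ _
        rw [ho.intervalSet_pred_opp]
        exact Or.inl (Or.inl hx)) (by
        rw [hτs, intervalSep, ho.intervalSet_opp_succ]
        exact Or.inl (Or.inr hx)) with h | h | ⟨n, h1, h2, -⟩
    · exact ⟨D.vnode _ ho.pred_mem, by simpa using h.2, Or.inr ⟨hz, Or.inl rfl⟩⟩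
    · exact ⟨D.vnode _ ho.succ_mem, by simpa using h.2, Or.inr ⟨hz, Or.inr rfl⟩⟩
    · exact ⟨n, h2, Or.inl h1⟩
  · exact ⟨D.vnode z hz, by simpa using hx, Or.inl rfl⟩

theorem centre_P (hU : U.IsLimitClosed) : centre D.P = centre Φ.P := by
  ext x
  constructor
  · intro hx
    by_contra hx'
    obtain ⟨z, hz⟩ := exists_mem_of_notMem_centre hx'
    obtain ⟨n, hn, -⟩ := exists_node_of_mem (D := D) hU hz
    exact notMem_centre hn hx
  · intro hx
    by_contra hx'
    obtain ⟨n, hn⟩ := exists_mem_of_notMem_centre hx'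
    exact notMem_centre (P_subset n hn) hx

theorem pred_mem_closedArc {z v w : Φ.C} (hz : z ∈ Φ.I) (hv : v ∉ Φ.I) (hw : w ∉ Φ.I)
    (h : z ∈ closedArc v w) : D.pred z ∈ closedArc v w ∧ D.succ z ∈ closedArc v w := by
  have ho := D.isOpposite z hz
  have h1 := ho.eq_or v
  have h2 := ho.eq_or w
  have h3 := ho.between
  have h4 : z ≠ v := fun e => hv (e ▸ hz)
  have h5 : z ≠ w := fun e => hw (e ▸ hz)
  rw [mem_closedArc] at *
  rw [mem_closedArc]
  obtain ⟨lo, -, hlo⟩ := exists_isLinearization z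
  rw [hlo.grindable] at *
  grind [hlo.grindable]

theorem intervalSet_base (hU : U.IsLimitClosed) {v w : Φ.C} (hv : v ∉ Φ.I) (hw : w ∉ Φ.I) :
    intervalSet Φ.P v w = centre Φ.P ∪ ⋃ z ∈ (Node.base : D.Node → Φ.C) ⁻¹' closedArc v w, D.P z := by
  ext x
  rw [mem_intervalSet]
  simp only [Set.mem_union, Set.mem_iUnion, exists_prop, Set.mem_preimage]
  constructor
  · rintro (⟨z, hz, hx⟩ | hx)
    · obtain ⟨n, hn, h | ⟨hzI, h⟩⟩ := exists_node_of_mem (D := D) hU hx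
      · exact Or.inr ⟨n, h ▸ hz, hn⟩
      · have := pred_mem_closedArc (D := D) hzI hv hw hz
        exact Or.inr ⟨n, by rcases h with h | h <;> rw [h]; exacts [this.1, this.2], hn⟩
    · exact Or.inl hx
  · rintro (hx | ⟨n, hn, hx⟩)
    · exact Or.inr hx
    · exact Or.inl ⟨_, hn, P_subset n hx⟩

theorem mem_closedArc_vnode_left {w : Φ.C} (hw : w ∉ Φ.I) {m n : D.Node} (hn : n.base ≠ w) :
    m ∈ closedArc (D.vnode w hw) n ↔
      m.base = w ∨ sbtw w m.base n.base ∨ (m.base = n.base ∧ ¬ n.key < m.key) := by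
  have hW : m = D.vnode w hw ↔ m.base = w := ⟨fun e => e ▸ rfl, fun e => by subst e; exact eq_vnode hw⟩
  rw [mem_closedArc, hW]
  have e1 : m.base = n.base → (m = n ∨ m.key < n.key ↔ ¬ n.key < m.key) := fun e => by
    constructor
    · rintro (rfl | h)
      · exact lt_irrefl _
      · exact h.asymm
    · intro h
      rcases Node.key_trichotomy e with h' | h' | h'
      · exact Or.inr h'
      · exact Or.inl h'
      · exact absurd h' h
  have e2 : m = n → m.base = n.base := fun e => e ▸ rfl
  rw [D.nodeOrder_isLinearization, D.baseOrder_isLinearization]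
  simp only [nodeOrder_lt_iff, vnode_base]
  generalize D.baseOrder = lo
  grind

theorem mem_closedArc_vnode_right {w : Φ.C} (hw : w ∉ Φ.I) {m n : D.Node} (hn : n.base ≠ w) :
    m ∈ closedArc n (D.vnode w hw) ↔
      m.base = w ∨ sbtw n.base m.base w ∨ (m.base = n.base ∧ ¬ m.key < n.key) := by
  have hW : m = D.vnode w hw ↔ m.base = w := ⟨fun e => e ▸ rfl, fun e => by subst e; exact eq_vnode hw⟩
  rw [mem_closedArc, hW]
  have e1 : m.base = n.base → (m = n ∨ n.key < m.key ↔ ¬ m.key < n.key) := fun e => by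
    constructor
    · rintro (rfl | h)
      · exact lt_irrefl _
      · exact h.asymm
    · intro h
      rcases Node.key_trichotomy e with h' | h' | h'
      · exact absurd h' h
      · exact Or.inl h'
      · exact Or.inr h'
  have e2 : m = n → m.base = n.base := fun e => e ▸ rfl
  rw [D.nodeOrder_isLinearization, D.baseOrder_isLinearization]
  simp only [nodeOrder_lt_iff, vnode_base]
  generalize D.baseOrder = lo
  grind

theorem mem_closedArc_vnode {v w : Φ.C} (hv : v ∉ Φ.I) (hw : w ∉ Φ.I) {m : D.Node} :
    m ∈ closedArc (D.vnode v hv) (D.vnode w hw) ↔ m.base ∈ closedArc v w := by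
  by_cases h : w = v
  · subst h
    rw [mem_closedArc, mem_closedArc]
    have hW : m = D.vnode w hw ↔ m.base = w :=
      ⟨fun e => e ▸ rfl, fun e => by subst e; exact eq_vnode hw⟩
    rw [hW]
    have h1 : ¬ sbtw (D.vnode w hw) m (D.vnode w hw) := fun e => (ne_of_sbtw e).2.2 rfl
    have h2 : ¬ sbtw w m.base w := fun e => (ne_of_sbtw e).2.2 rfl
    tauto
  · rw [mem_closedArc_vnode_left hv (by exact h), mem_closedArc]
    have : m.base = w → m = D.vnode w hw := fun e => by subst e; exact eq_vnode hw
    constructor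
    · rintro (h | h | ⟨h, -⟩)
      · exact Or.inl h
      · exact Or.inr (Or.inr h)
      · exact Or.inr (Or.inl h)
    · rintro (h | h | h)
      · exact Or.inl h
      · exact Or.inr (Or.inr ⟨h, by rw [this h]; exact lt_irrefl _⟩)
      · exact Or.inr (Or.inl h)

theorem intervalSet_vnode (hU : U.IsLimitClosed) {v w : Φ.C} (hv : v ∉ Φ.I) (hw : w ∉ Φ.I) :
    intervalSet D.P (D.vnode v hv) (D.vnode w hw) = intervalSet Φ.P v w := by
  rw [intervalSet_base (D := D) hU hv hw, intervalSet, centre_P hU, Set.union_comm]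
  congr 1
  ext x
  simp only [Set.mem_iUnion, Set.mem_preimage, mem_closedArc_vnode]

theorem intervalSep_vnode (hU : U.IsLimitClosed) {v w : Φ.C} (hv : v ∉ Φ.I) (hw : w ∉ Φ.I) :
    intervalSep D.P (D.vnode v hv) (D.vnode w hw) = intervalSep Φ.P v w := by
  rw [intervalSep, intervalSep, intervalSet_vnode hU, intervalSet_vnode hU]

end Pseudoflower.Subdivision
end Vertices

/-! ### Interval separations of the subdivision lie in the universe -/

section Separators

variable {V : Type u} {U : VertexUniverse V} {k : ℕ}

theorem Pseudoflower.IsOpposite.mem_closedArc_pred {Φ : Pseudoflower U k} {p i s w v m m' : Φ.C}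
    (h : Φ.IsOpposite p i s w) (hvi : v ≠ i) (hmv : m ≠ v) (hmi : m ≠ i)
    (hm : sbtw v m i) (hm' : sbtw i m' v) :
    v ≠ p ∧ m ∈ closedArc v p ∧ m' ∈ closedArc p v := by
  have c1 := h.eq_or v
  have c2 := h.eq_or m
  have c4 := h.between
  clear h
  rw [mem_closedArc, mem_closedArc]
  obtain ⟨lo, -, hlo⟩ := exists_isLinearization i
  rw [hlo.grindable] at *
  refine ⟨?_, ?_, ?_⟩
  · grind [hlo.grindable]
  · grind [hlo.grindable]
  · grind [hlo.grindable]

namespace Pseudoflower.Subdivision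

variable {Φ : Pseudoflower U k} {D : Φ.Subdivision} {i : Φ.C}

theorem opp_mem (hi : i ∈ Φ.I) : D.opp i ∉ Φ.I := (D.isOpposite i hi).opp_mem

theorem intervalSet_opp_left (hU : U.IsLimitClosed) {n : D.Node} (hn : n ∉ D.petals)
    (hb : n.base ∈ Φ.I) :
    intervalSet D.P (D.vnode (D.opp n.base) (opp_mem hb)) n = n.cut.sep.left := by
  have ho := D.isOpposite _ hb
  have hm := D.isMax _ hb
  have hs := (hm.subset n.mem.1).2.2
  have hgap := notMem_petals.1 hn
  have hcent : centre Φ.P ⊆ n.cut.sep.left := (centre_subset_intervalSet _ _).trans hs.1.1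
  ext x
  rw [mem_intervalSet, centre_P hU]
  simp only [mem_closedArc_vnode_left _ ho.opp_ne.symm]
  constructor
  · rintro (⟨m, h, hx⟩ | hx)
    · have key : m.base ∈ closedArc (D.opp n.base) (D.pred n.base) → x ∈ n.cut.sep.left := fun h =>
        hs.1.1 (subset_intervalSet h (P_subset m hx))
      rcases h with h | h | ⟨h, h'⟩
      · exact key (mem_closedArc.2 (Or.inl h))
      · apply key
        rw [mem_closedArc]
        have h1 := ho.eq_or m.base
        have h2 := ho.between_opp
        have h3 := ho.between
        obtain ⟨lo, -, hlo⟩ := exists_isLinearization n.base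
        rw [hlo.grindable] at *
        grind [hlo.grindable]
      · rcases Node.key_trichotomy h with e | rfl | e
        · rw [Node.key_lt_iff, hgap] at e
          have e : m.cut < n.cut := by simpa using e
          have hn' := n.mem
          rw [← h] at hn'
          rcases hx with ⟨-, -, ⟨-, hx⟩ | ⟨-, μ, hμ, hx⟩⟩
          · exact (Cut.sep_le e.le).1 hx
          · exact (Cut.sep_le ((hμ.2.2.2 _ hn').resolve_left (not_le_of_gt e))).1 hx
        · rw [P_of_notMem hn] at hx
          exact hx.1.2
        · exact absurd e h'
    · exact hcent hx
  · intro hx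
    by_cases hxc : x ∈ centre Φ.P
    · exact Or.inr hxc
    left
    have hpred : x ∈ intervalSet Φ.P (D.opp n.base) (D.pred n.base) →
        ∃ z : D.Node, (z.base = D.opp n.base ∨ sbtw (D.opp n.base) z.base n.base ∨
          z.base = n.base ∧ ¬n.key < z.key) ∧ x ∈ D.P z := by
      intro h
      rw [intervalSet_base (D := D) hU ho.opp_mem ho.pred_mem] at h
      simp only [Set.mem_union, Set.mem_iUnion, exists_prop, Set.mem_preimage, mem_closedArc] at h
      obtain ⟨z, hz, hxz⟩ := h.resolve_left hxc
      refine ⟨z, ?_, hxz⟩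
      rcases hz with hz | hz | hz
      · exact Or.inl hz
      · rw [hz]; exact Or.inr (Or.inl ho.between_petal')
      · right; left
        have h2 := ho.between_petal'
        obtain ⟨lo, -, hlo⟩ := exists_isLinearization n.base
        rw [hlo.grindable] at *
        grind
    by_cases hxp : x ∈ intervalSet Φ.P (D.opp n.base) (D.pred n.base)
    · exact hpred hxp
    have hxi : x ∈ Φ.P n.base := by
      have := hs.2.1 hx
      rw [intervalSep, ho.intervalSet_opp_succ] at this
      grind
    rcases exists_node hU hb (bot_mem hb) n.mem (bot_le hb n.mem) hxi (by
        change x ∈ intervalSet Φ.P _ _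
        rw [ho.intervalSet_pred_opp]
        exact Or.inl (Or.inl hxi)) hx with h | h | ⟨m, h1, h2, -, h3⟩
    · exact hpred (subset_intervalSet (right_mem_closedArc _ _) h.2)
    · obtain ⟨-, β, hβ, hlt⟩ := n.inner hgap hb
      exact absurd (h.1 β hβ) (not_le_of_gt hlt)
    · refine ⟨m, Or.inr (Or.inr ⟨h1, ?_⟩), h2⟩
      rw [Node.key_lt_iff]
      have : ∀ a b : Cut V, a < b → ¬ b < a ∧ b ≠ a := fun a b h => ⟨h.asymm, h.ne'⟩
      grind

theorem intervalSet_opp_right (hU : U.IsLimitClosed) {n : D.Node} (hn : n ∉ D.petals)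
    (hb : n.base ∈ Φ.I) :
    intervalSet D.P n (D.vnode (D.opp n.base) (opp_mem hb)) = n.cut.sep.right := by
  have ho := D.isOpposite _ hb
  have hm := D.isMax _ hb
  have hs := (hm.subset n.mem.1).2.2
  have hgap := notMem_petals.1 hn
  have hcent : centre Φ.P ⊆ n.cut.sep.right := (centre_subset_intervalSet _ _).trans hs.2.2
  ext x
  rw [mem_intervalSet, centre_P hU]
  simp only [mem_closedArc_vnode_right _ ho.opp_ne.symm]
  constructor
  · rintro (⟨m, h, hx⟩ | hx)
    · have key : m.base ∈ closedArc (D.succ n.base) (D.opp n.base) → x ∈ n.cut.sep.right := fun h =>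
        hs.2.2 (subset_intervalSet h (P_subset m hx))
      rcases h with h | h | ⟨h, h'⟩
      · exact key (mem_closedArc.2 (Or.inr (Or.inl h)))
      · apply key
        rw [mem_closedArc]
        have h1 := ho.eq_or m.base
        have h2 := ho.between_opp
        have h3 := ho.between
        obtain ⟨lo, -, hlo⟩ := exists_isLinearization n.base
        rw [hlo.grindable] at *
        grind [hlo.grindable]
      · rcases Node.key_trichotomy h with e | rfl | e
        · exact absurd e h'
        · rw [P_of_notMem hn] at hx
          exact hx.2
        · rw [Node.key_lt_iff, hgap] at e
          have e : n.cut ≤ m.cut := e.elim le_of_lt fun h => h.1.le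
          exact (Cut.sep_le e).2 hx.2.1
    · exact hcent hx
  · intro hx
    by_cases hxc : x ∈ centre Φ.P
    · exact Or.inr hxc
    left
    have hsucc : x ∈ intervalSet Φ.P (D.succ n.base) (D.opp n.base) →
        ∃ z : D.Node, (z.base = D.opp n.base ∨ sbtw n.base z.base (D.opp n.base) ∨
          z.base = n.base ∧ ¬z.key < n.key) ∧ x ∈ D.P z := by
      intro h
      rw [intervalSet_base (D := D) hU ho.succ_mem ho.opp_mem] at h
      simp only [Set.mem_union, Set.mem_iUnion, exists_prop, Set.mem_preimage, mem_closedArc] at h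
      obtain ⟨z, hz, hxz⟩ := h.resolve_left hxc
      refine ⟨z, ?_, hxz⟩
      have h2 := ho.between_petal
      rcases hz with hz | hz | hz
      · rw [hz]; exact Or.inr (Or.inl h2.cyclic_left)
      · exact Or.inl hz
      · right; left
        obtain ⟨lo, -, hlo⟩ := exists_isLinearization n.base
        rw [hlo.grindable] at *
        grind
    by_cases hxp : x ∈ intervalSet Φ.P (D.succ n.base) (D.opp n.base)
    · exact hsucc hxp
    have hxi : x ∈ Φ.P n.base := by
      have := hs.1.2 hx
      rw [intervalSep, ho.intervalSet_pred_opp] at this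
      grind
    obtain ⟨τ, hτ, hτs, hmax⟩ := exists_top (D := D) hb
    rcases exists_node hU hb n.mem hτ (hmax _ n.mem) hxi hx (by
        rw [hτs]
        change x ∈ intervalSet Φ.P _ _
        rw [ho.intervalSet_opp_succ]
        exact Or.inl (Or.inr hxi)) with h | h | ⟨m, h1, h2, h3, -⟩
    · exact absurd h.1 (bot_lt hb hn).ne'
    · exact hsucc (subset_intervalSet (left_mem_closedArc _ _) h.2)
    · refine ⟨m, Or.inr (Or.inr ⟨h1, ?_⟩), h2⟩
      rw [Node.key_lt_iff, hgap]
      rintro (h | h)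
      · exact not_lt_of_ge h3 h
      · simp at h

/-- Seen from the opposite cutpoint, a new cutpoint gives back its split. This is how the new
interval separations come to lie in U. -/
theorem intervalSep_opp (hU : U.IsLimitClosed) {n : D.Node} (hn : n ∉ D.petals)
    (hb : n.base ∈ Φ.I) : intervalSep D.P (D.vnode (D.opp n.base) (opp_mem hb)) n = n.cut.sep := by
  rw [intervalSep, intervalSet_opp_left hU hn hb, intervalSet_opp_right hU hn hb]

theorem sepAt_vnode (hU : U.IsLimitClosed) {v : Φ.C} (hv : v ∉ Φ.I) {n : D.Node}
    (hn : n ∉ D.petals) (hne : D.vnode v hv ≠ n) (x : V) : SepAt D.P x (D.vnode v hv) n := by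
  by_cases hb : n.base ∈ Φ.I
  · have ho := D.isOpposite _ hb
    have hw : SepAt D.P x (D.vnode (D.opp n.base) (opp_mem hb)) n := by
      intro h1 h2
      rw [intervalSet_opp_left hU hn hb] at h1
      rw [intervalSet_opp_right hU hn hb] at h2
      have : x ∈ n.cut.sep.left ∩ n.cut.sep.right := ⟨h1, h2⟩
      rw [ho.left_inter_right ((D.isMax _ hb).subset n.mem.1)] at this
      rw [P_of_notMem hn, centre_P hU, P_vnode, Set.union_comm (Φ.P _)]
      exact this
    by_cases hvw : D.opp n.base = v
    · subst hvw
      exact hw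
    have hvw' : D.vnode (D.opp n.base) (opp_mem hb) ≠ D.vnode v hv := fun e => hvw (congrArg Node.base e)
    have hwn : D.vnode (D.opp n.base) (opp_mem hb) ≠ n := fun e => opp_mem hb (by
      have := congrArg Node.base e
      rw [vnode_base] at this
      rw [this]; exact hb)
    -- If x avoids P_w, the separator conditions at w transfer to v and n. Otherwise x avoids the
    -- petal, so nodes over other elements of Φ witness it on both sides, and the separator of v and
    -- the predecessor in Φ decides.
    by_cases hxw : x ∈ Φ.P (D.opp n.base)
    · intro h1 h2
      by_contra hx
      simp only [Set.mem_union, not_or, P_vnode, centre_P hU] at hx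
      obtain ⟨⟨hxv, -⟩, hxc⟩ := hx
      have hxi : x ∉ Φ.P n.base := fun h => Set.disjoint_left.1 ho.disjoint hxw h
      have hvn : n.base ≠ v := fun e => hv (e ▸ hb)
      rw [mem_intervalSet, centre_P hU] at h1 h2
      obtain ⟨m, hm, hxm⟩ := h1.resolve_right hxc
      obtain ⟨m', hm', hxm'⟩ := h2.resolve_right hxc
      have hxm := P_subset m hxm
      have hxm' := P_subset m' hxm'
      rw [mem_closedArc_vnode_left hv hvn] at hm
      rw [mem_closedArc_vnode_right hv hvn] at hm'
      have e1 : m.base ≠ n.base := fun e => hxi (e ▸ hxm)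
      have e2 : m'.base ≠ n.base := fun e => hxi (e ▸ hxm')
      have e3 : m.base ≠ v := fun e => hxv (e ▸ hxm)
      have e4 : m'.base ≠ v := fun e => hxv (e ▸ hxm')
      have hm : sbtw v m.base n.base := by tauto
      have hm' : sbtw n.base m'.base v := by tauto
      have c5 := ho.mem_closedArc_pred hvn.symm e3 e1 hm hm'
      rcases Φ.sepAt hv ho.pred_mem c5.1 x (subset_intervalSet c5.2.1 hxm)
        (subset_intervalSet c5.2.2 hxm') with (h | h) | h
      · exact hxv h
      · exact hxi (ho.pred_subset h)
      · exact hxc h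
    · refine SepAt.of_base' (u := D.vnode (D.opp n.base) (opp_mem hb)) (by simpa using hxw) hvw' hwn hne ?_ hw
      intro h1 h2
      rw [intervalSet_vnode hU] at h1 h2
      rw [P_vnode, P_vnode, centre_P hU]
      exact Φ.sepAt ho.opp_mem hv hvw x h1 h2
  · rw [eq_vnode hb] at hne ⊢
    have hne' : v ≠ n.base := by
      rintro rfl; exact hne rfl
    intro h1 h2
    rw [intervalSet_vnode hU] at h1 h2
    rw [P_vnode, P_vnode, centre_P hU]
    exact Φ.sepAt hv hb hne' x h1 h2

theorem vnode_ne {v : Φ.C} (hv : v ∉ Φ.I) {n : D.Node} (hb : n.base ∈ Φ.I) : D.vnode v hv ≠ n := by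
  rintro rfl
  exact hv hb

/-- Since P_a and P_b are disjoint, one of a, b has a set avoiding x and can serve as base point for
`SepAt.of_base'`. -/
theorem sepAt_node (hU : U.IsLimitClosed) {m n : D.Node} (hm : m ∉ D.petals)
    (hn : n ∉ D.petals) (hne : m ≠ n) (x : V) : SepAt D.P x m n := by
  by_cases hbm : m.base ∈ Φ.I
  · by_cases hbn : n.base ∈ Φ.I
    · have key : ∀ u, u ∉ Φ.I → x ∉ Φ.P u → SepAt D.P x m n := fun u hu hx =>
        SepAt.of_base' (u := D.vnode u hu) (by simpa using hx) (vnode_ne hu hbm) (vnode_ne hu hbn)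
          hne (sepAt_vnode hU hu hm (vnode_ne hu hbm) x) (sepAt_vnode hU hu hn (vnode_ne hu hbn) x)
      by_cases hx : x ∈ Φ.P D.a
      · exact key D.b D.isTripod.mem₂ (Set.disjoint_left.1 D.isTripod.disjoint₁ hx)
      · exact key D.a D.isTripod.mem₁ hx
    · rw [eq_vnode hbn] at hne ⊢
      exact (sepAt_vnode hU hbn hm hne.symm x).symm
  · rw [eq_vnode hbm] at hne ⊢
    exact sepAt_vnode hU hbm hn hne x

theorem disjoint_opp_pred (hi : i ∈ Φ.I) : Disjoint (Φ.P (D.opp i)) (Φ.P (D.pred i)) :=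
  (D.isOpposite i hi).disjoint.mono_right (D.isOpposite i hi).pred_subset

theorem disjoint_opp_succ (hi : i ∈ Φ.I) : Disjoint (Φ.P (D.opp i)) (Φ.P (D.succ i)) :=
  (D.isOpposite i hi).disjoint.mono_right (D.isOpposite i hi).succ_subset

theorem intervalSep_opp_mem (hU : U.IsLimitClosed) {n : D.Node} (hn : n ∉ D.petals)
    (hb : n.base ∈ Φ.I) : intervalSep D.P (D.vnode (D.opp n.base) (opp_mem hb)) n ∈ U.seps := by
  rw [intervalSep_opp hU hn hb]
  exact ((D.isMax _ hb).subset n.mem.1).1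

theorem intervalSep_swap_mem {C : Type u} [CircularOrder C] {P : C → Set V} {a b : C}
    (h : intervalSep P a b ∈ U.seps) : intervalSep P b a ∈ U.seps := U.inv_mem _ h

/-- Up to inversion the separation is a corner of the split S(w,n) and of a separation of Φ between
v and a neighbour of the petal. The set at w is disjoint from those at both neighbours. -/
theorem intervalSep_vnode_mem (hU : U.IsLimitClosed) {v : Φ.C} (hv : v ∉ Φ.I) {n : D.Node}
    (hn : n ∉ D.petals) (hne : D.vnode v hv ≠ n) :
    intervalSep D.P (D.vnode v hv) n ∈ U.seps := by
  by_cases hb : n.base ∈ Φ.I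
  · have ho := D.isOpposite _ hb
    by_cases hvw : D.opp n.base = v
    · subst hvw
      exact intervalSep_opp_mem hU hn hb
    have hvn : n.base ≠ v := fun e => hv (e ▸ hb)
    have c1 := ho.eq_or v
    have c2 := ho.between
    have c3 := ho.between_opp
    have hwm := intervalSep_opp_mem hU hn hb
    rcases sbtw_or_sbtw_of_ne hvn (Ne.symm hvw) ho.opp_ne with e | e
    · have c4 : sbtw n.base (D.opp n.base) (D.pred n.base) ∧ v ≠ D.pred n.base := by
        obtain ⟨lo, -, hlo⟩ := exists_isLinearization n.base
        rw [hlo.grindable] at *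
        grind [hlo.grindable]
      have := intervalSep_eq_inf (P := D.P) (a := n) (b := D.vnode v hv)
        (w := D.vnode _ ho.opp_mem) (w' := D.vnode _ ho.pred_mem) (Node.sbtw_of_base e)
        (Node.sbtw_of_base c4.1) (fun x => (sepAt_vnode hU _ hn (vnode_ne _ hb) x).symm)
        (fun x => sepAt_vnode hU hv (vnode_notMem _ _) (fun h => c4.2 (congrArg Node.base h)) x)
        (by simpa using disjoint_opp_pred hb)
      apply intervalSep_swap_mem
      rw [this]
      refine U.inf_mem _ (U.inv_mem _ hwm) _ ?_
      rw [intervalSep_vnode hU]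
      exact Φ.sep_mem _ ho.pred_mem _ hv c4.2.symm
    · have c4 : sbtw v n.base (D.succ n.base) ∧ sbtw v (D.succ n.base) (D.opp n.base) := by
        obtain ⟨lo, -, hlo⟩ := exists_isLinearization n.base
        rw [hlo.grindable] at *
        grind [hlo.grindable]
      have c5 : v ≠ D.succ n.base := (ne_of_sbtw c4.1).2.2.symm
      have := intervalSep_eq_inf (P := D.P) (a := D.vnode v hv) (b := n)
        (w := D.vnode _ ho.succ_mem) (w' := D.vnode _ ho.opp_mem) (Node.sbtw_of_base c4.1)
        (Node.sbtw_of_base c4.2)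
        (fun x => sepAt_vnode hU hv (vnode_notMem _ _) (fun h => c5 (congrArg Node.base h)) x)
        (fun x => (sepAt_vnode hU _ hn (vnode_ne _ hb) x).symm)
        (by simpa using (disjoint_opp_succ hb).symm)
      rw [this]
      refine U.inf_mem _ ?_ _ hwm
      rw [intervalSep_vnode hU]
      exact Φ.sep_mem _ hv _ ho.succ_mem c5
  · rw [eq_vnode hb] at hne ⊢
    rw [intervalSep_vnode hU]
    exact Φ.sep_mem _ hv _ hb (by rintro rfl; exact hne rfl)

theorem intervalSep_mem_of_sbtw (hU : U.IsLimitClosed) {m n : D.Node} (hm : m ∉ D.petals)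
    (hn : n ∉ D.petals) (hbm : m.base ∈ Φ.I) (hbn : n.base ∈ Φ.I) {w w' : Φ.C} (hw : w ∉ Φ.I)
    (hw' : w' ∉ Φ.I) (hd : Disjoint (Φ.P w) (Φ.P w')) (h : sbtw m n (D.vnode w hw))
    (h' : sbtw m (D.vnode w hw) (D.vnode w' hw')) : intervalSep D.P m n ∈ U.seps := by
  rw [intervalSep_eq_inf h h' (fun x => (sepAt_vnode hU _ hm (vnode_ne _ hbm) x).symm)
    (fun x => (sepAt_vnode hU _ hn (vnode_ne _ hbn) x).symm) (by simpa using hd)]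
  exact U.inf_mem _ (intervalSep_swap_mem (intervalSep_vnode_mem hU hw hm (vnode_ne _ hbm))) _
    (intervalSep_vnode_mem hU hw' hn (vnode_ne _ hbn))

theorem intervalSep_mem (hU : U.IsLimitClosed) {m n : D.Node} (hm : m ∉ D.petals)
    (hn : n ∉ D.petals) (hne : m ≠ n) : intervalSep D.P m n ∈ U.seps := by
  by_cases hbm : m.base ∈ Φ.I
  · by_cases hbn : n.base ∈ Φ.I
    · have ht := D.isTripod
      have n1 := vnode_ne (D := D) ht.mem₁ hbm
      have n2 := vnode_ne (D := D) ht.mem₂ hbm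
      have n3 := vnode_ne (D := D) ht.mem₃ hbm
      have n4 := vnode_ne (D := D) ht.mem₁ hbn
      have n5 := vnode_ne (D := D) ht.mem₂ hbn
      have n6 := vnode_ne (D := D) ht.mem₃ hbn
      have hs : sbtw (D.vnode _ ht.mem₁) (D.vnode _ ht.mem₂) (D.vnode _ ht.mem₃) :=
        Node.sbtw_of_base ht.between
      -- Two of a, b, c lie on the same arc between m and n. Their disjoint sets allow S(m,n) or its
      -- inverse to be written as a corner.
      have key : ∀ (w w' : Φ.C) (hw : w ∉ Φ.I) (hw' : w' ∉ Φ.I), Disjoint (Φ.P w) (Φ.P w') →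
          (sbtw m n (D.vnode w hw) ∧ sbtw m (D.vnode w hw) (D.vnode w' hw')) ∨
          (sbtw n m (D.vnode w hw) ∧ sbtw n (D.vnode w hw) (D.vnode w' hw')) →
          intervalSep D.P m n ∈ U.seps := by
        rintro w w' hw hw' hd (⟨h, h'⟩ | ⟨h, h'⟩)
        · exact intervalSep_mem_of_sbtw hU hm hn hbm hbn hw hw' hd h h'
        · exact intervalSep_swap_mem (intervalSep_mem_of_sbtw hU hn hm hbn hbm hw hw' hd h h')
      have k1 := key _ _ ht.mem₁ ht.mem₂ ht.disjoint₁
      have k2 := key _ _ ht.mem₂ ht.mem₁ ht.disjoint₁.symm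
      have k3 := key _ _ ht.mem₂ ht.mem₃ ht.disjoint₂
      have k4 := key _ _ ht.mem₃ ht.mem₂ ht.disjoint₂.symm
      have k5 := key _ _ ht.mem₃ ht.mem₁ ht.disjoint₃
      have k6 := key _ _ ht.mem₁ ht.mem₃ ht.disjoint₃.symm
      clear key
      generalize (intervalSep D.P m n ∈ U.seps) = Q at *
      generalize D.vnode _ ht.mem₁ = A at *
      generalize D.vnode _ ht.mem₂ = B at *
      generalize D.vnode _ ht.mem₃ = E at *
      by_contra hQ
      obtain ⟨lo, hmin, hlo⟩ := exists_isLinearization m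
      have hlt : ∀ x, x ≠ m → m < x := fun x hx => lt_of_le_of_ne (hmin x) hx.symm
      have l0 := hlt n hne.symm
      have l1 := hlt A n1
      have l2 := hlt B n2
      have l3 := hlt E n3
      clear hmin hlt
      simp only [hlo.grindable, l0, l1, l2, l3, l0.not_gt, l1.not_gt, l2.not_gt, l3.not_gt, hQ,
        true_and, and_true, and_false, or_false, false_or, imp_false] at hs k1 k2 k3 k4 k5 k6
      rcases lt_or_gt_of_ne n4 with a | a <;> rcases lt_or_gt_of_ne n5 with b | b <;>
        rcases lt_or_gt_of_ne n6 with c | c <;> grind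
    · rw [eq_vnode hbn] at hne ⊢
      exact intervalSep_swap_mem (intervalSep_vnode_mem hU hbn hm hne.symm)
  · rw [eq_vnode hbm] at hne ⊢
    exact intervalSep_vnode_mem hU hbm hn hne

theorem encard_P (hU : U.IsLimitClosed) {n : D.Node} (hn : n ∉ D.petals) :
    2 * (D.P n).encard + (centre D.P).encard = k := by
  rw [centre_P hU]
  by_cases hb : n.base ∈ Φ.I
  · rw [P_of_notMem hn]
    exact (D.isOpposite _ hb).encard_cutset ((D.isMax _ hb).subset n.mem.1)
  · rw [eq_vnode hb, P_vnode]
    exact Φ.encard_cutpoint _ hb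

theorem inter_intervalSet (hU : U.IsLimitClosed) {m n : D.Node} (hm : m ∉ D.petals)
    (hn : n ∉ D.petals) (hne : m ≠ n) :
    intervalSet D.P m n ∩ intervalSet D.P n m = D.P m ∪ D.P n ∪ centre D.P := by
  apply Set.Subset.antisymm
  · exact fun x hx => sepAt_node hU hm hn hne x hx.1 hx.2
  · have h1 := subset_intervalSet (P := D.P) (left_mem_closedArc m n)
    have h2 := subset_intervalSet (P := D.P) (left_mem_closedArc n m)
    have h3 := subset_intervalSet (P := D.P) (right_mem_closedArc m n)
    have h4 := subset_intervalSet (P := D.P) (right_mem_closedArc n m)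
    have h5 := centre_subset_intervalSet (P := D.P) m n
    have h6 := centre_subset_intervalSet (P := D.P) n m
    exact Set.union_subset (Set.union_subset (Set.subset_inter h1 h4) (Set.subset_inter h3 h2))
      (Set.subset_inter h5 h6)

theorem order_le (hU : U.IsLimitClosed) {m n : D.Node} (hm : m ∉ D.petals)
    (hn : n ∉ D.petals) (hne : m ≠ n) : (intervalSep D.P m n).order ≤ k := by
  rw [VPair.order]
  change (intervalSet D.P m n ∩ intervalSet D.P n m).encard ≤ k
  rw [inter_intervalSet hU hm hn hne]
  refine (Set.encard_union_le _ _).trans ?_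
  rw [← encard_P hU hm, two_mul]
  refine add_le_add_left ((Set.encard_union_le _ _).trans ?_) _
  exact add_le_add_right (ENat.two_mul_add_cancel (encard_P hU hn) (encard_P hU hm)).le _

end Pseudoflower.Subdivision
end Separators

/-! ### The subdivision is a pseudoflower extending the given one -/

section Refinement

variable {V : Type u} {U : VertexUniverse V} {k : ℕ}

theorem IsCyclicSucc.left_unique {C : Type u} [CircularOrder C] {p p' a : C}
    (h : IsCyclicSucc p a) (h' : IsCyclicSucc p' a) : p = p' := by
  by_contra hne
  rcases sbtw_or_sbtw_of_ne hne h'.1.symm h.1 with e | e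
  · exact h.2 p' (Ne.symm hne) h'.1.symm (mem_closedArc.2 (Or.inr (Or.inr e)))
  · exact h'.2 p hne h.1.symm (mem_closedArc.2 (Or.inr (Or.inr e.cyclic_left)))

theorem IsCyclicSucc.right_unique {C : Type u} [CircularOrder C] {s s' a : C}
    (h : IsCyclicSucc a s) (h' : IsCyclicSucc a s') : s = s' := by
  by_contra hne
  rcases sbtw_or_sbtw_of_ne h.1.symm hne h'.1 with e | e
  · exact h'.2 s h.1 hne (mem_closedArc.2 (Or.inr (Or.inr e)))
  · exact h.2 s' h'.1 (Ne.symm hne) (mem_closedArc.2 (Or.inr (Or.inr e.cyclic_right)))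

namespace Pseudoflower.Subdivision

variable {Φ : Pseudoflower U k} {D : Φ.Subdivision} {i : Φ.C}

theorem eq_vnode_of_base {v : Φ.C} (hv : v ∉ Φ.I) {n : D.Node} (h : n.base = v) :
    n = D.vnode v hv := by
  subst h
  exact eq_vnode hv

theorem Node.key_between {x y b : D.Node} (h : x.base = y.base) (hxy : x.key < y.key)
    (hb : sbtw x b y) : b.base = x.base ∧ x.key < b.key ∧ b.key < y.key := by
  have hbase : b.base = x.base := by
    by_contra hne
    exact sbtw_asymm (Node.sbtw_of_key h (Ne.symm hne) hxy) hb.cyclic_right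
  have h1 : x.key < b.key := by
    rcases Node.key_trichotomy hbase with e | rfl | e
    · exact absurd (Node.sbtw_of_key_key hbase h e hxy) (sbtw_asymm hb.cyclic_right)
    · exact absurd rfl (ne_of_sbtw hb).1
    · exact e
  refine ⟨hbase, h1, ?_⟩
  rcases Node.key_trichotomy (hbase.trans h) with e | rfl | e
  · exact e
  · exact absurd rfl (ne_of_sbtw hb).2.1
  · exact absurd (Node.sbtw_of_key_key h (h.symm.trans hbase.symm) hxy e)
      (sbtw_asymm hb.cyclic_left)

/-- The node at the beginning of a jump. -/
theorem exists_pred_jumpNode (hU : U.IsLimitClosed) (hi : i ∈ Φ.I) {κ μ : Cut V}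
    (h : IsJump (D.cuts i) κ μ) : ∃ p, p ∉ D.petals ∧ IsCyclicSucc p (D.jumpNode h) ∧
      D.P p = Φ.cutset i κ.sep ∧ D.vnode (D.opp i) (opp_mem hi) ≠ p ∧
      intervalSep D.P (D.vnode (D.opp i) (opp_mem hi)) p = κ.sep := by
  have ho := D.isOpposite i hi
  -- A first cut is not a node; the predecessor of the petal in Φ replaces it.
  rcases (bot_le hi h.1).lt_or_eq with hlt | rfl
  · let p : D.Node := ⟨i, κ, false, h.1, by simp, fun _ _ => ⟨⟨_, bot_mem hi, hlt⟩, μ, h.2.1, h.2.2.1⟩⟩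
    have hp : p ∉ D.petals := by simp [petals, p]
    refine ⟨p, hp, ⟨fun e => hp (e ▸ jumpNode_mem h), fun b hb1 hb2 hb => ?_⟩, P_of_notMem hp,
      vnode_ne _ (n := p) hi, intervalSep_opp hU hp hi⟩
    have hb := ((mem_closedArc.1 hb).resolve_left hb1).resolve_left hb2
    obtain ⟨-, h1, h2⟩ := Node.key_between (x := p) (y := D.jumpNode h) rfl
      (Node.key_lt_iff.2 (Or.inr ⟨rfl, rfl, rfl⟩)) hb
    simp only [Node.key_lt_iff, jumpNode, p] at h1 h2
    have := fun e : κ < b.cut => e.asymm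
    grind
  · refine ⟨D.vnode _ ho.pred_mem, vnode_notMem _ _, ⟨(vnode_ne _ hi).symm, fun b hb1 hb2 hb => ?_⟩,
      ?_, fun e => ho.opp_ne_pred (congrArg Node.base e), intervalSep_vnode hU _ _⟩
    · rw [mem_closedArc_vnode_left ho.pred_mem (by exact (ne_of_sbtw ho.between).1.symm)] at hb
      rcases hb with hb | hb | ⟨hb, hk⟩
      · exact hb1 (eq_vnode_of_base _ hb)
      · have h1 := ho.eq_or b.base
        have h2 := ho.between
        change sbtw (D.pred i) b.base i at hb
        obtain ⟨lo, -, hlo⟩ := exists_isLinearization i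
        rw [hlo.grindable] at *
        grind [hlo.grindable]
      · change b.base = i at hb
        subst hb
        rw [Node.key_lt_iff] at hk
        simp only [jumpNode, not_or] at hk
        by_cases hbI : b ∈ D.petals
        · refine hb2 (Node.ext rfl ?_ hbI)
          exact ((bot_le hi b.mem).lt_or_eq.resolve_left hk.1).symm
        · exact hk.1 (bot_lt hi hbI)
    · rw [P_vnode]
      exact ho.cutset_bot.symm

/-- The node at the end of a jump. -/
theorem exists_succ_jumpNode (hU : U.IsLimitClosed) (hi : i ∈ Φ.I) {κ μ : Cut V}
    (h : IsJump (D.cuts i) κ μ) : ∃ p, p ∉ D.petals ∧ IsCyclicSucc (D.jumpNode h) p ∧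
      D.P p = Φ.cutset i μ.sep ∧ D.vnode (D.opp i) (opp_mem hi) ≠ p ∧
      intervalSep D.P (D.vnode (D.opp i) (opp_mem hi)) p = μ.sep := by
  have ho := D.isOpposite i hi
  rcases cut_cases hi h.2.1 with rfl | ⟨hτ, hmax⟩ | ⟨p, hp, rfl, rfl⟩
  · exact absurd (bot_le hi h.1) (not_le_of_gt h.2.2.1)
  · refine ⟨D.vnode _ ho.succ_mem, vnode_notMem _ _, ⟨vnode_ne _ hi, fun b hb1 hb2 hb => ?_⟩,
      ?_, fun e => ho.opp_ne_succ (congrArg Node.base e), ?_⟩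
    · rw [mem_closedArc_vnode_right ho.succ_mem (by exact (ne_of_sbtw ho.between).2.1)] at hb
      rcases hb with hb | hb | ⟨hb, hk⟩
      · exact hb2 (eq_vnode_of_base _ hb)
      · have h1 := ho.eq_or b.base
        have h2 := ho.between
        change sbtw i b.base (D.succ i) at hb
        obtain ⟨lo, -, hlo⟩ := exists_isLinearization i
        rw [hlo.grindable] at *
        grind [hlo.grindable]
      · change b.base = i at hb
        subst hb
        rw [Node.key_lt_iff] at hk
        simp only [jumpNode, not_or, and_true] at hk
        have hκ : κ ≤ b.cut := (cuts_total h.1 b.mem).elim id fun h' =>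
          h'.lt_or_eq.elim (fun h' => absurd h' hk.1) fun h' => h'.ge
        by_cases hbI : b ∈ D.petals
        · rcases hκ.lt_or_eq with e | e
          · obtain ⟨β, hβ⟩ := b.jump hbI
            have h1 := hmax _ hβ.2.1
            have h2 := (h.2.2.2 _ b.mem).resolve_left (not_le_of_gt e)
            exact absurd (h2.trans_lt hβ.2.2.1) (not_lt_of_ge h1)
          · exact hb1 (Node.ext rfl e.symm hbI)
        · obtain ⟨-, β, hβ, hlt⟩ := b.inner (notMem_petals.1 hbI) hi
          rcases hκ.lt_or_eq with e | e
          · have h2 := (h.2.2.2 _ b.mem).resolve_left (not_le_of_gt e)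
            exact absurd (h2.trans_lt hlt) (not_lt_of_ge (hmax _ hβ))
          · exact hk.2 ⟨e.symm, notMem_petals.1 hbI⟩
    · rw [P_vnode, hτ]
      exact ho.cutset_top.symm
    · rw [hτ]
      exact intervalSep_vnode hU _ _
  · refine ⟨p, hp, ⟨fun e => hp (e ▸ jumpNode_mem h), fun b hb1 hb2 hb => ?_⟩, P_of_notMem hp,
      vnode_ne _ hi, intervalSep_opp hU hp hi⟩
    have hb := ((mem_closedArc.1 hb).resolve_left hb1).resolve_left hb2
    obtain ⟨hbase, h1, h2⟩ := Node.key_between (x := D.jumpNode h) (y := p) rfl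
      (Node.key_lt_iff.2 (Or.inl h.2.2.1)) hb
    rw [Node.key_lt_iff] at h1 h2
    rw [notMem_petals.1 hp] at h2
    have h1 : κ < b.cut := by simpa [jumpNode] using h1
    have h2 : b.cut < p.cut := by simpa using h2
    have hbm := b.mem
    rw [hbase] at hbm
    rcases h.2.2.2 _ hbm with e | e
    · exact not_lt_of_ge e h1
    · exact not_lt_of_ge e h2

theorem cutset_subset_left {κ μ : Cut V} (h : IsJump (D.cuts i) κ μ) :
    Φ.cutset i κ.sep ⊆ D.P (D.jumpNode h) :=
  fun _ hx => (mem_P_jumpNode h).2 ⟨hx.1.1, hx.2, (Cut.sep_le h.2.2.1.le).1 hx.1.2⟩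

theorem cutset_subset_right {κ μ : Cut V} (h : IsJump (D.cuts i) κ μ) :
    Φ.cutset i μ.sep ⊆ D.P (D.jumpNode h) :=
  fun _ hx => (mem_P_jumpNode h).2 ⟨hx.1.1, (Cut.sep_le h.2.2.1.le).2 hx.2, hx.1.2⟩

theorem neighbor_subset (hU : U.IsLimitClosed) {j p s : D.Node} (hj : j ∈ D.petals)
    (hp : IsCyclicSucc p j) (hs : IsCyclicSucc j s) : D.P p ∪ D.P s ⊆ D.P j := by
  have hi := base_mem_of_mem_petals hj
  obtain ⟨κ, μ, h, hj'⟩ := exists_eq_jumpNode hj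
  obtain ⟨p', -, h1, h2, -⟩ := exists_pred_jumpNode hU hi h
  obtain ⟨s', -, h3, h4, -⟩ := exists_succ_jumpNode hU hi h
  rw [← hj'] at h1 h3
  rw [hp.left_unique h1, hs.right_unique h3, h2, h4, hj']
  exact Set.union_subset (cutset_subset_left h) (cutset_subset_right h)

theorem encard_cutset (hi : i ∈ Φ.I) {κ : Cut V} (hκ : κ ∈ D.cuts i) :
    2 * (Φ.cutset i κ.sep).encard + (centre Φ.P).encard = k :=
  (D.isOpposite i hi).encard_cutset ((D.isMax i hi).subset hκ.1)

theorem finite_of_encard {A : Set V} {x : ℕ∞} (h : 2 * A.encard + x = k) : A.Finite := by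
  rw [← Set.encard_ne_top_iff]
  intro e
  rw [e] at h
  simp at h

/-- A petal of the smallest possible size is the second copy of a doubled separation. -/
theorem eq_of_trivial (hi : i ∈ Φ.I) {κ μ : Cut V} (h : IsJump (D.cuts i) κ μ)
    (hc : 2 * (D.P (D.jumpNode h)).encard + (centre Φ.P).encard = k) :
    κ.sep = μ.sep ∧ κ.bit = false ∧ D.pick (D.P (D.jumpNode h)) = (i, κ.sep) := by
  have e1 : Φ.cutset i κ.sep = D.P (D.jumpNode h) :=
    (finite_of_encard (encard_cutset hi h.1)).eq_of_subset_of_encard_le (cutset_subset_left h)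
      (ENat.two_mul_add_cancel hc (encard_cutset hi h.1)).le
  have e2 : Φ.cutset i μ.sep = D.P (D.jumpNode h) :=
    (finite_of_encard (encard_cutset hi h.2.1)).eq_of_subset_of_encard_le (cutset_subset_right h)
      (ENat.two_mul_add_cancel hc (encard_cutset hi h.2.1)).le
  -- Both end cutsets fill the new petal, so every vertex of the old petal between the two splits
  -- lies in both separators.
  have e3 : κ.sep = μ.sep := (D.isMax i hi).sep_eq_of_subset (D.isOpposite i hi) h.1.1 h.2.1.1
    (Cut.sep_le h.2.2.1.le) fun x hx h1 h2 => by
      have h3 : x ∈ D.P (D.jumpNode h) := (mem_P_jumpNode h).2 ⟨hx, h1, h2⟩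
      have h4 := h3
      rw [← e1] at h3
      rw [← e2] at h4
      exact ⟨h3.1.2, h4.2⟩
  rcases isJump_sep h with h' | ⟨-, h1, h2⟩
  · exact absurd e3 h'.2.2.1.ne
  · refine ⟨e3, h1, ?_⟩
    rw [← e2, e3]
    exact (h.2.1.2 h2).2

/-- By `eq_of_trivial` both petals come from doubling the split that `pick` assigns to their common
vertex set. -/
theorem petal_injective {j j' : D.Node} (hj : j ∈ D.petals) (hj' : j' ∈ D.petals)
    (hc : 2 * (D.P j).encard + (centre Φ.P).encard = k) (he : D.P j = D.P j') : j = j' := by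
  obtain ⟨κ, μ, h, e⟩ := exists_eq_jumpNode hj
  obtain ⟨κ', μ', h', e'⟩ := exists_eq_jumpNode hj'
  have h1 := eq_of_trivial (base_mem_of_mem_petals hj) h (by rwa [← e])
  have h2 := eq_of_trivial (base_mem_of_mem_petals hj') h' (by rwa [← e', ← he])
  rw [← e] at h1
  rw [← e', ← he, h1.2.2, Prod.mk.injEq] at h2
  have e3 : j.cut = κ := congrArg Node.cut e
  have e4 : j'.cut = κ' := congrArg Node.cut e'
  refine Node.ext h2.2.2.1 ?_ (hj.trans hj'.symm)
  rw [e3, e4, Cut.ext_iff']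
  exact ⟨h2.2.2.2, h1.2.1.trans h2.2.1.symm⟩

/-- The pseudoflower obtained by subdividing the petals of `Φ`. -/
noncomputable def refinement (D : Φ.Subdivision) (hU : U.IsLimitClosed) : Pseudoflower U k where
  C := D.Node
  I := D.petals
  isCycleCompletion := isCycleCompletion_petals hU
  P := D.P
  encard_cutpoint := fun _ hv => encard_P hU hv
  sep_mem := fun _ hv _ hw h => intervalSep_mem hU hv hw h
  sep_order := fun _ hv _ hw h => order_le hU hv hw h
  separator := fun _ hv _ hw h => inter_intervalSet hU hv hw h
  neighbor_subset := fun _ hj _ _ hp hs => neighbor_subset hU hj hp hs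
  petal_injective := fun _ hj _ hj' hc he => petal_injective hj hj' (centre_P (D := D) hU ▸ hc) he

theorem le_refinement (D : Φ.Subdivision) (hU : U.IsLimitClosed) : Φ ≤ D.refinement hU := by
  refine ⟨(centre_P hU).symm, (Node.base : D.Node → Φ.C), fun z => ?_, fun x y z h => ?_, ?_,
    fun v hv w hw => intervalSet_base hU hv hw⟩
  · by_cases hz : z ∈ Φ.I
    · obtain ⟨m, -, hm⟩ := exists_petal_base (D := D) hU hz
      exact ⟨m, hm⟩
    · exact ⟨D.vnode z hz, rfl⟩
  · exact Node.sbtw_of_base h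
  · ext z
    constructor
    · rintro ⟨m, hm, rfl⟩
      exact base_mem_of_mem_petals hm
    · intro hz
      exact exists_petal_base (D := D) hU hz

end Pseudoflower.Subdivision
end Refinement

/-! ### General facts about extensions -/

section Extensions

variable {V : Type u} {U : VertexUniverse V} {k : ℕ}

theorem IsCyclicSucc.mem_closedArc {C : Type u} [CircularOrder C] {p i s z : C}
    (h : IsCyclicSucc p i) (h' : IsCyclicSucc i s) (hps : p ≠ s) (hz : z ∈ closedArc p s) :
    z = p ∨ z = i ∨ z = s := by
  have h1 := h.2 z
  have h2 := h'.2 z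
  have h3 := h.2 s hps.symm h'.1
  have h4 := h.1
  have h5 := h'.1
  rw [_root_.mem_closedArc] at *
  obtain ⟨lo, -, hlo⟩ := exists_isLinearization i
  rw [hlo.grindable] at *
  grind [hlo.grindable]

theorem IsCyclicSucc.between {C : Type u} [CircularOrder C] {p i s : C}
    (h : IsCyclicSucc p i) (h' : IsCyclicSucc i s) (hps : p ≠ s) : sbtw p i s := by
  rcases sbtw_or_sbtw_of_ne h.1.symm h'.1.symm hps.symm with e | e
  · exact e
  · exact absurd (_root_.mem_closedArc.2 (Or.inr (Or.inr e.cyclic_right))) (h.2 s hps.symm h'.1)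

theorem CyclicMonotone.sbtw_map {C C' : Type u} [CircularOrder C] [CircularOrder C'] {F : C' → C}
    (hF : CyclicMonotone F) {x y z : C'} (h : sbtw x y z) (hxy : F x ≠ F y) (hyz : F y ≠ F z)
    (hzx : F z ≠ F x) : sbtw (F x) (F y) (F z) := by
  rcases sbtw_or_sbtw_of_ne hxy hyz hzx with e | e
  · exact e
  · exact absurd (hF _ _ _ e) (sbtw_asymm h)

namespace Pseudoflower

variable {Φ Φ' : Pseudoflower U k} {F : Φ'.C → Φ.C}

/-- The map `F` witnesses that `Φ'` extends `Φ`. -/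
structure IsExtension (Φ Φ' : Pseudoflower U k) (F : Φ'.C → Φ.C) : Prop where
  centre_eq : centre Φ.P = centre Φ'.P
  surjective : Function.Surjective F
  monotone : CyclicMonotone F
  image_eq : F '' Φ'.I = Φ.I
  intervalSet_eq : ∀ v, v ∉ Φ.I → ∀ w, w ∉ Φ.I →
    intervalSet Φ.P v w = centre Φ.P ∪ ⋃ z ∈ F ⁻¹' closedArc v w, Φ'.P z

namespace IsExtension

variable (h : IsExtension Φ Φ' F)

include h

theorem map_mem {z : Φ'.C} (hz : z ∈ Φ'.I) : F z ∈ Φ.I := h.image_eq ▸ ⟨z, hz, rfl⟩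

theorem notMem {z : Φ'.C} (hz : F z ∉ Φ.I) : z ∉ Φ'.I := fun e => hz (h.map_mem e)

/-- If x and y were distinct over one cutpoint, petals i and i' from the two arcs between them would
have the same image: otherwise monotonicity would place i and i' in the same order after both x and
y. All petals would then share one image, but Φ has at least two. -/
theorem eq_of_notMem {x y : Φ'.C} (hx : F x ∉ Φ.I) (hxy : F x = F y) : x = y := by
  by_contra hne
  have hy : F y ∉ Φ.I := hxy ▸ hx
  obtain ⟨i, hi, h1⟩ := Φ'.isCycleCompletion.exists_between (h.notMem hx) (h.notMem hy) hne
  obtain ⟨i', hi', h2⟩ :=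
    Φ'.isCycleCompletion.exists_between (h.notMem hy) (h.notMem hx) (Ne.symm hne)
  have key : ∀ i ∈ Φ'.I, ∀ i' ∈ Φ'.I, sbtw x i y → sbtw y i' x → F i = F i' := by
    intro i hi i' hi' h1 h2
    by_contra hii
    have e1 : F x ≠ F i := fun e => hx (e ▸ h.map_mem hi)
    have e2 : F i' ≠ F x := fun e => hx (e ▸ h.map_mem hi')
    rcases sbtw_or_sbtw_of_ne e1 hii e2 with e | e
    · have h3 := e
      rw [hxy] at h3
      have h3 := h.monotone _ _ _ h3
      obtain ⟨lo, -, hlo⟩ := exists_isLinearization x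
      rw [hlo.grindable] at *
      grind
    · have h3 := h.monotone _ _ _ e
      obtain ⟨lo, -, hlo⟩ := exists_isLinearization x
      rw [hlo.grindable] at *
      grind
  obtain ⟨j, hj, hji⟩ := Φ.isCycleCompletion.nontrivial.exists_ne (F i)
  rw [← h.image_eq] at hj
  obtain ⟨m, hm, rfl⟩ := hj
  have hmx : x ≠ m := fun e => h.notMem hx (e ▸ hm)
  have hmy : m ≠ y := fun e => h.notMem hy (e ▸ hm)
  rcases sbtw_or_sbtw_of_ne hmx hmy (Ne.symm hne) with e | e
  · exact hji ((key m hm i' hi' e h2).trans (key i hi i' hi' h1 h2).symm)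
  · exact hji (key i hi m hm h1 e).symm

/-- Since [v, v] = {v}, the extension condition at v = w compares the two sets up to the centre,
from which both are disjoint. -/
theorem P_eq {g : Φ'.C} (hg : F g ∉ Φ.I) : Φ'.P g = Φ.P (F g) := by
  have h1 := h.intervalSet_eq _ hg _ hg
  have h2 : F ⁻¹' closedArc (F g) (F g) = {g} := by
    ext z
    rw [Set.mem_preimage, mem_closedArc, Set.mem_singleton_iff]
    constructor
    · rintro (e | e | e)
      · exact (h.eq_of_notMem hg e.symm).symm
      · exact (h.eq_of_notMem hg e.symm).symm
      · exact absurd rfl (ne_of_sbtw e).2.2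
    · rintro rfl
      exact Or.inl rfl
  have h3 : intervalSet Φ.P (F g) (F g) = Φ.P (F g) ∪ centre Φ.P := by
    ext x
    rw [mem_intervalSet]
    simp only [mem_closedArc]
    constructor
    · rintro (⟨z, e | e | e, hx⟩ | hx)
      · exact Or.inl (e ▸ hx)
      · exact Or.inl (e ▸ hx)
      · exact absurd rfl (ne_of_sbtw e).2.2
      · exact Or.inr hx
    · rintro (hx | hx)
      · exact Or.inl ⟨_, Or.inl rfl, hx⟩
      · exact Or.inr hx
  rw [h2, h3, Set.biUnion_singleton] at h1
  have h4 := Set.disjoint_left.1 (Φ.disjoint_centre (F g))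
  have h5 := Set.disjoint_left.1 (Φ'.disjoint_centre g)
  rw [← h.centre_eq] at h5
  ext x
  have : x ∈ Φ.P (F g) ∪ centre Φ.P ↔ x ∈ centre Φ.P ∪ Φ'.P g := by rw [h1]
  have := @h4 x
  have := @h5 x
  grind

theorem preimage_closedArc {a b : Φ'.C} (ha : F a ∉ Φ.I) (hb : F b ∉ Φ.I) :
    F ⁻¹' closedArc (F a) (F b) = closedArc a b := by
  ext z
  rw [Set.mem_preimage, mem_closedArc, mem_closedArc]
  have e1 : F z = F a ↔ z = a := ⟨fun e => (h.eq_of_notMem ha e.symm).symm, fun e => e ▸ rfl⟩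
  have e2 : F z = F b ↔ z = b := ⟨fun e => (h.eq_of_notMem hb e.symm).symm, fun e => e ▸ rfl⟩
  rw [e1, e2]
  constructor
  · rintro (e | e | e)
    · exact Or.inl e
    · exact Or.inr (Or.inl e)
    · exact Or.inr (Or.inr (h.monotone _ _ _ e))
  · rintro (e | e | e)
    · exact Or.inl e
    · exact Or.inr (Or.inl e)
    · have h1 := ne_of_sbtw e
      exact Or.inr (Or.inr (h.monotone.sbtw_map e (fun e => h1.1 (e1.1 e.symm).symm)
        (fun e => h1.2.1 (e2.1 e)) fun e => h1.2.2 (h.eq_of_notMem hb e)))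

theorem intervalSet_map {a b : Φ'.C} (ha : F a ∉ Φ.I) (hb : F b ∉ Φ.I) :
    intervalSet Φ.P (F a) (F b) = intervalSet Φ'.P a b := by
  rw [h.intervalSet_eq _ ha _ hb, h.preimage_closedArc ha hb, h.centre_eq, intervalSet,
    Set.union_comm]

theorem intervalSep_map {a b : Φ'.C} (ha : F a ∉ Φ.I) (hb : F b ∉ Φ.I) :
    intervalSep Φ.P (F a) (F b) = intervalSep Φ'.P a b := by
  rw [intervalSep, intervalSep, h.intervalSet_map ha hb, h.intervalSet_map hb ha]

/-- P'_y lies in V(p,s) for the neighbours p, s of F y. The arc [p, s] has only these three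
elements, and the petal contains the sets of its neighbours. -/
theorem P_subset {y : Φ'.C} (hy : F y ∈ Φ.I) : Φ'.P y ⊆ Φ.P (F y) := by
  obtain ⟨p, s, hp, hs, hps, h1, h2, -⟩ := Φ.isCycleCompletion.exists_pred_succ hy
  intro x hx
  have h3 : x ∈ intervalSet Φ.P p s := by
    rw [h.intervalSet_eq _ hp _ hs]
    refine Or.inr (Set.mem_biUnion (x := y) ?_ hx)
    exact mem_closedArc.2 (Or.inr (Or.inr (h1.between h2 hps)))
  have h4 := Φ.neighbor_subset _ hy p s h1 h2
  rw [mem_intervalSet, h.centre_eq] at h3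
  obtain ⟨z, hz, hxz⟩ := h3.resolve_right (notMem_centre hx)
  rcases h1.mem_closedArc h2 hps hz with rfl | rfl | rfl
  · exact h4 (Or.inl hxz)
  · exact hxz
  · exact h4 (Or.inr hxz)

theorem symm (hinj : Function.Injective F) : Φ' ≤ Φ := by
  obtain ⟨G, hG1, hG2⟩ := Function.bijective_iff_has_inverse.1 ⟨hinj, h.surjective⟩
  have hI : ∀ z, F z ∈ Φ.I ↔ z ∈ Φ'.I := by
    intro z
    refine ⟨fun hz => ?_, h.map_mem⟩
    rw [← h.image_eq] at hz
    obtain ⟨z', hz', e⟩ := hz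
    exact hinj e ▸ hz'
  refine ⟨h.centre_eq.symm, G, fun z => ⟨F z, hG1 z⟩, fun x y z hs => ?_, ?_, fun v hv w hw => ?_⟩
  · have h1 := ne_of_sbtw hs
    rw [← hG2 x, ← hG2 y, ← hG2 z]
    exact h.monotone.sbtw_map hs (fun e => h1.1 (hinj e)) (fun e => h1.2.1 (hinj e))
      fun e => h1.2.2 (hinj e)
  · ext z
    constructor
    · rintro ⟨y, hy, rfl⟩
      rw [← hI, hG2]
      exact hy
    · intro hz
      exact ⟨F z, h.map_mem hz, hG1 z⟩
  · have hv' : F v ∉ Φ.I := fun e => hv ((hI v).1 e)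
    have hw' : F w ∉ Φ.I := fun e => hw ((hI w).1 e)
    have hpre : G ⁻¹' closedArc v w = closedArc (F v) (F w) := by
      rw [← h.preimage_closedArc hv' hw', ← Set.preimage_comp]
      ext z
      simp [hG2 z]
    rw [← h.intervalSet_map hv' hw', hpre, ← h.centre_eq, intervalSet, Set.union_comm]

end IsExtension

/-- The petals contain a cutpoint set. -/
theorem exists_subset_of_mem (Φ : Pseudoflower U k) {y : Φ.C} (hy : y ∈ Φ.I) :
    ∃ v, v ∉ Φ.I ∧ Φ.P v ⊆ Φ.P y := by
  obtain ⟨p, s, hp, hs, hps, h1, h2, -⟩ := Φ.isCycleCompletion.exists_pred_succ hy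
  exact ⟨p, hp, Set.subset_union_left.trans (Φ.neighbor_subset _ hy p s h1 h2)⟩

/-- A petal contains the set of some cutpoint, which already has the size of A. -/
theorem P_eq_of_subset (Φ : Pseudoflower U k) {y : Φ.C} (hy : y ∈ Φ.I) {A : Set V}
    (hA : 2 * A.encard + (centre Φ.P).encard = k) (hs : Φ.P y ⊆ A) : Φ.P y = A := by
  obtain ⟨v, hv, hvy⟩ := Φ.exists_subset_of_mem hy
  have : Φ.P v = A := by
    refine Set.Finite.eq_of_subset_of_encard_le ?_ (hvy.trans hs)
      (ENat.two_mul_add_cancel hA (Φ.encard_cutpoint v hv)).le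
    exact Set.encard_ne_top_iff.1 (Φ.encard_ne_top hv)
  exact hs.antisymm (this ▸ hvy)

end Pseudoflower
end Extensions

/-! ### Maximality of the subdivision -/

section Maximality

variable {V : Type u} {U : VertexUniverse V} {k : ℕ}

namespace Pseudoflower.Subdivision

variable {Φ : Pseudoflower U k} {D : Φ.Subdivision} {hU : U.IsLimitClosed} {Φ' : Pseudoflower U k}
  {F : Φ'.C → D.Node}

theorem P_subset_of_isExtension (h : IsExtension (D.refinement hU) Φ' F) {y : Φ'.C}
    (hy : y ∈ Φ'.I) : Φ'.P y ⊆ D.P (F y) := h.P_subset (h.map_mem hy)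

/-- A petal whose vertex set is a cutset is the only petal over its image. -/
theorem eq_of_P_eq_cutset (h : IsExtension (D.refinement hU) Φ' F) {i : Φ.C} (hi : i ∈ Φ.I)
    {S : VPair V} (hS : S ∈ D.chain i) {y z : Φ'.C} (hy : y ∈ Φ'.I) (hz : z ∈ Φ'.I)
    (hyS : Φ'.P y = Φ.cutset i S) (hyz : F y = F z) : y = z := by
  have hcentre : centre Φ.P = centre Φ'.P := (centre_P hU).symm.trans h.centre_eq
  obtain ⟨h1, h2, h3⟩ := D.pick_mem i hi S hS
  have hA : 2 * (Φ.cutset i S).encard + (centre Φ'.P).encard = k := by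
    rw [← hcentre]
    exact encard_cutset (D := D) (κ := Cut.mk S false) hi (mk_false_mem_cuts hS)
  -- Any petal of Φ' over the doubled split of this cutset has the cutset as its vertex set, so it
  -- is y by the last axiom for Φ'. Hence y, and with it z, lies over that doubled split.
  have hjump := isJump_doubled h1 h2 ((congrArg D.pick h3).trans Prod.mk.eta.symm)
  have key : ∀ x ∈ Φ'.I, F x = D.jumpNode hjump → y = x := by
    intro x hx hxF
    refine Φ'.petal_injective y hy x hx (by rw [hyS]; exact hA) ?_
    rw [hyS]
    refine (Φ'.P_eq_of_subset hx hA ((P_subset_of_isExtension h hx).trans ?_)).symm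
    rw [hxF]
    refine Set.Subset.trans (fun v hv => ?_) h3.le
    obtain ⟨a1, a2, a3⟩ := (mem_P_jumpNode hjump).1 hv
    exact ⟨⟨a1, a3⟩, a2⟩
  have hj : D.jumpNode hjump ∈ F '' Φ'.I := by
    have e : F '' Φ'.I = D.petals := h.image_eq
    rw [e]
    exact jumpNode_mem hjump
  obtain ⟨x, hx, hxF⟩ := hj
  have hyx := key x hx hxF
  exact key z hz (by rw [← hyz, hyx, hxF])

/-- A cutpoint z over the jump from κ to μ makes S(w',z) a split between the two, so by maximality
of the chain it is one of them. The petals x and y of Φ' next to z on its two sides have the same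
image, and one of them has a cutset as its vertex set, which contradicts `eq_of_P_eq_cutset`. -/
theorem map_notMem_petals (h : IsExtension (D.refinement hU) Φ' F) {z : Φ'.C} (hz : z ∉ Φ'.I) :
    F z ∉ D.petals := by
  intro hzF
  have hi := base_mem_of_mem_petals hzF
  obtain ⟨κ, μ, hj, hzj⟩ := exists_eq_jumpNode hzF
  generalize (F z).base = i at hi hj hzj
  obtain ⟨p, hp, hpj, hpP, hpW, hpκ⟩ := exists_pred_jumpNode hU hi hj
  obtain ⟨s, hs, hjs, hsP, hsW, hsμ⟩ := exists_succ_jumpNode hU hi hj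
  have ho := D.isOpposite i hi
  have hm := D.isMax i hi
  have hWI := vnode_notMem (D := D) (D.opp i) (opp_mem hi)
  have hWj := vnode_ne (D := D) (v := D.opp i) (opp_mem hi) (n := D.jumpNode hj) hi
  have hPW : D.P (D.vnode (D.opp i) (opp_mem hi)) = Φ.P (D.opp i) := P_vnode _ _
  generalize D.vnode (D.opp i) (opp_mem hi) = W at *
  have hmono : CyclicMonotone F := h.monotone
  have hI' : ∀ x, F x ∉ D.petals → x ∉ Φ'.I := fun x hx => h.notMem hx
  have hmem : ∀ x ∈ Φ'.I, F x ∈ D.petals := fun x hx => h.map_mem hx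
  have hsep : ∀ a b, F a ∉ D.petals → F b ∉ D.petals →
      intervalSep D.P (F a) (F b) = intervalSep Φ'.P a b := fun a b ha hb => h.intervalSep_map ha hb
  have hP : ∀ a, F a ∉ D.petals → Φ'.P a = D.P (F a) := fun a ha => h.P_eq ha
  obtain ⟨w', rfl⟩ : ∃ w', F w' = W := h.surjective W
  obtain ⟨p', rfl⟩ : ∃ p', F p' = p := h.surjective p
  obtain ⟨s', rfl⟩ : ∃ s', F s' = s := h.surjective s
  rw [← hzj] at hpj hjs hWj
  have hwpz : sbtw w' p' z := by
    apply hmono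
    rcases sbtw_or_sbtw_of_ne hpW hpj.1.symm hWj.symm with e | e
    · exact e
    · exact absurd (mem_closedArc.2 (Or.inr (Or.inr e.cyclic_left))) (hpj.2 _ hpW hWj)
  have hzsw : sbtw z s' w' := by
    apply hmono
    rcases sbtw_or_sbtw_of_ne hjs.1.symm hsW.symm hWj with e | e
    · exact e
    · exact absurd (mem_closedArc.2 (Or.inr (Or.inr e.cyclic_right))) (hjs.2 _ hWj hsW)
  have hzw : w' ≠ z := (ne_of_sbtw hwpz).2.2.symm
  rw [hsep _ _ hWI hp] at hpκ
  rw [hsep _ _ hWI hs] at hsμ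
  have hκT : κ.sep ≤ intervalSep Φ'.P w' z := hpκ ▸ intervalSep_le hwpz
  have hTμ : intervalSep Φ'.P w' z ≤ μ.sep := hsμ ▸ intervalSep_le hzsw.cyclic_right
  have hw'I := hI' _ hWI
  have hT : intervalSep Φ'.P w' z ∈ D.chain i := by
    refine hm.maximal _ ⟨Φ'.sep_mem _ hw'I _ hz hzw, Φ'.sep_order _ hw'I _ hz hzw,
      (hm.subset hj.1.1).2.2.1.trans hκT, hTμ.trans (hm.subset hj.2.1.1).2.2.2⟩ fun S hS => ?_
    rcases hj.2.2.2 _ (mk_false_mem_cuts hS) with e | e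
    · exact Or.inr ((Cut.sep_le e).trans hκT)
    · exact Or.inl (hTμ.trans (Cut.sep_le e))
  obtain ⟨x, hx, hpxz⟩ := Φ'.isCycleCompletion.exists_between (hI' _ hp) hz (ne_of_sbtw hwpz).2.1
  obtain ⟨y, hy, hzys⟩ := Φ'.isCycleCompletion.exists_between hz (hI' _ hs) (ne_of_sbtw hzsw).1
  have hxz : F x = F z := by
    by_contra hne
    exact hpj.2 (F x) (fun e => hp (e ▸ hmem x hx)) hne (mem_closedArc.2 (Or.inr (Or.inr
      (hmono.sbtw_map hpxz (fun e => hp (e ▸ hmem x hx)) hne hpj.1))))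
  have hyz : F y = F z := by
    by_contra hne
    exact hjs.2 (F y) hne (fun e => hs (e ▸ hmem y hy)) (mem_closedArc.2 (Or.inr (Or.inr
      (hmono.sbtw_map hzys (Ne.symm hne) (fun e => hs (e ▸ hmem y hy)) hjs.1))))
  have hxy : x ≠ y := by
    rintro rfl
    obtain ⟨lo, -, hlo⟩ := exists_isLinearization z
    rw [hlo.grindable] at *
    grind
  have hdisj : ∀ v ∈ Φ'.I, F v = F z → Disjoint (Φ'.P v) (Φ'.P w') := by
    intro v hv hvz
    rw [hP _ hWI, hPW]
    refine (ho.disjoint.mono_right ((P_subset_of_isExtension h hv).trans ?_)).symm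
    rw [hvz, hzj]
    exact P_subset _
  have hcentre : centre Φ.P = centre Φ'.P := (centre_P hU).symm.trans h.centre_eq
  have hsize : ∀ {ν : Cut V}, ν ∈ D.cuts i →
      2 * (Φ.cutset i ν.sep).encard + (centre Φ'.P).encard = k := fun hν => by
    rw [← hcentre]
    exact encard_cutset hi hν
  -- If the split is κ, then P'_x lies on both sides of S(w',p') and avoids P'_{w'}, so it is
  -- contained in P'_{p'}, the cutset of κ. The case of μ is symmetric, with y and s'.
  rcases hj.2.2.2 _ (mk_false_mem_cuts hT) with e | e
  · have hE : intervalSep Φ'.P w' p' = intervalSep Φ'.P w' z :=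
      hpκ.trans (hκT.antisymm (Cut.sep_le e))
    refine hxy (eq_of_P_eq_cutset h hi hj.1.1 hx hy ?_ (hxz.trans hyz.symm))
    refine Φ'.P_eq_of_subset hx (hsize hj.1) fun v hv => ?_
    rw [← hpP, ← hP _ hp]
    have h1 : v ∈ intervalSet Φ'.P w' p' := by
      have : v ∈ intervalSet Φ'.P w' z := by
        refine subset_intervalSet (mem_closedArc.2 (Or.inr (Or.inr ?_))) hv
        obtain ⟨lo, -, hlo⟩ := exists_isLinearization z
        rw [hlo.grindable] at *
        grind
      have hE' : intervalSet Φ'.P w' p' = intervalSet Φ'.P w' z := congrArg VPair.left hE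
      rwa [hE']
    have h2 : v ∈ intervalSet Φ'.P p' w' := by
      refine subset_intervalSet (mem_closedArc.2 (Or.inr (Or.inr ?_))) hv
      obtain ⟨lo, -, hlo⟩ := exists_isLinearization z
      rw [hlo.grindable] at *
      grind
    rcases Φ'.sepAt hw'I (hI' _ hp) (ne_of_sbtw hwpz).1 v h1 h2 with (h3 | h3) | h3
    · exact absurd h3 (Set.disjoint_left.1 (hdisj x hx hxz) hv)
    · exact h3
    · exact absurd h3 (notMem_centre hv)
  · have hE : intervalSep Φ'.P w' s' = intervalSep Φ'.P w' z :=
      hsμ.trans ((Cut.sep_le e).antisymm hTμ)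
    refine hxy (eq_of_P_eq_cutset h hi hj.2.1.1 hy hx ?_ (hyz.trans hxz.symm)).symm
    refine Φ'.P_eq_of_subset hy (hsize hj.2.1) fun v hv => ?_
    rw [← hsP, ← hP _ hs]
    have h1 : v ∈ intervalSet Φ'.P w' s' := by
      refine subset_intervalSet (mem_closedArc.2 (Or.inr (Or.inr ?_))) hv
      obtain ⟨lo, -, hlo⟩ := exists_isLinearization z
      rw [hlo.grindable] at *
      grind
    have h2 : v ∈ intervalSet Φ'.P s' w' := by
      have : v ∈ intervalSet Φ'.P z w' := by
        refine subset_intervalSet (mem_closedArc.2 (Or.inr (Or.inr ?_))) hv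
        obtain ⟨lo, -, hlo⟩ := exists_isLinearization z
        rw [hlo.grindable] at *
        grind
      have hE' : intervalSet Φ'.P s' w' = intervalSet Φ'.P z w' := congrArg VPair.right hE
      rwa [hE']
    rcases Φ'.sepAt hw'I (hI' _ hs) (ne_of_sbtw hzsw).2.1.symm v h1 h2 with (h3 | h3) | h3
    · exact absurd h3 (Set.disjoint_left.1 (hdisj y hy hyz) hv)
    · exact h3
    · exact absurd h3 (notMem_centre hv)

/-- Two petals x, y over the same node are impossible: the cutpoints p and s next to x map to
cutpoints, and y lies on the other arc between them, so the common image would lie on both sides. -/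
theorem injective_of_isExtension (h : IsExtension (D.refinement hU) Φ' F) :
    Function.Injective F := by
  intro x y hxy
  by_cases hxI : F x ∈ D.petals
  · by_contra hne
    have hx : x ∈ Φ'.I := not_imp_comm.1 (map_notMem_petals h) (not_not.2 hxI)
    have hy : y ∈ Φ'.I := not_imp_comm.1 (map_notMem_petals h) (not_not.2 (hxy ▸ hxI))
    obtain ⟨p, s, hp, hs, hps, h1, h2, h3⟩ := Φ'.isCycleCompletion.exists_pred_succ hx
    have hpF := map_notMem_petals h hp
    have hsF := map_notMem_petals h hs
    have hpx : F p ≠ F x := fun e => hpF (e ▸ hxI)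
    have hsx : F s ≠ F x := fun e => hsF (e ▸ hxI)
    have hpsF : F p ≠ F s := fun e => hps (h.eq_of_notMem hpF e)
    have hmono : CyclicMonotone F := h.monotone
    have e1 := hmono.sbtw_map (h1.between h2 hps) hpx hsx.symm hpsF.symm
    rcases h3 y with e | e | e | e
    · exact hp (e ▸ hy)
    · exact hne e.symm
    · exact hs (e ▸ hy)
    · have e2 := hmono.sbtw_map e (hxy ▸ hsx) (hxy ▸ hpx.symm) hpsF
      rw [← hxy] at e2
      exact sbtw_asymm e1 e2
  · exact h.eq_of_notMem hxI hxy

theorem le_of_refinement_le (D : Φ.Subdivision) (hU : U.IsLimitClosed)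
    (h : D.refinement hU ≤ Φ') : Φ' ≤ D.refinement hU := by
  obtain ⟨h1, F, h2, h3, h4, h5⟩ := h
  have hF : IsExtension (D.refinement hU) Φ' F := ⟨h1, h2, h3, h4, h5⟩
  exact hF.symm (injective_of_isExtension hF)

end Pseudoflower.Subdivision
end Maximality

theorem mainTheorem1 {V : Type u} (U : VertexUniverse V) (hU : U.IsLimitClosed) (k : ℕ)
    (Prof : Set (Set (VPair V)))
    (hProf : ∀ P ∈ Prof, U.IsProfile (k + 1) P)
    (hk : ∀ P ∈ Prof, ∀ Q ∈ Prof, ∀ s ∈ U.seps, Distinguishes s P Q → (k : ℕ∞) ≤ s.order)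
    (Φ : Pseudoflower U k)
    (hΦ : ∃ P₁ ∈ Prof, ∃ P₂ ∈ Prof, ∃ P₃ ∈ Prof,
      Φ.Locates P₁ ∧ Φ.Locates P₂ ∧ Φ.Locates P₃ ∧
      Φ.DistinguishesProfiles P₁ P₂ ∧ Φ.DistinguishesProfiles P₁ P₃ ∧
      Φ.DistinguishesProfiles P₂ P₃) :
    ∃ Ψ : Pseudoflower U k, Φ ≤ Ψ ∧ ∀ Ψ' : Pseudoflower U k, Ψ ≤ Ψ' → Ψ' ≤ Ψ := by
  obtain ⟨P₁, h₁, P₂, h₂, P₃, h₃, l₁, l₂, l₃, d₁₂, d₁₃, d₂₃⟩ := hΦ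
  obtain ⟨a, b, c, ht⟩ := Pseudoflower.exists_isTripod
    ⟨hProf _ h₁, hProf _ h₂, hk _ h₁ _ h₂, d₁₂⟩ ⟨hProf _ h₁, hProf _ h₃, hk _ h₁ _ h₃, d₁₃⟩
    ⟨hProf _ h₂, hProf _ h₃, hk _ h₂ _ h₃, d₂₃⟩ l₁ l₂ l₃
  obtain ⟨D⟩ := ht.exists_subdivision
  exact ⟨D.refinement hU, D.le_refinement hU, fun Ψ' h => D.le_of_refinement_le hU h⟩
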